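/- **Theorem 1.5 (Bianchi).** Let $d\ge 1$ be a squarefree integer with $d\neq 1,3$, let $\mathcal O_d$ be the ring of integers of $\mathbb Q(i\sqrt d)$, and let $\mathrm{Bi}(d)=\mathrm{PSL}(2,\mathcal O_d)$. *Setting.* Let $\mathrm{SU}(3,1)\subset \mathrm{SL}(4,\mathbb C)$ be the special unitary group of the Hermitian form $\langle z,z\rangle=2\,\mathrm{Re}(z_1\overline{z_4})+|z_2|^2+|z_3|^2$. Complex hyperbolic space $\mathrm H^3_{\mathbb C}\subset\mathbb{CP}^3$ is the set of negative lines, its boundary is the set of null lines, and $\mathrm H^3_{\mathbb R}=\{x\in\mathbb R^4:\langle x,x\rangle=-1,\ x_1>0\}$. Regard $\iota:\mathrm{Bi}(d)\hookrightarrow \mathrm{SO}(3,1)\subset\mathrm{SU}(3,1)$ through the isomorphism $\mathrm{PSL}(2,\mathbb C)\simeq\mathrm{SO}^0(3,1)$ given by the action $X\mapsto AXA^*$ on Hermitian matrices $X=\begin{pmatrix}\sqrt2x_1&-x_2+ix_3\\-x_2-ix_3&-\sqrt2x_4\end{pmatrix}$ (so that $\langle x,x\rangle=-\det X$). An element of $\mathrm{SU}(3,1)$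 is *parabolic* if it has no fixed point in $\mathrm H^3_{\mathbb C}$ and exactly one on the boundary, and *boundary elliptic* if it acts non-trivially and fixes both a point of $\mathrm H^3_{\mathbb C}$ and a point of the boundary. A representation $\rho:\mathrm{Bi}(d)\to\mathrm{SU}(3,1)$ is *parabolic-preserving* if $\rho(\gamma)$ is parabolic (resp. boundary elliptic) whenever $\iota(\gamma)$ is. It is *strongly parabolic-preserving* if moreover $\rho(\Lambda)$ is discrete for every parabolic subgroup $\Lambda$ of $\mathrm{Bi}(d)$, that is, for the stabilizer $\Lambda$ of any boundary point fixed by some $\gamma$ with $\iota(\gamma)$ parabolic. *Bending.* Let $P=\{x_3=0\}\subset \mathrm H^3_{\mathbb R}$, and for $v\in\mathrm U(1)$ let $g_v=\mathrm{diag}(v,v,v^{-3},v)\in\mathrm{SU}(3,1)$, which in $\mathrm{PU}(3,1)$ is $\mathrm{diag}(1,1,u,1)$ with $u=v^{-4}$. Let $C$ and $C'$ be the connected components of $\mathrm H^3_{\mathbb R}\setminus\bigcup_{\gamma\in\mathrm{Bi}(d)}\iota(\gamma)P$ that have $P$ in their closure and lie in $\{x_3<0\}$ and $\{x_3>0\}$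 respectively. A *bending of $\mathrm{Bi}(d)$ along the modular surface by $g_v$* is a representation $\rho:\mathrm{Bi}(d)\to\mathrm{SU}(3,1)$ with $\rho(\gamma)=\iota(\gamma)$ whenever $\gamma C=C$, and $\rho(z)=g_v\,\iota(z)$ whenever $zC=C'$ (the stable letters of the HNN decomposition given by the surface). This notion includes the requirements that each translate of $P$ equals $P$ or is disjoint from it (the surface is embedded), that some $z$ with $zC=C'$ exists (the surface is non-separating), and that $g_v$ commutes with $\iota(\gamma)$ for all $\gamma$ stabilizing $P$. *Conclusion.* 1. The stabilizer of $P$ in $\mathrm{Bi}(d)$ is $\mathrm{PSL}(2,\mathbb Z)$ (so $P$ covers the modular surface), and the centralizer of $\iota(\mathrm{PSL}(2,\mathbb Z))$ in $\mathrm{SU}(3,1)$ is $\{g_v: v\in\mathrm U(1)\}$. 2. For every $v\in\mathrm U(1)$ there is exactly one bending $\rho_v$ of $\mathrm{Bi}(d)$ along the modular surface by $g_v$. 3. For every $v\in\mathrm U(1)$ with $v^4\neq-1$ (that is, $u\ne-1$), $\rho_v$ is parabolic-preserving; if moreover $d\equiv 1$ or $2 \pmod 4$, then $\rho_v$ is strongly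 parabolic-preserving. -/

import Mathlib

open scoped Matrix LinearAlgebra.Projectivization MatrixGroups NumberField

noncomputable section

namespace Bianchi

/-! ### Complex hyperbolic 3-space in the Siegel model and the group SU(3,1) -/

/-- The Hermitian form of signature (3,1), `⟨z,z⟩ = 2 Re (z₀ conj z₃) + |z₁|² + |z₂|²`. -/
def J : Matrix (Fin 4) (Fin 4) ℂ :=
  !![0, 0, 0, 1; 0, 1, 0, 0; 0, 0, 1, 0; 1, 0, 0, 0]

/-- The real number `⟨z,z⟩`. -/
def hnorm (z : Fin 4 → ℂ) : ℝ :=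
  2 * (z 0 * star (z 3)).re + ‖z 1‖ ^ 2 + ‖z 2‖ ^ 2

/-- `SU(3,1)`: determinant one matrices preserving the Hermitian form. -/
def SU31 : Subgroup (Matrix.SpecialLinearGroup (Fin 4) ℂ) where
  carrier := {g | (g : Matrix (Fin 4) (Fin 4) ℂ)ᴴ * J * (g : Matrix (Fin 4) (Fin 4) ℂ) = J}
  one_mem' := by simp
  mul_mem' := by
    intro a b ha hb
    simp only [Set.mem_ofPred_eq] at ha hb ⊢
    rw [Matrix.SpecialLinearGroup.coe_mul, Matrix.conjTranspose_mul]
    calc _ = (b : Matrix (Fin 4) (Fin 4) ℂ)ᴴ *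
          ((a : Matrix (Fin 4) (Fin 4) ℂ)ᴴ * J * (a : Matrix (Fin 4) (Fin 4) ℂ)) *
            (b : Matrix (Fin 4) (Fin 4) ℂ) := by simp only [Matrix.mul_assoc]
      _ = J := by rw [ha, hb]
  inv_mem' := by
    intro a ha
    simp only [Set.mem_ofPred_eq] at ha ⊢
    have h1 : (a : Matrix (Fin 4) (Fin 4) ℂ) * ((a⁻¹ : SL(4, ℂ)) : Matrix (Fin 4) (Fin 4) ℂ) = 1 := by
      rw [← Matrix.SpecialLinearGroup.coe_mul, mul_inv_cancel, Matrix.SpecialLinearGroup.coe_one]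
    have h2 : ((a⁻¹ : SL(4, ℂ)) : Matrix (Fin 4) (Fin 4) ℂ)ᴴ * (a : Matrix (Fin 4) (Fin 4) ℂ)ᴴ = 1 := by
      rw [← Matrix.conjTranspose_mul, h1, Matrix.conjTranspose_one]
    conv_lhs => rw [← ha]
    calc _ = (((a⁻¹ : SL(4, ℂ)) : Matrix (Fin 4) (Fin 4) ℂ)ᴴ * (a : Matrix (Fin 4) (Fin 4) ℂ)ᴴ) * J *
          ((a : Matrix (Fin 4) (Fin 4) ℂ) * ((a⁻¹ : SL(4, ℂ)) : Matrix (Fin 4) (Fin 4) ℂ)) := by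
            simp only [Matrix.mul_assoc]
      _ = J := by rw [h1, h2]; simp

/-- Complex hyperbolic space: the negative complex lines. -/
def HC : Set (ℙ ℂ (Fin 4 → ℂ)) := {p | hnorm p.rep < 0}

/-- Its boundary at infinity: the null complex lines. -/
def bdryHC : Set (ℙ ℂ (Fin 4 → ℂ)) := {p | hnorm p.rep = 0}

/-- Parabolic: no fixed point in the space and exactly one on the boundary. -/
def IsParabolic (g : SU31) : Prop :=
  (∀ p ∈ HC, (g : SL(4, ℂ)) • p ≠ p) ∧ ∃! p, p ∈ bdryHC ∧ (g : SL(4, ℂ)) • p = p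

/-- Boundary elliptic: a nontrivial isometry with a fixed point in the space and a fixed point
on the boundary. -/
def IsBoundaryElliptic (g : SU31) : Prop :=
  (∃ p ∈ HC, (g : SL(4, ℂ)) • p ≠ p) ∧ (∃ p ∈ HC, (g : SL(4, ℂ)) • p = p) ∧
    ∃ p ∈ bdryHC, (g : SL(4, ℂ)) • p = p

section Representations

variable {Γ : Type*} [Group Γ]

/-- `ρ` is parabolic-preserving with respect to the reference representation `i` (the inclusion
of a discrete group). -/
def ParabolicPreserving (i ρ : Γ →* SU31) : Prop :=
  ∀ γ, (IsParabolic (i γ) → IsParabolic (ρ γ)) ∧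
    (IsBoundaryElliptic (i γ) → IsBoundaryElliptic (ρ γ))

/-- A parabolic subgroup: the stabilizer of a boundary point fixed by some parabolic element. -/
def IsParabolicSubgroup (i : Γ →* SU31) (Λ : Subgroup Γ) : Prop :=
  ∃ p ∈ bdryHC, (∃ γ, IsParabolic (i γ) ∧ (i γ : SL(4, ℂ)) • p = p) ∧
    ∀ γ, γ ∈ Λ ↔ (i γ : SL(4, ℂ)) • p = p

/-- Strongly parabolic-preserving: moreover the image of each parabolic subgroup is discrete. -/
def StronglyParabolicPreserving (i ρ : Γ →* SU31) : Prop :=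
  ParabolicPreserving i ρ ∧ ∀ Λ, IsParabolicSubgroup i Λ → DiscreteTopology (Λ.map ρ)

/-! ### Bending along a totally geodesic plane of real hyperbolic 3-space -/

/-- Real hyperbolic 3-space: the sheet `x₀ > 0` of the hyperboloid `⟨x,x⟩ = -1` in `ℝ⁴ ⊂ ℂ⁴`. -/
def HR : Set (Fin 4 → ℂ) := {x | (∀ j, (x j).im = 0) ∧ hnorm x = -1 ∧ 0 < (x 0).re}

/-- The totally geodesic plane `x₂ = 0`. -/
def plane : Set (Fin 4 → ℂ) := {x | x ∈ HR ∧ x 2 = 0}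

/-- The image of a subset of `ℂ⁴` under the isometry `i γ`. -/
def move (i : Γ →* SU31) (γ : Γ) (s : Set (Fin 4 → ℂ)) : Set (Fin 4 → ℂ) :=
  (fun x => (i γ : SL(4, ℂ)) • x) '' s

/-- The preimage in `HR` of the complement of the surface. -/
def complement (i : Γ →* SU31) : Set (Fin 4 → ℂ) := HR \ ⋃ γ, move i γ plane

/-- The connected components of this preimage. -/
def IsRegion (i : Γ →* SU31) (C : Set (Fin 4 → ℂ)) : Prop :=
  ∃ x ∈ complement i, C = connectedComponentIn (complement i) x

/-- `ρ` is the bending of `i : Γ → SO(3,1) ⊂ SU(3,1)` by `g` along the surface covered by `plane`,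
in the case where that surface is embedded and non-separating.

The regions `C` and `C'` are those lying on the two sides of `plane`. The stabilizer `Γ'` of `C`
is the fundamental group of the complement of the surface, and an element `z` carrying `C` to `C'`
is a stable letter: `z⁻¹ Δ z ⊂ Γ'`, where `Δ ⊂ Γ'` is the stabilizer of `plane`. The representation
`ρ` is `i` on `Γ'` and `g * i z` at the stable letter. -/
structure IsBending (i : Γ →* SU31) (g : SU31) (ρ : Γ →* SU31) : Prop where
  embedded : ∀ γ, move i γ plane = plane ∨ Disjoint (move i γ plane) plane
  centralizes : ∀ γ, move i γ plane = plane → i γ * g = g * i γ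
  hnn : ∃ C C', IsRegion i C ∧ IsRegion i C' ∧ plane ⊆ closure C ∧ plane ⊆ closure C' ∧
    (∀ x ∈ C, (x 2).re < 0) ∧ (∀ x ∈ C', 0 < (x 2).re) ∧
    (∀ γ, move i γ C = C → ρ γ = i γ) ∧
    (∃ z, move i z C = C') ∧
    (∀ z, move i z C = C' → ρ z = g * i z)

end Representations

/-! ### The isomorphism from PSL(2,ℂ) to the identity component of SO(3,1) -/

/-- Identification of `ℂ⁴` with the complex 2×2 matrices; the real vectors correspond to the
Hermitian matrices and `2 x₀ x₃ + x₁² + x₂²` to minus the determinant. -/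
def toHerm : (Fin 4 → ℂ) ≃ₗ[ℂ] Matrix (Fin 2) (Fin 2) ℂ where
  toFun w := !![(√2 : ℝ) * w 0, - w 1 + Complex.I * w 2;
    - w 1 - Complex.I * w 2, - (√2 : ℝ) * w 3]
  invFun X := ![X 0 0 / (√2 : ℝ), - (X 0 1 + X 1 0) / 2, - Complex.I * (X 0 1 - X 1 0) / 2,
    - X 1 1 / (√2 : ℝ)]
  map_add' v w := by
    ext a b; fin_cases a <;> fin_cases b <;> simp <;> ring
  map_smul' c w := by
    ext a b; fin_cases a <;> fin_cases b <;> simp <;> ring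
  left_inv w := by
    have h : ((√2 : ℝ) : ℂ) ≠ 0 := by simp
    ext a
    fin_cases a
    · simp [h]
    · simp
    · simp; ring_nf; simp
    · simp [h]
  right_inv X := by
    have h : ((√2 : ℝ) : ℂ) ≠ 0 := by simp
    ext a b
    fin_cases a <;> fin_cases b
    · simp; field_simp
    · simp; ring_nf; simp; ring
    · simp; ring_nf; simp; ring
    · simp; field_simp

/-- The action `X ↦ A X Aᴴ`, read in `ℂ⁴`. -/
def spinLin (A : Matrix (Fin 2) (Fin 2) ℂ) : (Fin 4 → ℂ) →ₗ[ℂ] (Fin 4 → ℂ) :=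
  toHerm.symm.toLinearMap ∘ₗ (LinearMap.mulLeft ℂ A ∘ₗ LinearMap.mulRight ℂ Aᴴ) ∘ₗ
    toHerm.toLinearMap

theorem spinLin_mul (A B : Matrix (Fin 2) (Fin 2) ℂ) :
    spinLin (A * B) = spinLin A ∘ₗ spinLin B := by
  ext1 j
  ext1
  simp [spinLin, Matrix.mul_assoc]

theorem spinLin_one : spinLin 1 = LinearMap.id := by
  ext1 j
  ext1
  simp [spinLin]

theorem spinLin_det (A : Matrix (Fin 2) (Fin 2) ℂ) (hA : A.det = 1) :
    LinearMap.det (spinLin A) = 1 := by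
  have h1 : LinearMap.det (spinLin A) =
      LinearMap.det (LinearMap.mulLeft ℂ A ∘ₗ LinearMap.mulRight ℂ Aᴴ) := by
    have := LinearMap.det_conj (LinearMap.mulLeft ℂ A ∘ₗ LinearMap.mulRight ℂ Aᴴ) toHerm.symm
    simpa [spinLin] using this
  have h2 : ∀ M N : Matrix (Fin 2) (Fin 2) ℂ,
      LinearMap.det (LinearMap.mulLeft ℂ M ∘ₗ LinearMap.mulRight ℂ N) = M.det ^ 2 * N.det ^ 2 := by
    intro M N
    rw [← LinearMap.det_toMatrix (Matrix.stdBasis ℂ (Fin 2) (Fin 2))]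
    have : LinearMap.toMatrix (Matrix.stdBasis ℂ (Fin 2) (Fin 2))
        (Matrix.stdBasis ℂ (Fin 2) (Fin 2)) (LinearMap.mulLeft ℂ M ∘ₗ LinearMap.mulRight ℂ N)
        = Matrix.kroneckerMap (· * ·) M Nᵀ := by
      ext ⟨a, b⟩ ⟨c, e⟩
      rw [LinearMap.toMatrix_apply]
      fin_cases a <;> fin_cases b <;> fin_cases c <;> fin_cases e <;>
        simp [Matrix.stdBasis, Matrix.mul_apply]
    rw [this, Matrix.det_kronecker]
    simp
  rw [h1, h2, hA, Matrix.det_conjTranspose, hA]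
  simp

/-- `x₀ y₃ + x₁ y₁ + x₂ y₂ + x₃ y₀` is the polarization of minus the determinant. -/
theorem form_eq (v w : Fin 4 → ℂ) : v ⬝ᵥ J *ᵥ w =
    -((toHerm v + toHerm w).det - (toHerm v).det - (toHerm w).det) / 2 := by
  have h : ((√2 : ℝ) : ℂ) ^ 2 = 2 := by
    rw [← Complex.ofReal_pow]; simp
  have h' : Complex.I ^ 2 = -1 := Complex.I_sq
  simp [toHerm, J, Matrix.det_fin_two, dotProduct, Matrix.mulVec, Fin.sum_univ_four]
  linear_combination (-(v 0 * w 3 + v 3 * w 0) / 2) * h + (v 2 * w 2) * h'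

theorem toHerm_star (w : Fin 4 → ℂ) : toHerm (star w) = (toHerm w)ᴴ := by
  ext a b
  fin_cases a <;> fin_cases b <;> simp [toHerm, Matrix.conjTranspose_apply]; ring

theorem toHerm_spinLin (A : Matrix (Fin 2) (Fin 2) ℂ) (w : Fin 4 → ℂ) :
    toHerm (spinLin A w) = A * toHerm w * Aᴴ := by
  simp [spinLin, Matrix.mul_assoc]

theorem spinLin_star (A : Matrix (Fin 2) (Fin 2) ℂ) (w : Fin 4 → ℂ) :
    spinLin A (star w) = star (spinLin A w) := by
  apply toHerm.injective
  simp [toHerm_spinLin, toHerm_star, Matrix.conjTranspose_mul, Matrix.mul_assoc]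

theorem spinLin_form (A : Matrix (Fin 2) (Fin 2) ℂ) (hA : A.det = 1) (v w : Fin 4 → ℂ) :
    spinLin A v ⬝ᵥ J *ᵥ spinLin A w = v ⬝ᵥ J *ᵥ w := by
  rw [form_eq, form_eq, ← map_add, ← map_add, toHerm_spinLin, toHerm_spinLin, toHerm_spinLin]
  simp [Matrix.det_mul, Matrix.det_conjTranspose, hA]

theorem spinLin_mem (A : Matrix (Fin 2) (Fin 2) ℂ) (hA : A.det = 1) :
    (LinearMap.toMatrix' (spinLin A))ᴴ * J * LinearMap.toMatrix' (spinLin A) = J := by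
  have key : ∀ v w : Fin 4 → ℂ, v ⬝ᵥ ((LinearMap.toMatrix' (spinLin A))ᴴ * J *
      LinearMap.toMatrix' (spinLin A)) *ᵥ w = v ⬝ᵥ J *ᵥ w := by
    intro v w
    obtain ⟨v', rfl⟩ : ∃ v', v = star v' := ⟨star v, (star_star v).symm⟩
    rw [← spinLin_form A hA (star v') w, spinLin_star, ← LinearMap.toMatrix'_mulVec (spinLin A) v',
      ← LinearMap.toMatrix'_mulVec (spinLin A) w, Matrix.star_mulVec, ← Matrix.dotProduct_mulVec,
      Matrix.mulVec_mulVec, Matrix.mulVec_mulVec, Matrix.mul_assoc]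
  ext a b
  have := key (Pi.single a 1) (Pi.single b 1)
  simpa using this

/-- The homomorphism `SL(2,ℂ) → SO(3,1) ⊂ SU(3,1)` given by the action `X ↦ A X Aᴴ` on
Hermitian matrices. -/
def spin : SL(2, ℂ) →* SU31 where
  toFun A := ⟨⟨LinearMap.toMatrix' (spinLin A.1), by
    rw [LinearMap.det_toMatrix']; exact spinLin_det A.1 A.2⟩, spinLin_mem A.1 A.2⟩
  map_one' := by
    apply Subtype.ext
    apply Subtype.ext
    simp [spinLin_one]
  map_mul' A B := by
    apply Subtype.ext
    apply Subtype.ext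
    change LinearMap.toMatrix' (spinLin (A.1 * B.1)) = _
    rw [spinLin_mul, LinearMap.toMatrix'_comp]
    rfl

/-! ### The Bianchi groups -/

/-- The imaginary quadratic field `ℚ(i√d)`. -/
abbrev Qd (d : ℕ) : IntermediateField ℚ ℂ :=
  IntermediateField.adjoin ℚ {Complex.I * (√(d : ℝ) : ℝ)}

/-- The Bianchi group `PSL(2, 𝓞_d)`. -/
abbrev Bi (d : ℕ) : Type := PSL(2, 𝓞 (Qd d))

/-- The inclusion of rings `𝓞_d → ℂ`. -/
def intEmb (d : ℕ) : 𝓞 (Qd d) →+* ℂ := algebraMap (𝓞 (Qd d)) ℂ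

theorem spin_center (d : ℕ) (A : SL(2, 𝓞 (Qd d))) (hA : A ∈ Subgroup.center (SL(2, 𝓞 (Qd d)))) :
    spin (Matrix.SpecialLinearGroup.map (intEmb d) A) = 1 := by
  obtain ⟨r, hr, hrA⟩ := Matrix.SpecialLinearGroup.mem_center_iff.mp hA
  have hs : (intEmb d r) ^ 2 = 1 := by
    rw [← map_pow]; rw [Fintype.card_fin] at hr; rw [hr, map_one]
  have hm : (Matrix.SpecialLinearGroup.map (intEmb d) A).1 = Matrix.scalar (Fin 2) (intEmb d r) := by
    rw [Matrix.SpecialLinearGroup.map_apply_coe, ← hrA]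
    ext a b
    fin_cases a <;> fin_cases b <;> simp
  have hl : spinLin (Matrix.SpecialLinearGroup.map (intEmb d) A).1 = LinearMap.id := by
    rw [← spinLin_one, hm]
    rcases eq_or_eq_neg_of_sq_eq_sq _ _ (hs.trans (one_pow 2).symm) with h | h
    · rw [h]; simp
    · rw [h]
      have e : Matrix.scalar (Fin 2) (-1 : ℂ) = -1 := by rw [map_neg, map_one]
      ext1 j
      ext1
      simp [spinLin, e]
  apply Subtype.ext
  apply Subtype.ext
  change LinearMap.toMatrix' (spinLin (Matrix.SpecialLinearGroup.map (intEmb d) A).1) = 1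
  rw [hl, LinearMap.toMatrix'_id]

/-- The inclusion `Bi(d) ⊂ SO(3,1) ⊂ SU(3,1)`. -/
def incl (d : ℕ) : Bi d →* SU31 :=
  QuotientGroup.lift (Subgroup.center (SL(2, 𝓞 (Qd d))))
    (spin.comp (Matrix.SpecialLinearGroup.map (intEmb d))) (fun A hA => spin_center d A hA)

/-- The modular group `PSL(2,ℤ)` as a subgroup of `Bi(d)`. -/
def modularGroup (d : ℕ) : Subgroup (Bi d) :=
  ((QuotientGroup.mk' (Subgroup.center (SL(2, 𝓞 (Qd d))))).comp
    (Matrix.SpecialLinearGroup.map (Int.castRingHom (𝓞 (Qd d))))).range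

/-- The element `diag(v, v, v⁻³, v)` of `SU(3,1)`; in `PU(3,1)` it is `diag(1, 1, u, 1)` with
`u = v⁻⁴`. -/
def bendElt (v : Circle) : SU31 :=
  ⟨⟨Matrix.diagonal ![(v : ℂ), v, ((v : ℂ) ^ 3)⁻¹, v], by
    have h : (v : ℂ) ≠ 0 := Circle.coe_ne_zero v
    simp [Matrix.det_diagonal, Fin.prod_univ_four]
    field_simp⟩, by
    have h : (starRingEnd ℂ) (v : ℂ) * v = 1 := by
      rw [mul_comm, Complex.mul_conj]; simp
    have h3 : (((starRingEnd ℂ) (v : ℂ)) ^ 3)⁻¹ * ((v : ℂ) ^ 3)⁻¹ = 1 := by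
      rw [← mul_inv, ← mul_pow, h]; simp
    change (Matrix.diagonal _)ᴴ * J * Matrix.diagonal _ = J
    ext a b
    fin_cases a <;> fin_cases b <;>
      simp [J, Matrix.diagonal_conjTranspose, Matrix.diagonal_mul, Matrix.mul_diagonal, h, h3]⟩

end Bianchi
end

open scoped Matrix LinearAlgebra.Projectivization MatrixGroups NumberField

noncomputable section

namespace Bianchi

/-! The geometry is linearized. The future cone over real hyperbolic space is convex, each translate
of the plane is the zero set of a real linear form on it, and a component of the complement of the
surface is a set of points lying on the same side of every form. Segments then play the role of
geodesics.

Embeddedness is arithmetic. Let `lam` be the least positive imaginary part in the ring of integers.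
The form of a translate is a spacelike unit vector whose product with the base normal is `1 + 2 *
lam ^ 2 * K` with `K` an integer. Since `lam > 1`, which is what excluding `d = 1, 3` provides, this
product has absolute value at least one, so two walls never cross. If they share a point of the
cone, all the integer coordinates vanish, the matrix is real, and the walls coincide
(`smul_two_re_coords`, `wall_ineq`, `mem_modularGroup_of_two_eq_zero`). The same coordinates give
local finiteness (`walls_finite`).

For existence, the wall `γP` receives the conjugate of `g_v` by `ι(γ)`, which is well defined
because `g_v` centralizes the stabilizer of `P`. The ordered product of these elements along the
walls crossed from a base point `x` is a function `f` of the region (`exists_holonomy`), and `γ ↦ f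
(γ • x) * ι γ` is a homomorphism by equivariance (`IsWallSystem.exists_bending`). For uniqueness,
the walls form one orbit, so the stabilizer of `C` and one translation by `ω` with `Im ω = lam`
generate the group (`exists_translate`, `isBending_unique`).

An element stabilizing some region or some wall is conjugate into the stabilizer of `C`, where `ρ =
ι`, so its image under `ρ` is conjugate to its image under `ι`. A boundary elliptic element fixes a
point of real hyperbolic space and is of this kind. So is an element fixing a null vector `nullVec
u` of integral origin on which no wall form vanishes: the values of the forms there are nonzero
multiples of `lam`, which leaves a horoball free of walls. In the remaining case some wall passes
through the cusp, the cusp is equivalent to infinity, and the element becomes a translation by `k *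
ω + l`.

On those translations `ρ` is explicit. In adapted coordinates the bent stable letter is a scalar
times a complex reflection times a unipotent whose vertical parameter is proportional to `(u + 1) /
(u - 1)` (`bendElt_mul_translation_isShear`). This parameter is nonzero exactly when `u ≠ -1`, so
the image is parabolic; and since parameters add under products, small parameters force `k = l = 0`,
whence discreteness. -/

/-! ### Systems of disjoint walls in a convex set -/

section Walls

variable {V W : Type*} [AddCommGroup V] [Module ℝ V]

/-- `x` and `y` lie strictly on the same side of every wall. -/
def SameSide (ℓ : W → V →ₗ[ℝ] ℝ) (x y : V) : Prop := ∀ m, 0 < ℓ m x * ℓ m y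

/-- `m` is the only wall between `x` and `y`, and it is crossed from its negative to its positive
side. -/
def AdjacentAlong (ℓ : W → V →ₗ[ℝ] ℝ) (m : W) (x y : V) : Prop :=
  ℓ m x < 0 ∧ 0 < ℓ m y ∧ ∀ m', m' ≠ m → 0 < ℓ m' x * ℓ m' y

/-- The walls separating `x` from `y`. -/
def separators (ℓ : W → V →ₗ[ℝ] ℝ) (x y : V) : Set W := {m | ℓ m x * ℓ m y < 0}

/-- The points of `H` which lie on no wall. -/
def offWalls (ℓ : W → V →ₗ[ℝ] ℝ) (H : Set V) : Set V := {x | x ∈ H ∧ ∀ m, ℓ m x ≠ 0}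

/-- A locally finite system of pairwise disjoint walls in a convex set. -/
structure IsWallSystem (ℓ : W → V →ₗ[ℝ] ℝ) (H : Set V) : Prop where
  convex : Convex ℝ H
  disjoint : ∀ {m m' x}, x ∈ H → ℓ m x = 0 → ℓ m' x = 0 → m = m'
  finite : ∀ {x y}, x ∈ H → y ∈ H → {m | ℓ m x * ℓ m y ≤ 0}.Finite

variable {ℓ : W → V →ₗ[ℝ] ℝ} {H : Set V}

theorem SameSide.symm {x y : V} (h : SameSide ℓ x y) : SameSide ℓ y x :=
  fun m => by rw [mul_comm]; exact h m

theorem mul_pos_trans {a b c : ℝ} (h : 0 < a * b) (h' : 0 < b * c) : 0 < a * c := by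
  have : 0 < (a * c) * b ^ 2 := by nlinarith [mul_pos h h']
  exact pos_of_mul_pos_left this (sq_nonneg b)

theorem mul_neg_of_pos_of_neg {a b c : ℝ} (h : 0 < a * b) (h' : b * c < 0) : a * c < 0 := by
  have := mul_pos_trans (c := -c) h (by linarith)
  linarith

theorem SameSide.trans {x y z : V} (h : SameSide ℓ x y) (h' : SameSide ℓ y z) :
    SameSide ℓ x z := fun m => mul_pos_trans (h m) (h' m)

theorem SameSide.refl {x : V} (h : x ∈ offWalls ℓ H) : SameSide ℓ x x :=
  fun m => mul_self_pos.mpr (h.2 m)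

theorem AdjacentAlong.congr_right {m : W} {x y y' : V} (h : AdjacentAlong ℓ m x y)
    (h' : SameSide ℓ y y') : AdjacentAlong ℓ m x y' := by
  refine ⟨h.1, ?_, fun m' hm => mul_pos_trans (h.2.2 m' hm) (h' m')⟩
  exact pos_of_mul_pos_right (h' m) h.2.1.le

theorem linear_apply_segment (f : V →ₗ[ℝ] ℝ) (x y : V) (t : ℝ) :
    f (x + t • (y - x)) = f x + t * (f y - f x) := by simp

theorem exists_zero_on_segment (f : V →ₗ[ℝ] ℝ) {x y : V} (h : f x * f y ≤ 0) :
    ∃ t ∈ Set.Icc (0 : ℝ) 1, f (x + t • (y - x)) = 0 := by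
  rcases eq_or_ne (f x) 0 with h0 | h0
  · exact ⟨0, by simp, by simp [h0]⟩
  · have hne : f x - f y ≠ 0 := by
      intro h1
      have : f y = f x := by linarith
      rw [this] at h
      exact absurd (mul_self_pos.mpr h0) (not_lt.mpr h)
    have hsq : 0 < (f x - f y) ^ 2 := by positivity
    refine ⟨f x / (f x - f y), ⟨?_, ?_⟩, ?_⟩
    · have e : f x / (f x - f y) = (f x * (f x - f y)) / (f x - f y) ^ 2 := by
        field_simp
      rw [e]
      apply div_nonneg _ hsq.le
      nlinarith [sq_nonneg (f x)]
    · have e : 1 - f x / (f x - f y) = (f y * (f y - f x)) / (f x - f y) ^ 2 := by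
        field_simp; ring
      have : 0 ≤ (f y * (f y - f x)) / (f x - f y) ^ 2 := by
        apply div_nonneg _ hsq.le
        nlinarith [sq_nonneg (f y)]
      linarith
    · rw [linear_apply_segment]; field_simp; ring

theorem separators_subset {x y : V} : separators ℓ x y ⊆ {m | ℓ m x * ℓ m y ≤ 0} := by
  intro m hm
  have h : ℓ m x * ℓ m y < 0 := hm
  exact h.le

theorem separators_eq_insert {x y z : V} {m : W}
    (hm : 0 < ℓ m x * ℓ m y) (hyz : ℓ m y * ℓ m z < 0)
    (h : ∀ m', m' ≠ m → 0 < ℓ m' y * ℓ m' z) :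
    separators ℓ x z = insert m (separators ℓ x y) ∧ m ∉ separators ℓ x y := by
  constructor
  · ext m'
    rw [Set.mem_insert_iff]
    by_cases hm' : m' = m
    · subst hm'
      exact iff_of_true (mul_neg_of_pos_of_neg hm hyz) (Or.inl rfl)
    · simp only [hm', false_or]
      have h1 := h m' hm'
      constructor
      · intro h2
        have h2' : ℓ m' z * ℓ m' x < 0 := by rw [mul_comm]; exact h2
        have := mul_neg_of_pos_of_neg h1 h2'
        rw [mul_comm] at this; exact this
      · intro h2
        have h2' : ℓ m' y * ℓ m' x < 0 := by rw [mul_comm]; exact h2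
        have := mul_neg_of_pos_of_neg (by rwa [mul_comm] at h1) h2'
        rw [mul_comm] at this; exact this
  · intro h2
    have : ℓ m x * ℓ m y < 0 := h2
    linarith

namespace IsWallSystem

variable (hW : IsWallSystem ℓ H)

include hW

theorem segment_mem {x y : V} (hx : x ∈ H) (hy : y ∈ H) {t : ℝ} (ht : t ∈ Set.Icc (0 : ℝ) 1) :
    x + t • (y - x) ∈ H := hW.convex.add_smul_sub_mem hx hy ht

/-- Only the finitely many walls meeting the segment from `p` to `q` need a continuity argument. For
the others the two endpoint values already have the same strict sign. -/
theorem eventually_sameSide {p q : V} (hp : p ∈ H) (hq : q ∈ H) :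
    ∀ᶠ ε in nhdsWithin (0 : ℝ) (Set.Ioi 0),
      ∀ m, ℓ m p ≠ 0 → 0 < ℓ m p * ℓ m (p + ε • (q - p)) := by
  have h1 : ∀ᶠ ε in nhdsWithin (0 : ℝ) (Set.Ioi 0),
      ∀ m ∈ {m | ℓ m p * ℓ m q ≤ 0}, ℓ m p ≠ 0 → 0 < ℓ m p * ℓ m (p + ε • (q - p)) := by
    rw [Filter.eventually_all_finite (hW.finite hp hq)]
    intro m _
    rcases eq_or_ne (ℓ m p) 0 with h0 | h0
    · simp [h0]
    · have hc : Continuous fun ε : ℝ => ℓ m p * ℓ m (p + ε • (q - p)) := by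
        simp only [linear_apply_segment]; fun_prop
      have : 0 < ℓ m p * ℓ m (p + (0 : ℝ) • (q - p)) := by simpa using mul_self_pos.mpr h0
      exact ((hc.tendsto 0).eventually (lt_mem_nhds this)).filter_mono nhdsWithin_le_nhds
        |>.mono fun _ h _ => h
  have h2 : ∀ᶠ ε in nhdsWithin (0 : ℝ) (Set.Ioi 0), ε < 1 :=
    (gt_mem_nhds one_pos).filter_mono nhdsWithin_le_nhds
  filter_upwards [h1, h2, self_mem_nhdsWithin] with ε h1 h2 h3 m hm
  by_cases hmem : ℓ m p * ℓ m q ≤ 0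
  · exact h1 m hmem hm
  · rw [linear_apply_segment]
    push Not at hmem
    have h3' : (0 : ℝ) < ε := h3
    have := mul_self_pos.mpr hm
    nlinarith [mul_pos h3' hmem, mul_pos (sub_pos.mpr h2) this]

/-- The segment from `p` to `q` stays in the wall `m`, so a sign change of `ℓ m'` would produce an
intersection of the two walls. -/
theorem sameSide_on_wall {m m' : W} (hm : m' ≠ m) {p q : V} (hp : p ∈ H) (hq : q ∈ H)
    (hp0 : ℓ m p = 0) (hq0 : ℓ m q = 0) : 0 < ℓ m' p * ℓ m' q := by
  by_contra! h
  obtain ⟨t, ht, h0⟩ := exists_zero_on_segment (ℓ m') h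
  refine hm (hW.disjoint (hW.segment_mem hp hq ht) h0 ?_)
  rw [linear_apply_segment, hp0, hq0]; simp

/-- The wall is the one crossed last on the segment from `x` to `y`, and `y'` is taken just before
that crossing. -/
theorem exists_last_wall {x y : V} (hx : x ∈ offWalls ℓ H) (hy : y ∈ offWalls ℓ H)
    (hne : (separators ℓ x y).Nonempty) :
    ∃ m ∈ separators ℓ x y, ∃ y' ∈ offWalls ℓ H, 0 < ℓ m x * ℓ m y' ∧
      ∀ m', m' ≠ m → 0 < ℓ m' y' * ℓ m' y := by
  have hfin : (separators ℓ x y).Finite := (hW.finite hx.1 hy.1).subset separators_subset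
  obtain ⟨m, hm, hmax⟩ := hfin.exists_maximalFor (fun m => ℓ m x / (ℓ m x - ℓ m y)) _ hne
  obtain ⟨t, ht, h0⟩ := exists_zero_on_segment (ℓ m) (le_of_lt hm)
  set p := x + t • (y - x) with hp
  have hpH : p ∈ H := hW.segment_mem hx.1 hy.1 ht
  -- A further wall between `p` and `y` would be crossed at a parameter larger than `t`, against the
  -- maximality of `m`.
  have key : ∀ m', m' ≠ m → 0 < ℓ m' p * ℓ m' y := by
    intro m' hm'
    have hp0 : ℓ m' p ≠ 0 := fun h => hm' (hW.disjoint hpH h h0)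
    by_contra! hle
    have hlt : ℓ m' p * ℓ m' y < 0 := lt_of_le_of_ne hle (mul_ne_zero hp0 (hy.2 m'))
    have hy2 := mul_self_pos.mpr (hy.2 m')
    rw [hp, linear_apply_segment] at hlt
    have hm's : ℓ m' x * ℓ m' y < 0 := by
      by_contra! hc
      nlinarith [ht.1, ht.2, mul_nonneg (sub_nonneg.mpr ht.2) hc, mul_nonneg ht.1 hy2.le]
    have hne' : ℓ m' x - ℓ m' y ≠ 0 := by
      intro h
      have : ℓ m' x = ℓ m' y := by linarith
      rw [this] at hm's; linarith
    have hne : ℓ m x - ℓ m y ≠ 0 := by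
      intro h
      have h' : ℓ m x = ℓ m y := by linarith
      have : ℓ m x * ℓ m y < 0 := hm
      rw [h'] at this; nlinarith [mul_self_nonneg (ℓ m y)]
    have ht' : t = ℓ m x / (ℓ m x - ℓ m y) := by
      rw [linear_apply_segment] at h0
      field_simp; linarith
    have hgt : t < ℓ m' x / (ℓ m' x - ℓ m' y) := by
      have e : (ℓ m' x + t * (ℓ m' y - ℓ m' x)) * ℓ m' y =
        (ℓ m' x / (ℓ m' x - ℓ m' y) - t) * ((ℓ m' x - ℓ m' y) * ℓ m' y) := by
        field_simp; ring
      rw [e] at hlt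
      have : (ℓ m' x - ℓ m' y) * ℓ m' y < 0 := by nlinarith
      by_contra! hc
      nlinarith
    have := hmax (j := m') hm's (by beta_reduce; rw [← ht']; exact hgt.le)
    beta_reduce at this
    rw [← ht'] at this
    linarith
  have h2 : ∀ᶠ ε in nhdsWithin (0 : ℝ) (Set.Ioi 0), ε < 1 :=
    (gt_mem_nhds one_pos).filter_mono nhdsWithin_le_nhds
  obtain ⟨ε, ⟨h1, h2⟩, h3⟩ :=
    ((hW.eventually_sameSide hpH hx.1).and h2 |>.and self_mem_nhdsWithin).exists
  have h3' : (0 : ℝ) < ε := h3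
  have hx2 := mul_self_pos.mpr (hx.2 m)
  have hmy : 0 < ℓ m x * ℓ m (p + ε • (x - p)) := by
    rw [linear_apply_segment, h0]; nlinarith [mul_pos h3' hx2]
  have hm'y : ∀ m', m' ≠ m → 0 < ℓ m' (p + ε • (x - p)) * ℓ m' y := by
    intro m' hm'
    refine mul_pos_trans ?_ (key m' hm')
    rw [mul_comm]
    exact h1 m' fun h => hm' (hW.disjoint hpH h h0)
  refine ⟨m, hm, p + ε • (x - p), ⟨hW.segment_mem hpH hx.1 ⟨h3'.le, h2.le⟩, ?_⟩, hmy, hm'y⟩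
  intro m' h
  by_cases hm' : m' = m
  · subst hm'; rw [h] at hmy; simp at hmy
  · have := hm'y m' hm'; rw [h] at this; simp at this

theorem separators_finite {x y : V} (hx : x ∈ H) (hy : y ∈ H) : (separators ℓ x y).Finite :=
  (hW.finite hx hy).subset separators_subset

/-- Induction over regions: starting from that of `x`, cross one wall at a time. -/
theorem region_induction {x : V} (hx : x ∈ offWalls ℓ H) {P : V → Prop}
    (base : ∀ y ∈ offWalls ℓ H, SameSide ℓ x y → P y)
    (step : ∀ y ∈ offWalls ℓ H, ∀ z ∈ offWalls ℓ H, ∀ m,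
      (AdjacentAlong ℓ m y z ∨ AdjacentAlong ℓ m z y) → P y → P z)
    {y : V} (hy : y ∈ offWalls ℓ H) : P y := by
  -- Stepping back over the last wall lowers the number of separating walls by one.
  induction hn : (separators ℓ x y).ncard using Nat.strong_induction_on generalizing y with
  | _ n ih =>
    by_cases hne : (separators ℓ x y).Nonempty
    · obtain ⟨m, hm, y', hy', h1, h2⟩ := hW.exists_last_wall hx hy hne
      have hyy' : ℓ m y' * ℓ m y < 0 := mul_neg_of_pos_of_neg (by rwa [mul_comm] at h1) hm
      obtain ⟨e1, e2⟩ := separators_eq_insert h1 hyy' h2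
      have hc : (separators ℓ x y).ncard = (separators ℓ x y').ncard + 1 := by
        rw [e1, Set.ncard_insert_of_notMem e2 (hW.separators_finite hx.1 hy'.1)]
      refine step y' hy' y hy m ?_ (ih _ (by omega) hy' rfl)
      rcases mul_neg_iff.mp hyy' with ⟨h3, h4⟩ | ⟨h3, h4⟩
      · exact Or.inr ⟨h4, h3, fun m' hm' => by rw [mul_comm]; exact h2 m' hm'⟩
      · exact Or.inl ⟨h3, h4, h2⟩
    · refine base y hy fun m => ?_
      by_contra! hc
      exact hne ⟨m, lt_of_le_of_ne hc (mul_ne_zero (hx.2 m) (hy.2 m))⟩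

end IsWallSystem

/-! ### Products over the walls separating two points -/

/-- The walls separating `x` from the wall `m`. -/
def wallsBefore (ℓ : W → V →ₗ[ℝ] ℝ) (H : Set V) (x : V) (m : W) : Set W :=
  {m' | ∃ p ∈ H, ℓ m p = 0 ∧ ℓ m' x * ℓ m' p < 0}

/-- The product of `κ` over a finite set, in the order given by an injective rank function. -/
def rankedProd {𝒢 : Type*} [Group 𝒢] (κ : W → 𝒢) (r : W → ℕ) (S : Set W) : 𝒢 :=
  open Classical in
  ((List.range S.ncard).map fun n =>
    if h : ∃ m ∈ S, r m = n then κ h.choose else 1).prod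

/-- The rank of `m` is the first index not used by the product over `S`, so `κ m` becomes the last
factor. Injectivity of the rank makes the chosen walls in the other factors agree. -/
theorem rankedProd_insert {𝒢 : Type*} [Group 𝒢] (κ : W → 𝒢) (r : W → ℕ) {S : Set W} {m : W}
    (hS : S.Finite) (hm : m ∉ S) (hr : r m = S.ncard) (hinj : Set.InjOn r (insert m S)) :
    rankedProd κ r (insert m S) = rankedProd κ r S * κ m := by
  classical
  unfold rankedProd
  rw [Set.ncard_insert_of_notMem hm hS, List.range_succ, List.map_append, List.prod_append]
  congr 1
  · congr 1
    apply List.map_congr_left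
    intro n hn
    rw [List.mem_range] at hn
    by_cases h : ∃ m' ∈ S, r m' = n
    · have h' : ∃ m' ∈ insert m S, r m' = n := by
        obtain ⟨m', h1, h2⟩ := h
        exact ⟨m', Set.mem_insert_of_mem _ h1, h2⟩
      rw [dif_pos h, dif_pos h']
      congr 1
      exact hinj h'.choose_spec.1 (Set.mem_insert_of_mem _ h.choose_spec.1)
        (h'.choose_spec.2.trans h.choose_spec.2.symm)
    · have h' : ¬ ∃ m' ∈ insert m S, r m' = n := by
        rintro ⟨m', h1, h2⟩
        rcases Set.mem_insert_iff.mp h1 with rfl | h1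
        · omega
        · exact h ⟨m', h1, h2⟩
      rw [dif_neg h, dif_neg h']
  · have h' : ∃ m' ∈ insert m S, r m' = S.ncard := ⟨m, Set.mem_insert _ _, hr⟩
    simp only [List.map_cons, List.map_nil, List.prod_cons, List.prod_nil, mul_one, dif_pos h']
    congr 1
    exact hinj h'.choose_spec.1 (Set.mem_insert _ _) (h'.choose_spec.2.trans hr.symm)

namespace IsWallSystem

variable (hW : IsWallSystem ℓ H)

include hW

/-- No other wall separates two points of `m`, so every point of `m` serves equally well as a
witness. -/
theorem wallsBefore_eq {x p : V} {m : W} (hp : p ∈ H) (h0 : ℓ m p = 0) :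
    wallsBefore ℓ H x m = separators ℓ x p := by
  ext m'
  constructor
  · rintro ⟨q, hq, hq0, h⟩
    have hne : m' ≠ m := by rintro rfl; rw [hq0] at h; simp at h
    have := mul_neg_of_pos_of_neg (hW.sameSide_on_wall hne hp hq h0 hq0)
      (by rwa [mul_comm] at h)
    rw [mul_comm] at this
    exact this
  · intro h
    exact ⟨p, hp, h0, h⟩

/-- Distinct walls are crossed at distinct times because they are disjoint. A wall crossed later has
strictly more predecessors, namely at least the earlier wall itself. -/
theorem wallsBefore_ncard_injOn {x y : V} (hx : x ∈ H) (hy : y ∈ H) :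
    Set.InjOn (fun m => (wallsBefore ℓ H x m).ncard) (separators ℓ x y) := by
  have key : ∀ m ∈ separators ℓ x y, ∀ m' ∈ separators ℓ x y, ∀ t ∈ Set.Icc (0 : ℝ) 1,
      ∀ t' ∈ Set.Icc (0 : ℝ) 1, t < t' →
      ℓ m (x + t • (y - x)) = 0 → ℓ m' (x + t' • (y - x)) = 0 →
      (wallsBefore ℓ H x m).ncard < (wallsBefore ℓ H x m').ncard := by
    intro m hm m' hm' t ht t' ht' htt h0 h0'
    have hp' := hW.segment_mem hx hy ht'
    rw [hW.wallsBefore_eq (hW.segment_mem hx hy ht) h0, hW.wallsBefore_eq hp' h0']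
    apply Set.ncard_lt_ncard _ (hW.separators_finite hx hp')
    refine (Set.ssubset_iff_of_subset ?_).mpr ⟨m, ?_, ?_⟩
    · intro k hk
      simp only [separators, Set.mem_ofPred_eq, linear_apply_segment] at hk ⊢
      have hc : ℓ k x * (ℓ k y - ℓ k x) < 0 := by
        by_contra! hc
        nlinarith [mul_nonneg ht.1 hc, mul_self_nonneg (ℓ k x)]
      nlinarith
    · simp only [separators, Set.mem_ofPred_eq, linear_apply_segment] at hm ⊢ h0
      have hc : ℓ m x * (ℓ m y - ℓ m x) < 0 := by nlinarith [mul_self_nonneg (ℓ m x)]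
      have e : ℓ m x * (ℓ m x + t' * (ℓ m y - ℓ m x)) =
        ℓ m x * (ℓ m x + t * (ℓ m y - ℓ m x)) + (t' - t) * (ℓ m x * (ℓ m y - ℓ m x)) := by ring
      rw [e, h0]
      nlinarith
    · simp only [separators, Set.mem_ofPred_eq, h0]; simp
  intro m hm m' hm' he
  obtain ⟨t, ht, h0⟩ := exists_zero_on_segment (ℓ m) (le_of_lt hm)
  obtain ⟨t', ht', h0'⟩ := exists_zero_on_segment (ℓ m') (le_of_lt hm')
  rcases lt_trichotomy t t' with h | h | h
  · exact absurd he (key m hm m' hm' t ht t' ht' h h0 h0').ne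
  · subst h
    exact hW.disjoint (hW.segment_mem hx hy ht) h0 h0'
  · exact absurd he (key m' hm' m hm t' ht' t ht h h0' h0).ne'

theorem wallsBefore_eq_separators {x y z : V} {m : W} (hy : y ∈ H) (hz : z ∈ H)
    (hm : 0 < ℓ m x * ℓ m y) (hyz : ℓ m y * ℓ m z < 0)
    (h : ∀ m', m' ≠ m → 0 < ℓ m' y * ℓ m' z) :
    wallsBefore ℓ H x m = separators ℓ x y := by
  obtain ⟨t, ht, h0⟩ := exists_zero_on_segment (ℓ m) hyz.le
  rw [hW.wallsBefore_eq (hW.segment_mem hy hz ht) h0]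
  ext m'
  by_cases hm' : m' = m
  · subst hm'
    simp only [separators, Set.mem_ofPred_eq, h0]
    simp only [mul_zero, lt_self_iff_false, false_iff, not_lt]
    exact hm.le
  · have h1 := h m' hm'
    have h2 : ℓ m' y ≠ 0 := by intro h2; rw [h2] at h1; simp at h1
    have h3 : 0 < ℓ m' y * ℓ m' (y + t • (z - y)) := by
      rw [linear_apply_segment]
      rcases eq_or_lt_of_le ht.2 with h4 | h4
      · rw [h4]; simpa using h1
      · nlinarith [mul_nonneg ht.1 h1.le, mul_pos (sub_pos.mpr h4) (mul_self_pos.mpr h2)]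
    constructor
    · intro h4
      have h4' : ℓ m' (y + t • (z - y)) * ℓ m' x < 0 := by rw [mul_comm]; exact h4
      have := mul_neg_of_pos_of_neg h3 h4'
      rw [mul_comm] at this; exact this
    · intro h4
      have h4' : ℓ m' y * ℓ m' x < 0 := by rw [mul_comm]; exact h4
      have := mul_neg_of_pos_of_neg (by rwa [mul_comm] at h3) h4'
      rw [mul_comm] at this; exact this

/-- A locally constant function on the complement of the walls, with prescribed jumps. -/
theorem exists_holonomy {𝒢 : Type*} [Group 𝒢] (G : W → 𝒢) {x : V} (hx : x ∈ offWalls ℓ H) :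
    ∃ f : V → 𝒢, f x = 1 ∧
      (∀ y ∈ offWalls ℓ H, ∀ z ∈ offWalls ℓ H, SameSide ℓ y z → f y = f z) ∧
      (∀ y ∈ offWalls ℓ H, ∀ z ∈ offWalls ℓ H, ∀ m, AdjacentAlong ℓ m y z →
        f z = f y * G m) := by
  classical
  -- When leaving `x`, a wall is crossed positively exactly if `x` is on its negative side;
  -- otherwise its jump is inverted.
  set κ : W → 𝒢 := fun m => if ℓ m x < 0 then G m else (G m)⁻¹ with hκ
  set r : W → ℕ := fun m => (wallsBefore ℓ H x m).ncard with hr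
  have key : ∀ y ∈ offWalls ℓ H, ∀ z ∈ offWalls ℓ H, ∀ m, 0 < ℓ m x * ℓ m y →
      ℓ m y * ℓ m z < 0 → (∀ m', m' ≠ m → 0 < ℓ m' y * ℓ m' z) →
      rankedProd κ r (separators ℓ x z) = rankedProd κ r (separators ℓ x y) * κ m := by
    intro y hy z hz m h1 h2 h3
    obtain ⟨e1, e2⟩ := separators_eq_insert h1 h2 h3
    have hinj := hW.wallsBefore_ncard_injOn hx.1 hz.1
    rw [e1] at hinj ⊢
    refine rankedProd_insert κ r (hW.separators_finite hx.1 hy.1) e2 ?_ hinj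
    simp only [hr]
    rw [hW.wallsBefore_eq_separators hy.1 hz.1 h1 h2 h3]
  refine ⟨fun y => rankedProd κ r (separators ℓ x y), ?_, ?_, ?_⟩
  · have : separators ℓ x x = ∅ := by
      ext m
      simp only [separators, Set.mem_ofPred_eq, Set.mem_empty_iff_false, iff_false, not_lt]
      exact mul_self_nonneg _
    simp [this, rankedProd]
  · intro y _ z _ h
    have : separators ℓ x y = separators ℓ x z := by
      ext m
      have h1 := h m
      have h2 := h.symm m
      constructor <;> intro h3
      · have h3' : ℓ m y * ℓ m x < 0 := by rw [mul_comm]; exact h3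
        have := mul_neg_of_pos_of_neg h2 h3'
        rw [mul_comm] at this; exact this
      · have h3' : ℓ m z * ℓ m x < 0 := by rw [mul_comm]; exact h3
        have := mul_neg_of_pos_of_neg h1 h3'
        rw [mul_comm] at this; exact this
    simp [this]
  · intro y hy z hz m ⟨h1, h2, h3⟩
    have hyz : ℓ m y * ℓ m z < 0 := mul_neg_of_neg_of_pos h1 h2
    rcases lt_or_gt_of_ne (hx.2 m) with h4 | h4
    · have := key y hy z hz m (mul_pos_of_neg_of_neg h4 h1) hyz h3
      simpa [hκ, h4] using this
    -- Here `x` is on the positive side, so `z` is the nearer point and the product for `y` extends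
    -- the one for `z`.
    · have := key z hz y hy m (mul_pos h4 h2) (by rwa [mul_comm] at hyz)
        (fun m' hm' => by rw [mul_comm]; exact h3 m' hm')
      have h5 : κ m = (G m)⁻¹ := by simp [hκ, not_lt.mpr h4.le]
      simp only
      rw [this, h5]; group

end IsWallSystem

/-! ### Groups acting on a system of walls -/

section Action

variable {Γ 𝒢 : Type*} [Group Γ] [Group 𝒢] [MulAction Γ V] [MulAction Γ W]
  (hℓ : ∀ (γ : Γ) (m : W) (x : V), ℓ (γ • m) (γ • x) = ℓ m x)

include hℓ

theorem linear_smul_eq (γ : Γ) (m : W) (x : V) : ℓ m (γ • x) = ℓ (γ⁻¹ • m) x := by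
  rw [← hℓ γ (γ⁻¹ • m), smul_inv_smul]

theorem SameSide.smul {x y : V} (h : SameSide ℓ x y) (γ : Γ) : SameSide ℓ (γ • x) (γ • y) := by
  intro m
  rw [linear_smul_eq hℓ, linear_smul_eq hℓ]
  exact h _

theorem AdjacentAlong.smul {m : W} {x y : V} (h : AdjacentAlong ℓ m x y) (γ : Γ) :
    AdjacentAlong ℓ (γ • m) (γ • x) (γ • y) := by
  refine ⟨by rw [hℓ]; exact h.1, by rw [hℓ]; exact h.2.1, fun m' hm' => ?_⟩
  rw [linear_smul_eq hℓ, linear_smul_eq hℓ]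
  refine h.2.2 _ fun he => hm' ?_
  rw [← he, smul_inv_smul]

variable (hH : ∀ (γ : Γ), ∀ x ∈ H, γ • x ∈ H)

include hH

theorem smul_mem_offWalls {x : V} (hx : x ∈ offWalls ℓ H) (γ : Γ) : γ • x ∈ offWalls ℓ H :=
  ⟨hH γ x hx.1, fun m => by rw [linear_smul_eq hℓ]; exact hx.2 _⟩

/-- The deformation of a homomorphism by a system of elements attached to the walls. -/
theorem IsWallSystem.exists_bending (hW : IsWallSystem ℓ H) (i : Γ →* 𝒢) (G : W → 𝒢)
    (hG : ∀ γ m, G (γ • m) = i γ * G m * (i γ)⁻¹) {x : V} (hx : x ∈ offWalls ℓ H) :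
    ∃ ρ : Γ →* 𝒢, (∀ γ, SameSide ℓ x (γ • x) → ρ γ = i γ) ∧
      ∀ γ m, AdjacentAlong ℓ m x (γ • x) → ρ γ = G m * i γ := by
  obtain ⟨f, f1, f2, f3⟩ := hW.exists_holonomy G hx
  -- Both sides have the same value at `x` and the same jump across each wall, by equivariance of
  -- `G`. At `y = δ • x` this is the cocycle identity making `γ ↦ f (γ • x) * i γ` multiplicative.
  have key : ∀ γ : Γ, ∀ y ∈ offWalls ℓ H, f (γ • y) = f (γ • x) * i γ * f y * (i γ)⁻¹ := by
    intro γ y hy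
    refine hW.region_induction hx (P := fun y => f (γ • y) = f (γ • x) * i γ * f y * (i γ)⁻¹)
      ?_ ?_ hy
    · intro y hy h
      rw [← f2 x hx y hy h, f1, ← f2 _ (smul_mem_offWalls hℓ hH hx γ) _
        (smul_mem_offWalls hℓ hH hy γ) (h.smul hℓ γ)]
      group
    · intro y hy z hz m hadj ih
      have hy' := smul_mem_offWalls hℓ hH hy γ
      have hz' := smul_mem_offWalls hℓ hH hz γ
      rcases hadj with h | h
      · rw [f3 _ hy' _ hz' _ (h.smul hℓ γ), f3 _ hy _ hz _ h, ih, hG]; group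
      · have e1 := f3 _ hz' _ hy' _ (h.smul hℓ γ)
        have e2 := f3 _ hz _ hy _ h
        rw [ih, e2, hG] at e1
        have : f (γ • z) = f (γ • x) * i γ * (f z * G m) * (i γ)⁻¹ * (i γ * G m * (i γ)⁻¹)⁻¹ := by
          rw [e1]; group
        rw [this]; group
  refine ⟨⟨⟨fun γ => f (γ • x) * i γ, by simp [f1]⟩, fun γ δ => ?_⟩, fun γ h => ?_,
    fun γ m h => ?_⟩
  · simp only [mul_smul, map_mul]
    rw [key γ _ (smul_mem_offWalls hℓ hH hx δ)]; group
  · change f (γ • x) * i γ = i γ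
    rw [← f2 x hx _ (smul_mem_offWalls hℓ hH hx γ) h, f1, one_mul]
  · change f (γ • x) * i γ = G m * i γ
    rw [f3 x hx _ (smul_mem_offWalls hℓ hH hx γ) m h, f1, one_mul]

/-- If the walls form one orbit and the region on one side of a wall is carried by `τ` to the
region on the other side, then every region is a translate of the first one. -/
theorem IsWallSystem.exists_region_translate (hW : IsWallSystem ℓ H) {o : W} {x x' : V}
    (hx : x ∈ offWalls ℓ H) (hx' : x' ∈ offWalls ℓ H) (hadj : AdjacentAlong ℓ o x x')
    (ho : ∀ m : W, ∃ γ : Γ, m = γ • o) {τ : Γ} (hτ : SameSide ℓ x' (τ • x))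
    {y : V} (hy : y ∈ offWalls ℓ H) :
    ∃ h ∈ Subgroup.closure ({γ : Γ | SameSide ℓ x (γ • x)} ∪ {τ}), SameSide ℓ y (h • x) := by
  set K := Subgroup.closure ({γ : Γ | SameSide ℓ x (γ • x)} ∪ {τ}) with hK
  have hstab : ∀ γ : Γ, SameSide ℓ x (γ • x) → γ ∈ K := fun γ h =>
    Subgroup.subset_closure (Or.inl h)
  have hτK : τ ∈ K := Subgroup.subset_closure (Or.inr rfl)
  -- Only one region borders `o` on each side: compare both crossings at points of `o`, which no
  -- other wall separates.
  have nbr : ∀ {y z : V}, y ∈ offWalls ℓ H → z ∈ offWalls ℓ H → AdjacentAlong ℓ o y z →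
      SameSide ℓ y x ∧ SameSide ℓ z x' := by
    intro y z hy hz h
    obtain ⟨t, ht, h0⟩ := exists_zero_on_segment (ℓ o) (x := y) (y := z)
      (mul_neg_of_neg_of_pos h.1 h.2.1).le
    obtain ⟨s, hs, k0⟩ := exists_zero_on_segment (ℓ o) (x := x) (y := x')
      (mul_neg_of_neg_of_pos hadj.1 hadj.2.1).le
    have aux : ∀ {a b : V} {u : ℝ} (m : W), u ∈ Set.Icc (0 : ℝ) 1 → ℓ m a ≠ 0 →
        0 < ℓ m a * ℓ m b → 0 < ℓ m a * ℓ m (a + u • (b - a)) := by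
      intro a b u m hu ha hab
      rw [linear_apply_segment]
      rcases eq_or_lt_of_le hu.2 with h4 | h4
      · rw [h4]; simpa using hab
      · nlinarith [mul_nonneg hu.1 hab.le, mul_pos (sub_pos.mpr h4) (mul_self_pos.mpr ha)]
    have main : ∀ m, m ≠ o → 0 < ℓ m y * ℓ m x := by
      intro m hm
      have a1 := aux m ht (hy.2 m) (h.2.2 m hm)
      have a2 := aux m hs (hx.2 m) (hadj.2.2 m hm)
      have a3 := hW.sameSide_on_wall hm (hW.segment_mem hy.1 hz.1 ht)
        (hW.segment_mem hx.1 hx'.1 hs) h0 k0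
      exact mul_pos_trans (mul_pos_trans a1 a3) (by rwa [mul_comm] at a2)
    constructor <;> intro m <;> by_cases hm : m = o
    · subst hm; exact mul_pos_of_neg_of_neg h.1 hadj.1
    · exact main m hm
    · subst hm; exact mul_pos h.2.1 hadj.2.1
    · have := h.2.2 m hm
      rw [mul_comm] at this
      exact mul_pos_trans (mul_pos_trans this (main m hm)) (hadj.2.2 m hm)
  refine hW.region_induction hx (P := fun y => ∃ h ∈ K, SameSide ℓ y (h • x)) ?_ ?_ hy
  · intro y _ h
    exact ⟨1, one_mem _, by rw [one_smul]; exact h.symm⟩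
  · rintro y hy z hz m hyz ⟨h, hh, hyh⟩
    obtain ⟨γ, rfl⟩ := ho m
    have hhx := smul_mem_offWalls hℓ hH hx h
    have back : ∀ {a b : V}, a ∈ offWalls ℓ H → b ∈ offWalls ℓ H →
        AdjacentAlong ℓ (γ • o) a b → SameSide ℓ a (γ • x) ∧ SameSide ℓ b (γ • x') := by
      intro a b ha hb hab
      have h1 := hab.smul hℓ γ⁻¹
      rw [inv_smul_smul] at h1
      obtain ⟨h2, h3⟩ := nbr (smul_mem_offWalls hℓ hH ha _) (smul_mem_offWalls hℓ hH hb _) h1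
      have h2' := h2.smul hℓ γ
      have h3' := h3.smul hℓ γ
      rw [smul_inv_smul] at h2' h3'
      exact ⟨h2', h3'⟩
    -- With the wall written `γ • o`, its two bordering regions are those of `γ • x` and `γ • τ •
    -- x`. The known translate `h • x` lies in one of them, which puts `γ` in `K` and hence gives
    -- the other.
    rcases hyz with h1 | h1
    · obtain ⟨h2, h3⟩ := back hy hz h1
      have h4 : SameSide ℓ x ((h⁻¹ * γ) • x) := by
        have := (hyh.symm.trans h2).smul hℓ h⁻¹
        rwa [inv_smul_smul, smul_smul] at this
      have hγ : γ ∈ K := by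
        have := mul_mem hh (hstab _ h4)
        rwa [mul_inv_cancel_left] at this
      refine ⟨γ * τ, mul_mem hγ hτK, h3.trans ?_⟩
      rw [mul_smul]; exact hτ.smul hℓ γ
    · obtain ⟨h2, h3⟩ := back hz hy h1
      have h4 : SameSide ℓ x ((h⁻¹ * γ * τ) • x) := by
        have := (hyh.symm.trans (h3.trans (hτ.smul hℓ γ))).smul hℓ h⁻¹
        rwa [inv_smul_smul, smul_smul, smul_smul] at this
      have hγ : γ ∈ K := by
        have := mul_mem (mul_mem hh (hstab _ h4)) (inv_mem hτK)
        rwa [mul_assoc h⁻¹, mul_inv_cancel_left, mul_inv_cancel_right] at this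
      exact ⟨γ, hγ, h2⟩

end Action

end Walls

/-! ### The ring of integers of an imaginary quadratic field -/

/-- A conjugation-invariant subring of `ℂ` whose elements have imaginary parts in `ℤ lam`, and
whose real elements are the integers. -/
structure IsImaginaryOrder (O : Subring ℂ) (lam : ℝ) : Prop where
  one_lt : 1 < lam
  conj_mem : ∀ {x}, x ∈ O → (starRingEnd ℂ) x ∈ O
  im_mem : ∀ {x}, x ∈ O → ∃ k : ℤ, x.im = k * lam
  real_mem : ∀ {x}, x ∈ O → x.im = 0 → ∃ n : ℤ, x = n
  exists_im : ∃ w ∈ O, w.im = lam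

/-- The square of the denominator is prime to the numerator, so it divides the squarefree `d`. -/
theorem rat_isInt_of_sq_mul {d : ℕ} (hd : Squarefree d) {q : ℚ} {n : ℤ} (h : q ^ 2 * d = n) :
    ∃ k : ℤ, q = k := by
  have hden : (q.den : ℚ) ≠ 0 := by exact_mod_cast q.den_ne_zero
  have h1 : (q.num : ℚ) ^ 2 * d = n * (q.den : ℚ) ^ 2 := by
    rw [← h]
    nth_rewrite 2 [← Rat.num_div_den q]
    field_simp
  have h2 : q.num ^ 2 * d = n * (q.den : ℤ) ^ 2 := by exact_mod_cast h1
  have h3 : (q.den : ℤ) ^ 2 ∣ q.num ^ 2 * d := ⟨n, by rw [h2]; ring⟩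
  have h4 : IsCoprime ((q.den : ℤ) ^ 2) (q.num ^ 2) := by
    apply IsCoprime.pow
    rw [Int.isCoprime_iff_gcd_eq_one]
    have := q.reduced
    rw [Nat.coprime_comm] at this
    simpa [Int.gcd] using this
  have h5 : (q.den : ℤ) ^ 2 ∣ d := h4.dvd_of_dvd_mul_left h3
  have h6 : q.den * q.den ∣ d := by
    rw [← sq]; exact_mod_cast h5
  have h7 : q.den = 1 := Nat.isUnit_iff.mp (hd _ h6)
  exact ⟨q.num, by rw [← Rat.num_div_den q, h7]; simp⟩

theorem rat_isInt_of_isIntegral {q : ℚ} (h : IsIntegral ℤ (q : ℂ)) : ∃ k : ℤ, q = k := by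
  have h' : IsIntegral ℤ q := by
    have : ((q : ℂ)) = algebraMap ℚ ℂ q := by simp
    rw [this] at h
    exact (isIntegral_algebraMap_iff (algebraMap ℚ ℂ).injective).mp h
  obtain ⟨k, hk⟩ := IsIntegrallyClosed.isIntegral_iff.mp h'
  exact ⟨k, by simpa using hk.symm⟩

theorem mem_intEmb_range {d : ℕ} {z : ℂ} :
    z ∈ (intEmb d).range ↔ z ∈ Qd d ∧ IsIntegral ℤ z := by
  constructor
  · rintro ⟨x, rfl⟩
    refine ⟨(x : Qd d).2, ?_⟩
    exact (NumberField.RingOfIntegers.isIntegral_coe x).map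
      ((Qd d).val.restrictScalars ℤ)
  · rintro ⟨h1, h2⟩
    have h3 : IsIntegral ℤ (⟨z, h1⟩ : Qd d) := by
      have : z = algebraMap (Qd d) ℂ ⟨z, h1⟩ := rfl
      rw [this] at h2
      exact (isIntegral_algebraMap_iff (algebraMap (Qd d) ℂ).injective).mp h2
    exact ⟨⟨⟨z, h1⟩, h3⟩, rfl⟩

theorem sq_I_mul_sqrt (d : ℕ) : (Complex.I * (√(d : ℝ) : ℝ)) ^ 2 = -(d : ℂ) := by
  rw [mul_pow, Complex.I_sq, ← Complex.ofReal_pow, Real.sq_sqrt (Nat.cast_nonneg d)]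
  simp

theorem mem_Qd {d : ℕ} {z : ℂ} :
    z ∈ Qd d ↔ ∃ a b : ℚ, z = a + b * (Complex.I * (√(d : ℝ) : ℝ)) := by
  set α : ℂ := Complex.I * (√(d : ℝ) : ℝ) with hα
  have hsq : α ^ 2 = -(d : ℂ) := sq_I_mul_sqrt d
  have hαmem : α ∈ Qd d := IntermediateField.mem_adjoin_simple_self ℚ α
  constructor
  · intro h
    have hint : IsIntegral ℚ α := by
      refine ⟨Polynomial.X ^ 2 + Polynomial.C (d : ℚ), ?_, ?_⟩
      · exact Polynomial.monic_X_pow_add_C _ two_ne_zero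
      · simp [hsq]
    have h2 : z ∈ Algebra.adjoin ℚ {α} := by
      rw [← IntermediateField.adjoin_simple_toSubalgebra_of_isAlgebraic hint.isAlgebraic]
      exact h
    clear h
    induction h2 using Algebra.adjoin_induction with
    | mem x hx =>
      rw [Set.mem_singleton_iff] at hx
      exact ⟨0, 1, by simp [hx]⟩
    | algebraMap r => exact ⟨r, 0, by simp⟩
    | add x y hx hy h1 h2 =>
      obtain ⟨a, b, e⟩ := h1
      obtain ⟨a', b', e'⟩ := h2
      exact ⟨a + a', b + b', by rw [e, e']; push_cast; ring⟩
    | mul x y hx hy h1 h2 =>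
      obtain ⟨a, b, e⟩ := h1
      obtain ⟨a', b', e'⟩ := h2
      exact ⟨a * a' - b * b' * d, a * b' + b * a', by
        rw [e, e']; push_cast; linear_combination (b * b' : ℂ) * hsq⟩
  · rintro ⟨a, b, rfl⟩
    have ha : ∀ q : ℚ, (q : ℂ) ∈ Qd d := fun q => (Qd d).algebraMap_mem q
    exact add_mem (ha a) (mul_mem (ha b) hαmem)

/-- The value of `lam` is `√d / 2` when `d` is 3 modulo 4 and `√d` otherwise. It fails to exceed one
exactly for `d = 3` and `d = 1`. -/
theorem isImaginaryOrder_range {d : ℕ} (hd : Squarefree d) (h1 : d ≠ 1) (h3 : d ≠ 3) :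
    ∃ lam, IsImaginaryOrder (intEmb d).range lam := by
  set s : ℝ := √(d : ℝ) with hs
  have hd0 : d ≠ 0 := hd.ne_zero
  have hs2 : s ^ 2 = d := Real.sq_sqrt (Nat.cast_nonneg d)
  have hspos : 0 < s := Real.sqrt_pos.mpr (by exact_mod_cast Nat.pos_of_ne_zero hd0)
  have hQ : ∀ z : ℂ, z ∈ Qd d ↔ ∃ a b : ℚ, z = a + b * (Complex.I * s) := fun z => mem_Qd
  have hconj : ∀ {x}, x ∈ (intEmb d).range → (starRingEnd ℂ) x ∈ (intEmb d).range := by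
    intro x hx
    rw [mem_intEmb_range, hQ] at hx ⊢
    obtain ⟨⟨a, b, e⟩, hi⟩ := hx
    refine ⟨⟨a, -b, ?_⟩, hi.map (Complex.conjAe.toAlgHom.restrictScalars ℤ)⟩
    rw [e]; simp
  -- `A` is the trace of `x` and `n` its norm, both rational and integral. Integrality of `B` then
  -- follows from squarefreeness.
  have hform : ∀ {x}, x ∈ (intEmb d).range → ∃ A B : ℤ, ∃ n : ℤ,
      x = A / 2 + B / 2 * (Complex.I * s) ∧ A ^ 2 + d * B ^ 2 = 4 * n := by
    intro x hx
    have hx' := hconj hx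
    obtain ⟨⟨a, b, e⟩, hi⟩ := (by rw [mem_intEmb_range, hQ] at hx; exact hx :
      (∃ a b : ℚ, x = a + b * (Complex.I * s)) ∧ IsIntegral ℤ x)
    have hi' : IsIntegral ℤ ((starRingEnd ℂ) x) := (mem_intEmb_range.mp hx').2
    have hcx : (starRingEnd ℂ) x = a - b * (Complex.I * s) := by
      rw [e]; simp; ring
    have hss : (s : ℂ) ^ 2 = d := by rw [← Complex.ofReal_pow, hs2]; simp
    obtain ⟨A, hA⟩ := rat_isInt_of_isIntegral (q := 2 * a) (by
      have := hi.add hi'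
      rw [hcx, e] at this
      have e2 : ((2 * a : ℚ) : ℂ) = (a + b * (Complex.I * s)) + (a - b * (Complex.I * s)) := by
        push_cast; ring
      rw [e2]; exact this)
    obtain ⟨n, hn⟩ := rat_isInt_of_isIntegral (q := a ^ 2 + d * b ^ 2) (by
      have := hi.mul hi'
      rw [hcx, e] at this
      have e2 : ((a ^ 2 + d * b ^ 2 : ℚ) : ℂ) =
          (a + b * (Complex.I * s)) * (a - b * (Complex.I * s)) := by
        push_cast
        linear_combination (-(b : ℂ) ^ 2) * hss + (b ^ 2 * s ^ 2 : ℂ) * Complex.I_sq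
      rw [e2]; exact this)
    obtain ⟨B, hB⟩ := rat_isInt_of_sq_mul hd (q := 2 * b) (n := 4 * n - A ^ 2) (by
      push_cast; rw [← hA, ← hn]; ring)
    refine ⟨A, B, n, ?_, ?_⟩
    · have hA' : (2 * a : ℂ) = A := by exact_mod_cast congrArg (fun q : ℚ => (q : ℂ)) hA
      have hB' : (2 * b : ℂ) = B := by exact_mod_cast congrArg (fun q : ℚ => (q : ℂ)) hB
      rw [← hA', ← hB', e]; ring
    · have : (A : ℚ) ^ 2 + d * B ^ 2 = 4 * n := by rw [← hA, ← hB, ← hn]; ring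
      exact_mod_cast this
  have him : ∀ A B : ℤ, ((A : ℂ) / 2 + B / 2 * (Complex.I * s)).im = B / 2 * s := by
    intro A B
    have : ((A : ℂ) / 2 + B / 2 * (Complex.I * s)) =
      ((A / 2 : ℝ) : ℂ) + ((B / 2 * s : ℝ) : ℂ) * Complex.I := by push_cast; ring
    rw [this]; simp
  have hreal : ∀ {x}, x ∈ (intEmb d).range → x.im = 0 → ∃ n : ℤ, x = n := by
    intro x hx h0
    obtain ⟨A, B, n, e, -⟩ := hform hx
    rw [e, him] at h0
    have hB : (B : ℝ) = 0 := by
      rcases mul_eq_zero.mp h0 with h | h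
      · linarith
      · exact absurd h hspos.ne'
    have hB' : B = 0 := by exact_mod_cast hB
    have : x = ((A / 2 : ℚ) : ℂ) := by rw [e, hB']; push_cast; ring
    obtain ⟨k, hk⟩ := rat_isInt_of_isIntegral (q := A / 2) (by
      rw [← this]; exact (mem_intEmb_range.mp hx).2)
    exact ⟨k, by rw [this, hk]; simp⟩
  by_cases hmod : d % 4 = 3
  · have hd7 : 7 ≤ d := by omega
    refine ⟨s / 2, ?_, hconj, ?_, hreal, 1 / 2 + 1 / 2 * (Complex.I * s), ?_, ?_⟩
    · have : (7 : ℝ) ≤ d := by exact_mod_cast hd7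
      nlinarith
    · intro x hx
      obtain ⟨A, B, n, e, -⟩ := hform hx
      exact ⟨B, by rw [e, him]; ring⟩
    · rw [mem_intEmb_range, hQ]
      refine ⟨⟨1 / 2, 1 / 2, by push_cast; ring⟩, ?_⟩
      obtain ⟨m, hm⟩ : ∃ m : ℕ, d = 4 * m + 3 := ⟨d / 4, by omega⟩
      -- This is the minimal polynomial of `(1 + i√d) / 2` for `d = 4m + 3`: trace one and norm `(1
      -- + d) / 4 = m + 1`.
      refine ⟨Polynomial.X ^ 2 + (Polynomial.C (-1) * Polynomial.X + Polynomial.C ((m : ℤ) + 1)),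
        ?_, ?_⟩
      · apply Polynomial.monic_X_pow_add
        apply lt_of_le_of_lt Polynomial.degree_linear_le
        norm_num
      · have hsq := sq_I_mul_sqrt d
        rw [← hs] at hsq
        have hm' : (d : ℂ) = 4 * m + 3 := by rw [hm]; push_cast; ring
        rw [hm'] at hsq
        simp
        linear_combination (1 / 4 : ℂ) * hsq
    · have := him 1 1
      push_cast at this
      rw [this]; ring
  · refine ⟨s, ?_, hconj, ?_, hreal, Complex.I * s, ?_, ?_⟩
    · have : (2 : ℝ) ≤ d := by
        have : 2 ≤ d := by omega
        exact_mod_cast this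
      nlinarith
    · intro x hx
      obtain ⟨A, B, n, e, h⟩ := hform hx
      -- With `B` odd, `A ^ 2 + d * B ^ 2` would be `A ^ 2 + d` modulo 4, which is nonzero for `d`
      -- equal to 1 or 2 modulo 4.
      have hBe : B % 2 = 0 := by
        have hd4 : d % 4 = 1 ∨ d % 4 = 2 := by
          have : d % 4 ≠ 0 := by
            intro h0
            have := hd 2 (by omega)
            rw [Nat.isUnit_iff] at this; omega
          omega
        by_contra hB
        obtain ⟨b, hb⟩ : ∃ b, B = 2 * b + 1 := ⟨B / 2, by omega⟩
        have hAe : A = 2 * (A / 2) + A % 2 := by omega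
        have hA2 : A % 2 = 0 ∨ A % 2 = 1 := by omega
        rcases hd4 with hd4 | hd4
        · obtain ⟨m, hm⟩ : ∃ m : ℤ, (d : ℤ) = 4 * m + 1 := ⟨(d : ℤ) / 4, by omega⟩
          rw [hm, hb] at h
          rcases hA2 with hA2 | hA2 <;> rw [hA2] at hAe <;> rw [hAe] at h <;> ring_nf at h <;> omega
        · obtain ⟨m, hm⟩ : ∃ m : ℤ, (d : ℤ) = 4 * m + 2 := ⟨(d : ℤ) / 4, by omega⟩
          rw [hm, hb] at h
          rcases hA2 with hA2 | hA2 <;> rw [hA2] at hAe <;> rw [hAe] at h <;> ring_nf at h <;> omega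
      obtain ⟨b, hb⟩ : ∃ b, B = 2 * b := ⟨B / 2, by omega⟩
      exact ⟨b, by rw [e, him, hb]; push_cast; ring⟩
    · rw [mem_intEmb_range, hQ]
      refine ⟨⟨0, 1, by simp⟩, Polynomial.X ^ 2 + Polynomial.C (d : ℤ), ?_, ?_⟩
      · exact Polynomial.monic_X_pow_add_C _ two_ne_zero
      · have hsq := sq_I_mul_sqrt d
        rw [← hs] at hsq
        simp [hsq]
    · simp

/-! ### The action on the future cone -/

/-- The open cone over real hyperbolic space. -/
def futureCone : Set (Fin 4 → ℂ) := {x | (∀ j, (x j).im = 0) ∧ hnorm x < 0 ∧ 0 < (x 0).re}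

theorem hnorm_eq (z : Fin 4 → ℂ) : hnorm z = 2 * ((z 0).re * (z 3).re + (z 0).im * (z 3).im) +
    ((z 1).re ^ 2 + (z 1).im ^ 2) + ((z 2).re ^ 2 + (z 2).im ^ 2) := by
  simp only [hnorm, Complex.sq_norm, Complex.normSq_apply]
  simp
  ring

theorem hnorm_eq_form (z : Fin 4 → ℂ) : (hnorm z : ℂ) = star z ⬝ᵥ J *ᵥ z := by
  rw [hnorm_eq]
  apply Complex.ext
  · rw [Complex.ofReal_re]
    simp [J, dotProduct, Matrix.mulVec, Fin.sum_univ_four]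
    ring
  · rw [Complex.ofReal_im]
    simp [J, dotProduct, Matrix.mulVec, Fin.sum_univ_four]
    ring

theorem hnorm_smul (g : SU31) (z : Fin 4 → ℂ) : hnorm ((g : SL(4, ℂ)) • z) = hnorm z := by
  have h : ((hnorm ((g : SL(4, ℂ)) • z) : ℝ) : ℂ) = hnorm z := by
    rw [hnorm_eq_form, hnorm_eq_form]
    have hg : ((g : SL(4, ℂ)) : Matrix (Fin 4) (Fin 4) ℂ)ᴴ * J * ((g : SL(4, ℂ)) :
      Matrix (Fin 4) (Fin 4) ℂ) = J := g.2
    change star ((g : SL(4, ℂ)).1 *ᵥ z) ⬝ᵥ J *ᵥ ((g : SL(4, ℂ)).1 *ᵥ z) = _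
    rw [Matrix.star_mulVec, ← Matrix.dotProduct_mulVec, Matrix.mulVec_mulVec,
      Matrix.mulVec_mulVec, hg]
  exact_mod_cast h

theorem hnorm_const_smul (c : ℂ) (z : Fin 4 → ℂ) : hnorm (c • z) = ‖c‖ ^ 2 * hnorm z := by
  simp only [hnorm_eq, Complex.sq_norm, Complex.normSq_apply, Pi.smul_apply, smul_eq_mul,
    Complex.mul_re, Complex.mul_im]
  ring

theorem hnorm_of_real {x : Fin 4 → ℂ} (hx : ∀ j, (x j).im = 0) :
    hnorm x = 2 * (x 0).re * (x 3).re + (x 1).re ^ 2 + (x 2).re ^ 2 := by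
  simp [hnorm_eq, hx, mul_assoc]

theorem spin_smul (A : SL(2, ℂ)) (x : Fin 4 → ℂ) :
    ((spin A : SU31) : SL(4, ℂ)) • x = spinLin A.1 x := LinearMap.toMatrix'_mulVec _ _

theorem incl_mk {d : ℕ} (A : SL(2, 𝓞 (Qd d))) :
    incl d (QuotientGroup.mk A) = spin (Matrix.SpecialLinearGroup.map (intEmb d) A) := rfl

theorem exists_rep {d : ℕ} (γ : Bi d) : ∃ A : SL(2, 𝓞 (Qd d)), γ = QuotientGroup.mk A :=
  ⟨γ.out, (QuotientGroup.out_eq' γ).symm⟩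

theorem toHerm_entries (x : Fin 4 → ℂ) : toHerm x = !![(√2 : ℝ) * x 0, - x 1 + Complex.I * x 2;
    - x 1 - Complex.I * x 2, - (√2 : ℝ) * x 3] := rfl

theorem toHerm_symm_entries (X : Matrix (Fin 2) (Fin 2) ℂ) : toHerm.symm X =
    ![X 0 0 / (√2 : ℝ), - (X 0 1 + X 1 0) / 2, - Complex.I * (X 0 1 - X 1 0) / 2,
    - X 1 1 / (√2 : ℝ)] := rfl

theorem spinLin_eq (A : Matrix (Fin 2) (Fin 2) ℂ) (x : Fin 4 → ℂ) :
    spinLin A x = toHerm.symm (A * toHerm x * Aᴴ) := by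
  rw [← toHerm_spinLin]; simp

theorem im_spinLin {A : Matrix (Fin 2) (Fin 2) ℂ} {x : Fin 4 → ℂ} (hx : ∀ j, (x j).im = 0)
    (j : Fin 4) : (spinLin A x j).im = 0 := by
  have h : star x = x := funext fun k => Complex.conj_eq_iff_im.mpr (hx k)
  have := congrFun (spinLin_star A x) j
  rw [h] at this
  exact Complex.conj_eq_iff_im.mp this.symm

/-- Two timelike vectors in the same cone have a product of definite sign. After scaling by `2 * a *
a'` the expression is a positive combination of the two hypotheses plus squares. -/
theorem mixed_pos {a b c e a' b' c' e' : ℝ} (ha : 0 < a) (ha' : 0 < a')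
    (h : b ^ 2 + c ^ 2 < 2 * a * e) (h' : b' ^ 2 + c' ^ 2 < 2 * a' * e') :
    0 < a * e' + a' * e - b * b' - c * c' := by
  have h1 : 0 < a * a' * 2 * (a * e' + a' * e - b * b' - c * c') := by
    nlinarith [mul_pos (mul_pos ha ha) (sub_pos.mpr h'),
      mul_pos (mul_pos ha' ha') (sub_pos.mpr h), sq_nonneg (a * b' - a' * b),
      sq_nonneg (a * c' - a' * c)]
  exact pos_of_mul_pos_right h1 (by positivity)

theorem mixed_sq_lt {a b c e a' b' c' e' s t : ℝ} (ha : 0 < a) (ha' : 0 < a') (hs : 0 ≤ s)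
    (ht : 0 ≤ t) (hst : s + t = 1) (h : b ^ 2 + c ^ 2 < 2 * a * e)
    (h' : b' ^ 2 + c' ^ 2 < 2 * a' * e') :
    (s * b + t * b') ^ 2 + (s * c + t * c') ^ 2 <
      2 * (s * a + t * a') * (s * e + t * e') := by
  have key := mixed_pos ha ha' h h'
  have e : 2 * (s * a + t * a') * (s * e + t * e') -
      ((s * b + t * b') ^ 2 + (s * c + t * c') ^ 2) =
      s ^ 2 * (2 * a * e - (b ^ 2 + c ^ 2)) + t ^ 2 * (2 * a' * e' - (b' ^ 2 + c' ^ 2)) +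
      2 * (s * t) * (a * e' + a' * e - b * b' - c * c') := by ring
  have h1 := mul_nonneg (mul_nonneg hs ht) key.le
  have h2 := mul_nonneg (sq_nonneg s) (sub_pos.mpr h).le
  have h3 := mul_nonneg (sq_nonneg t) (sub_pos.mpr h').le
  rcases eq_or_lt_of_le hs with h0 | h0
  · have : t = 1 := by linarith
    subst this; rw [← h0]; linarith
  · have := mul_pos (pow_pos h0 2) (sub_pos.mpr h)
    linarith

theorem futureCone_convex : Convex ℝ futureCone := by
  rintro x ⟨hx1, hx2, hx3⟩ y ⟨hy1, hy2, hy3⟩ s t hs ht hst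
  have him : ∀ j, ((s • x + t • y) j).im = 0 := fun j => by simp [hx1 j, hy1 j]
  rw [hnorm_of_real hx1] at hx2
  rw [hnorm_of_real hy1] at hy2
  refine ⟨him, ?_, ?_⟩
  · rw [hnorm_of_real him]
    simp only [Pi.add_apply, Pi.smul_apply, Complex.add_re, Complex.smul_re, smul_eq_mul]
    have := mixed_sq_lt (b := (x 1).re) (c := (x 2).re) (e := -(x 3).re) (b' := (y 1).re)
      (c' := (y 2).re) (e' := -(y 3).re) hx3 hy3 hs ht hst (by linarith) (by linarith)
    linarith
  · simp only [Pi.add_apply, Pi.smul_apply, Complex.add_re, Complex.smul_re, smul_eq_mul]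
    rcases eq_or_lt_of_le hs with h | h
    · rw [← h] at hst ⊢
      have : t = 1 := by linarith
      rw [this]; linarith
    · nlinarith [mul_pos h hx3, mul_nonneg ht hy3.le]

theorem smul_mem_futureCone {x : Fin 4 → ℂ} (hx : x ∈ futureCone) {t : ℝ} (ht : 0 < t) :
    (t : ℂ) • x ∈ futureCone := by
  obtain ⟨h1, h2, h3⟩ := hx
  refine ⟨fun j => by simp [h1 j], ?_, ?_⟩
  · rw [hnorm_const_smul]
    have : 0 < ‖(t : ℂ)‖ ^ 2 := by simp; positivity
    nlinarith
  · simp; positivity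

theorem spinLin_zero_re (A : Matrix (Fin 2) (Fin 2) ℂ) {x : Fin 4 → ℂ}
    (hx : ∀ j, (x j).im = 0) : √2 * (spinLin A x 0).re =
      √2 * (x 0).re * Complex.normSq (A 0 0) - √2 * (x 3).re * Complex.normSq (A 0 1) -
        2 * (x 1).re * (A 0 0 * (starRingEnd ℂ) (A 0 1)).re -
        2 * (x 2).re * (A 0 0 * (starRingEnd ℂ) (A 0 1)).im := by
  have hs0 : √2 ≠ 0 := by positivity
  rw [spinLin_eq, toHerm_symm_entries, toHerm_entries]
  simp [Matrix.mul_apply, hx, Complex.normSq_apply]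
  field_simp
  ring

theorem spinLin_two_re (A : Matrix (Fin 2) (Fin 2) ℂ) {x : Fin 4 → ℂ}
    (hx : ∀ j, (x j).im = 0) : (spinLin A x 2).re =
      √2 * (x 0).re * (A 0 0 * (starRingEnd ℂ) (A 1 0)).im -
        √2 * (x 3).re * (A 0 1 * (starRingEnd ℂ) (A 1 1)).im -
        (x 1).re * (A 0 0 * (starRingEnd ℂ) (A 1 1) + A 0 1 * (starRingEnd ℂ) (A 1 0)).im +
        (x 2).re * (A 0 0 * (starRingEnd ℂ) (A 1 1) - A 0 1 * (starRingEnd ℂ) (A 1 0)).re := by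
  rw [spinLin_eq, toHerm_symm_entries, toHerm_entries]
  simp [Matrix.mul_apply, hx]
  ring

theorem futureCone_coords {x : Fin 4 → ℂ} (hx : x ∈ futureCone) :
    0 < √2 * (x 0).re ∧ 0 < -(√2 * (x 3).re) ∧
      (x 1).re ^ 2 + (x 2).re ^ 2 < (√2 * (x 0).re) * -(√2 * (x 3).re) := by
  obtain ⟨h1, h2, h3⟩ := hx
  rw [hnorm_of_real h1] at h2
  have hs : √2 * √2 = (2 : ℝ) := Real.mul_self_sqrt (by norm_num)
  have hs0 : 0 < √2 := by positivity
  have h4 : 0 < √2 * (x 0).re := by positivity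
  have h5 : (x 1).re ^ 2 + (x 2).re ^ 2 < (√2 * (x 0).re) * -(√2 * (x 3).re) := by
    have : (√2 * (x 0).re) * -(√2 * (x 3).re) = -(√2 * √2) * ((x 0).re * (x 3).re) := by ring
    rw [this, hs]; linarith
  refine ⟨h4, ?_, h5⟩
  exact pos_of_mul_pos_right (lt_of_le_of_lt (by positivity) h5) h4.le

theorem spin_smul_mem_futureCone (A : SL(2, ℂ)) {x : Fin 4 → ℂ} (hx : x ∈ futureCone) :
    ((spin A : SU31) : SL(4, ℂ)) • x ∈ futureCone := by
  have hn := hnorm_smul (spin A) x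
  obtain ⟨hP, hR, hPR⟩ := futureCone_coords hx
  obtain ⟨h1, h2, h3⟩ := hx
  refine ⟨fun j => ?_, by rw [hn]; exact h2, ?_⟩
  · rw [spin_smul]; exact im_spinLin h1 j
  · rw [spin_smul]
    have h0 := spinLin_zero_re A.1 h1
    have hdet := A.2
    rw [Matrix.det_fin_two] at hdet
    have hab : ¬ (A.1 0 0 = 0 ∧ A.1 0 1 = 0) := by
      rintro ⟨h, h'⟩
      rw [h, h'] at hdet
      simp at hdet
    have hs0 : 0 < √2 := by positivity
    refine pos_of_mul_pos_right ?_ hs0.le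
    rw [h0]
    generalize A.1 0 0 = a at *
    generalize A.1 0 1 = b at *
    generalize √2 * (x 0).re = P at *
    have hR' : √2 * (x 3).re = -(-(√2 * (x 3).re)) := by ring
    rw [hR']
    generalize -(√2 * (x 3).re) = R at *
    generalize (x 1).re = u at *
    generalize (x 2).re = w at *
    simp only [Complex.normSq_apply, Complex.mul_re, Complex.mul_im, Complex.conj_re,
      Complex.conj_im]
    -- The quantity is the value of a positive definite Hermitian matrix on the first row of `A`.
    -- Multiplying by its corner entry `P` completes the square, leaving the determinant `P * R - (u
    -- ^ 2 + w ^ 2)`.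
    refine pos_of_mul_pos_right (a := P) ?_ hP.le
    have e : P * (P * (a.re * a.re + a.im * a.im) - -R * (b.re * b.re + b.im * b.im) -
        2 * u * (a.re * b.re - a.im * -b.im) - 2 * w * (a.re * -b.im + a.im * b.re)) =
        (P * a.re - u * b.re + w * b.im) ^ 2 + (P * a.im - u * b.im - w * b.re) ^ 2 +
          (P * R - (u ^ 2 + w ^ 2)) * (b.re ^ 2 + b.im ^ 2) := by ring
    rw [e]
    by_cases hb : b = 0
    · have ha : a ≠ 0 := fun h => hab ⟨h, hb⟩
      have := Complex.normSq_pos.mpr ha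
      rw [Complex.normSq_apply] at this
      subst hb
      simp
      nlinarith [mul_pos (pow_pos hP 2) this]
    · have := Complex.normSq_pos.mpr hb
      rw [Complex.normSq_apply] at this
      have h5 : 0 < P * R - (u ^ 2 + w ^ 2) := by linarith
      nlinarith [mul_pos h5 this, sq_nonneg (P * a.re - u * b.re + w * b.im),
        sq_nonneg (P * a.im - u * b.im - w * b.re)]

/-! ### The walls of the Bianchi group -/

instance biAction (d : ℕ) : MulAction (Bi d) (Fin 4 → ℂ) :=
  MulAction.compHom _ (SU31.subtype.comp (incl d))

theorem bi_smul_def {d : ℕ} (γ : Bi d) (x : Fin 4 → ℂ) :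
    γ • x = (incl d γ : SL(4, ℂ)) • x := rfl

theorem bi_smul_mem_futureCone {d : ℕ} (γ : Bi d) (x : Fin 4 → ℂ) (hx : x ∈ futureCone) :
    γ • x ∈ futureCone := by
  obtain ⟨A, rfl⟩ := exists_rep γ
  exact spin_smul_mem_futureCone _ hx

theorem bi_smul_const {d : ℕ} (γ : Bi d) (c : ℂ) (x : Fin 4 → ℂ) : γ • (c • x) = c • γ • x :=
  smul_comm (incl d γ : SL(4, ℂ)) c x

theorem bi_smul_add {d : ℕ} (γ : Bi d) (x y : Fin 4 → ℂ) : γ • (x + y) = γ • x + γ • y :=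
  smul_add (incl d γ : SL(4, ℂ)) x y

/-- The third coordinate is the antisymmetric part of the matrix, which a real `A` multiplies by its
determinant. -/
theorem modular_smul_two {d : ℕ} {δ : Bi d} (hδ : δ ∈ modularGroup d) (x : Fin 4 → ℂ) :
    (δ • x) 2 = x 2 := by
  obtain ⟨A, rfl⟩ := hδ
  change (((spin _ : SU31) : SL(4, ℂ)) • x) 2 = _
  rw [spin_smul, spinLin_eq, toHerm_symm_entries, toHerm_entries]
  have hdet := A.2
  rw [Matrix.det_fin_two] at hdet
  have hdet' : (A.1 0 0 : ℂ) * A.1 1 1 - A.1 0 1 * A.1 1 0 = 1 := by exact_mod_cast hdet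
  simp [Matrix.mul_apply]
  linear_combination x 2 * hdet' +
    ((A.1 0 1 : ℂ) * A.1 1 0 - A.1 0 0 * A.1 1 1) * x 2 * Complex.I_sq

/-- The linear form `x ↦ (γ⁻¹ x)₂` defining the translate by `γ` of the plane. -/
def wallFormAux (d : ℕ) (γ : Bi d) : (Fin 4 → ℂ) →ₗ[ℝ] ℝ where
  toFun x := ((γ⁻¹ • x) 2).re
  map_add' x y := by rw [bi_smul_add]; simp
  map_smul' t x := by
    have : (t • x) = (t : ℂ) • x := by ext j; simp
    rw [this, bi_smul_const]; simp

/-- The translates of the plane are indexed by the cosets of the modular group. -/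
abbrev Wall (d : ℕ) : Type := Bi d ⧸ modularGroup d

def baseWall (d : ℕ) : Wall d := ((1 : Bi d) : Bi d ⧸ modularGroup d)

/-- The linear form vanishing on a wall. -/
def wallForm (d : ℕ) (m : Wall d) : (Fin 4 → ℂ) →ₗ[ℝ] ℝ :=
  Quotient.liftOn' m (wallFormAux d) (by
    intro γ γ' h
    rw [QuotientGroup.leftRel_apply] at h
    refine LinearMap.ext fun x => ?_
    change ((γ⁻¹ • x) 2).re = ((γ'⁻¹ • x) 2).re
    have : γ⁻¹ • x = (γ⁻¹ * γ') • γ'⁻¹ • x := by rw [smul_smul]; simp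
    rw [this, modular_smul_two h])

theorem wallForm_mk {d : ℕ} (γ : Bi d) (x : Fin 4 → ℂ) :
    wallForm d (γ : Bi d ⧸ modularGroup d) x = ((γ⁻¹ • x) 2).re := rfl

theorem wallForm_baseWall {d : ℕ} (x : Fin 4 → ℂ) : wallForm d (baseWall d) x = (x 2).re := by
  rw [baseWall, wallForm_mk, inv_one, one_smul]

theorem wallForm_smul {d : ℕ} (γ : Bi d) (m : Wall d) (x : Fin 4 → ℂ) :
    wallForm d (γ • m) (γ • x) = wallForm d m x := by
  induction m using QuotientGroup.induction_on with
  | H δ =>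
    change wallForm d ((γ * δ : Bi d) : Bi d ⧸ modularGroup d) _ = _
    rw [wallForm_mk, wallForm_mk, smul_smul]
    simp

theorem exists_eq_smul_baseWall {d : ℕ} (m : Wall d) : ∃ γ : Bi d, m = γ • baseWall d := by
  induction m using QuotientGroup.induction_on with
  | H δ =>
    refine ⟨δ, ?_⟩
    change _ = ((δ * 1 : Bi d) : Bi d ⧸ modularGroup d)
    rw [mul_one]

theorem smul_baseWall_eq {d : ℕ} {γ : Bi d} : γ • baseWall d = baseWall d ↔ γ ∈ modularGroup d := by
  change ((γ * 1 : Bi d) : Bi d ⧸ modularGroup d) = ((1 : Bi d) : Bi d ⧸ modularGroup d) ↔ _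
  rw [mul_one, eq_comm, QuotientGroup.eq]
  simp

/-! ### Integrality of the walls -/

/-- These are the integer coordinates of the normal vector of a wall. The quadratic relation says
that it has norm one, and the decisive point is that its product with the base normal is congruent
to 1 modulo `2 * lam ^ 2`. -/
theorem smul_two_re_coords {d : ℕ} {lam : ℝ} (hO : IsImaginaryOrder (intEmb d).range lam)
    (B : SL(2, 𝓞 (Qd d))) : ∃ (j k K : ℤ) (t : ℝ),
      (1 + 2 * lam ^ 2 * K) ^ 2 + t ^ 2 = 1 + 4 * lam ^ 2 * (j * k) ∧
      (∀ x : Fin 4 → ℂ, (∀ i, (x i).im = 0) →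
        (((QuotientGroup.mk B : Bi d) • x) 2).re =
          -lam * (k * (√2 * (x 0).re) + j * -(√2 * (x 3).re)) +
            (1 + 2 * lam ^ 2 * K) * (x 2).re + t * (x 1).re) ∧
      (j = 0 → k = 0 → K = 0 → (QuotientGroup.mk B : Bi d) ∈ modularGroup d) := by
  set a := intEmb d (B.1 0 0) with ha
  set b := intEmb d (B.1 0 1) with hb
  set c := intEmb d (B.1 1 0) with hc
  set e := intEmb d (B.1 1 1) with he
  have haO : a ∈ (intEmb d).range := ⟨_, rfl⟩
  have hbO : b ∈ (intEmb d).range := ⟨_, rfl⟩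
  have hcO : c ∈ (intEmb d).range := ⟨_, rfl⟩
  have heO : e ∈ (intEmb d).range := ⟨_, rfl⟩
  have hdet : a * e - b * c = 1 := by
    have := B.2
    rw [Matrix.det_fin_two] at this
    rw [ha, hb, hc, he, ← map_mul, ← map_mul, ← map_sub, this, map_one]
  obtain ⟨k, hk⟩ := hO.im_mem (mul_mem haO (hO.conj_mem hcO))
  obtain ⟨j, hj⟩ := hO.im_mem (mul_mem hbO (hO.conj_mem heO))
  obtain ⟨p, hp⟩ := hO.im_mem heO
  obtain ⟨q, hq⟩ := hO.im_mem hcO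
  -- Replacing `e` and `c` by their conjugates changes the real part of `a * e - b * c = 1` by `2 *
  -- (Im a * Im e - Im b * Im c)`. One factor `lam` comes from `e` and `c`; the second comes from
  -- the imaginary part of `p * a - q * b`, again a ring element.
  obtain ⟨K, hK⟩ := hO.im_mem (sub_mem (mul_mem (intCast_mem (intEmb d).range p) haO)
    (mul_mem (intCast_mem (intEmb d).range q) hbO))
  have hre : (a * (starRingEnd ℂ) e - b * (starRingEnd ℂ) c).re = 1 + 2 * lam ^ 2 * K := by
    have h1 := congrArg Complex.re hdet
    simp only [Complex.mul_re, Complex.sub_re, Complex.one_re, Complex.conj_re,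
      Complex.conj_im, Complex.sub_im, Complex.mul_im, Complex.intCast_re,
      Complex.intCast_im] at h1 hK ⊢
    have : p * a.im - q * b.im = K * lam := by linarith
    rw [hp, hq] at h1 ⊢
    linear_combination h1 + 2 * lam * this
  have hns : (a * (starRingEnd ℂ) e - b * (starRingEnd ℂ) c).re ^ 2 +
      (a * (starRingEnd ℂ) e + b * (starRingEnd ℂ) c).im ^ 2 =
      1 + 4 * ((a * (starRingEnd ℂ) c).im * (b * (starRingEnd ℂ) e).im) := by
    have h1 := congrArg Complex.re hdet
    have h2 := congrArg Complex.im hdet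
    simp only [Complex.mul_re, Complex.sub_re, Complex.one_re, Complex.one_im, Complex.conj_re,
      Complex.conj_im, Complex.sub_im, Complex.mul_im, Complex.add_im] at h1 h2 ⊢
    linear_combination (a.re * e.re - a.im * e.im - (b.re * c.re - b.im * c.im) + 1) * h1 +
      (a.re * e.im + a.im * e.re - (b.re * c.im + b.im * c.re)) * h2
  refine ⟨-j, -k, K, -(a * (starRingEnd ℂ) e + b * (starRingEnd ℂ) c).im, ?_, ?_, ?_⟩
  · rw [← hre, neg_sq, hns, hk, hj]; push_cast; ring
  · intro x hx
    have h0 : (QuotientGroup.mk B : Bi d) • x =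
        spinLin (Matrix.SpecialLinearGroup.map (intEmb d) B).1 x := by
      rw [bi_smul_def, incl_mk, spin_smul]
    rw [h0, spinLin_two_re _ hx]
    have e1 : ∀ r s, (Matrix.SpecialLinearGroup.map (intEmb d) B).1 r s = intEmb d (B.1 r s) :=
      fun _ _ => rfl
    simp only [e1, ← ha, ← hb, ← hc, ← he]
    rw [hre, hk, hj]; push_cast; ring
  · intro hj0 hk0 hK0
    rw [neg_eq_zero] at hj0 hk0
    rw [hj0] at hj
    rw [hk0] at hk
    rw [hK0] at hre
    have h5 : (a * (starRingEnd ℂ) e + b * (starRingEnd ℂ) c).im = 0 := by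
      rw [hre, hk, hj] at hns
      have : (a * (starRingEnd ℂ) e + b * (starRingEnd ℂ) c).im ^ 2 = 0 := by
        push_cast at hns; linarith
      simpa using this
    have h1 := congrArg Complex.re hdet
    have h2 := congrArg Complex.im hdet
    simp only [Complex.mul_re, Complex.sub_re, Complex.one_re, Complex.one_im, Complex.conj_re,
      Complex.conj_im, Complex.sub_im, Complex.mul_im, Complex.add_im] at h1 h2 h5 hk hj hre
    -- Together, `E1`, `E1'`, `E2` and `E3` state that the inverse of the matrix times its conjugate
    -- is the identity, so all four entries are real.
    have E1 : (starRingEnd ℂ) a * e - b * (starRingEnd ℂ) c = 1 := by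
      apply Complex.ext <;> simp only [Complex.mul_re, Complex.sub_re, Complex.one_re,
        Complex.one_im, Complex.conj_re, Complex.conj_im, Complex.sub_im, Complex.mul_im]
      · push_cast at hre; linarith
      · linarith
    have E1' : a * (starRingEnd ℂ) e - (starRingEnd ℂ) b * c = 1 := by
      have := congrArg (starRingEnd ℂ) E1
      simpa using this
    have E2 : a * (starRingEnd ℂ) c - (starRingEnd ℂ) a * c = 0 := by
      apply Complex.ext <;> simp only [Complex.mul_re, Complex.sub_re, Complex.zero_re,
        Complex.zero_im, Complex.conj_re, Complex.conj_im, Complex.sub_im, Complex.mul_im]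
      · ring
      · push_cast at hk; linarith
    have E3 : b * (starRingEnd ℂ) e - (starRingEnd ℂ) b * e = 0 := by
      apply Complex.ext <;> simp only [Complex.mul_re, Complex.sub_re, Complex.zero_re,
        Complex.zero_im, Complex.conj_re, Complex.conj_im, Complex.sub_im, Complex.mul_im]
      · ring
      · push_cast at hj; linarith
    have him : a.im = 0 ∧ b.im = 0 ∧ c.im = 0 ∧ e.im = 0 := by
      simp only [← Complex.conj_eq_iff_im]
      refine ⟨?_, ?_, ?_, ?_⟩
      · linear_combination a * E1 - (starRingEnd ℂ) a * hdet + b * E2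
      · linear_combination b * E1' - (starRingEnd ℂ) b * hdet - a * E3
      · linear_combination c * E1 - (starRingEnd ℂ) c * hdet + e * E2
      · linear_combination e * E1' - (starRingEnd ℂ) e * hdet - c * E3
    obtain ⟨a', ha'⟩ := hO.real_mem haO him.1
    obtain ⟨b', hb'⟩ := hO.real_mem hbO him.2.1
    obtain ⟨c', hc'⟩ := hO.real_mem hcO him.2.2.1
    obtain ⟨e', he'⟩ := hO.real_mem heO him.2.2.2
    have hdet' : (!![a', b'; c', e'] : Matrix (Fin 2) (Fin 2) ℤ).det = 1 := by
      rw [Matrix.det_fin_two]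
      rw [ha', hb', hc', he'] at hdet
      simp
      exact_mod_cast hdet
    have hinj : Function.Injective (intEmb d) := by
      intro r s hrs
      apply NumberField.RingOfIntegers.ext
      exact Subtype.ext hrs
    refine ⟨⟨!![a', b'; c', e'], hdet'⟩, ?_⟩
    change (QuotientGroup.mk _ : Bi d) = QuotientGroup.mk B
    congr 1
    refine Subtype.ext (Matrix.ext fun r s => hinj ?_)
    fin_cases r <;> fin_cases s <;> simp [← ha, ← hb, ← hc, ← he, ha', hb', hc', he'] <;>
      exact map_intCast (intEmb d) _

theorem mul_one_add_pos {r : ℝ} (hr : 1 < r) {K : ℤ} (hK : K ≠ 0) :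
    0 < (K : ℝ) * (1 + r * K) := by
  rcases lt_or_gt_of_ne hK with h | h
  · have h1 : (K : ℝ) ≤ -1 := by exact_mod_cast Int.le_sub_one_of_lt h
    have h2 : 1 + r * K < 0 := by nlinarith
    exact mul_pos_of_neg_of_neg (by linarith) h2
  · have : (0 : ℝ) < K := by exact_mod_cast h
    positivity

/-- Integrality of `K` and `lam > 1` give `|1 + 2 * lam ^ 2 * K| ≥ 1`; this is the non-crossing
condition for the two planes. -/
theorem wall_ineq {lam : ℝ} (hlam : 1 < lam) {j k K : ℤ} {t : ℝ}
    (h : (1 + 2 * lam ^ 2 * K) ^ 2 + t ^ 2 = 1 + 4 * lam ^ 2 * (j * k)) :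
    0 ≤ j * k ∧ t ^ 2 ≤ 4 * lam ^ 2 * (j * k) := by
  have hl2 : 1 < lam ^ 2 := by nlinarith
  have h1 : (1 : ℝ) ≤ (1 + 2 * lam ^ 2 * K) ^ 2 := by
    have e : (1 + 2 * lam ^ 2 * K) ^ 2 = 1 + 4 * lam ^ 2 * (K * (1 + lam ^ 2 * K)) := by ring
    rw [e]
    have : 0 ≤ (K : ℝ) * (1 + lam ^ 2 * K) := by
      by_cases hK : K = 0
      · simp [hK]
      · exact (mul_one_add_pos hl2 hK).le
    nlinarith
  refine ⟨?_, by linarith⟩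
  by_contra! hc
  have : ((j * k : ℤ) : ℝ) ≤ -1 := by exact_mod_cast Int.le_sub_one_of_lt hc
  push_cast at this
  nlinarith [sq_nonneg t, sq_nonneg (1 + 2 * lam ^ 2 * (K : ℝ))]

/-- At a common point, `wall_ineq` bounds `(k * P + j * R) ^ 2` by `4 * j * k * u ^ 2`, while the
arithmetic-geometric inequality bounds it below by `4 * j * k * P * R`. As `u ^ 2 < P * R`, this
forces `j * k = 0`, then all three integers vanish. -/
theorem mem_modularGroup_of_two_eq_zero {d : ℕ} {lam : ℝ}
    (hO : IsImaginaryOrder (intEmb d).range lam) {γ : Bi d} {x : Fin 4 → ℂ}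
    (hx : x ∈ futureCone) (h0 : (x 2).re = 0) (h1 : ((γ • x) 2).re = 0) :
    γ ∈ modularGroup d := by
  obtain ⟨B, rfl⟩ := exists_rep γ
  obtain ⟨j, k, K, t, h2, h3, h4⟩ := smul_two_re_coords hO B
  obtain ⟨h5, h6⟩ := wall_ineq hO.one_lt h2
  have hlam := hO.one_lt
  rw [h3 x hx.1, h0] at h1
  obtain ⟨hP, hR, hPR⟩ := futureCone_coords hx
  rw [h0] at hPR
  generalize √2 * (x 0).re = P at *
  generalize -(√2 * (x 3).re) = R at *
  generalize (x 1).re = u at *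
  have h7 : lam * (k * P + j * R) = t * u := by linarith
  have h8 : lam ^ 2 * (k * P + j * R) ^ 2 ≤ 4 * lam ^ 2 * (j * k) * u ^ 2 := by
    have : lam ^ 2 * (k * P + j * R) ^ 2 = t ^ 2 * u ^ 2 := by rw [← mul_pow, h7, mul_pow]
    rw [this]
    exact mul_le_mul_of_nonneg_right h6 (sq_nonneg u)
  have h9 : (k * P + j * R) ^ 2 ≤ 4 * (j * k) * u ^ 2 := by
    have hl : 0 < lam ^ 2 := by positivity
    nlinarith
  have h5' : (0 : ℝ) ≤ j * k := by exact_mod_cast h5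
  have hjk : (j * k : ℝ) = 0 := by
    by_contra hne
    have hpos : (0 : ℝ) < j * k := lt_of_le_of_ne h5' (Ne.symm hne)
    nlinarith [sq_nonneg (k * P - j * R), mul_pos hpos (sub_pos.mpr hPR)]
  have hsum : (k * P + j * R : ℝ) = 0 := by
    have : (k * P + j * R : ℝ) ^ 2 ≤ 0 := by rw [hjk] at h9; linarith
    exact pow_eq_zero_iff two_ne_zero |>.mp (le_antisymm this (sq_nonneg _))
  have hj : (j : ℝ) = 0 := by
    rcases mul_eq_zero.mp hjk with h | h
    · exact h
    · rw [h] at hsum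
      simpa [hR.ne'] using hsum
  have hk : (k : ℝ) = 0 := by
    rw [hj] at hsum
    simpa [hP.ne'] using hsum
  have hK : (K : ℝ) = 0 := by
    rw [hj] at h2
    have e : 4 * lam ^ 2 * (K * (1 + lam ^ 2 * K)) + t ^ 2 = 0 := by linear_combination h2
    have hl2 : 1 < lam ^ 2 := by nlinarith
    by_contra hK
    have h10 := mul_one_add_pos hl2 (K := K) (fun h => hK (by simp [h]))
    nlinarith [sq_nonneg t, mul_pos (pow_pos (by linarith : 0 < lam) 2) h10]
  exact h4 (by exact_mod_cast hj) (by exact_mod_cast hk) (by exact_mod_cast hK)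

theorem wall_unique {d : ℕ} {lam : ℝ} (hO : IsImaginaryOrder (intEmb d).range lam)
    {m m' : Wall d} {x : Fin 4 → ℂ} (hx : x ∈ futureCone) (h : wallForm d m x = 0)
    (h' : wallForm d m' x = 0) : m = m' := by
  obtain ⟨γ, rfl⟩ := exists_eq_smul_baseWall m
  obtain ⟨δ, rfl⟩ := exists_eq_smul_baseWall m'
  rw [← smul_inv_smul γ x, wallForm_smul, wallForm_baseWall] at h
  rw [← smul_inv_smul δ x, wallForm_smul, wallForm_baseWall] at h'
  have h1 : ((δ⁻¹ * γ) • γ⁻¹ • x) = δ⁻¹ • x := by rw [smul_smul]; simp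
  have := mem_modularGroup_of_two_eq_zero hO (γ := δ⁻¹ * γ)
    (bi_smul_mem_futureCone γ⁻¹ x hx) h (by rw [h1]; exact h')
  rw [← smul_baseWall_eq, mul_smul, inv_smul_eq_iff] at this
  exact this

theorem wallForm_coords {d : ℕ} {lam : ℝ} (hO : IsImaginaryOrder (intEmb d).range lam)
    (m : Wall d) : ∃ (j k K : ℤ) (t : ℝ),
      (1 + 2 * lam ^ 2 * K) ^ 2 + t ^ 2 = 1 + 4 * lam ^ 2 * (j * k) ∧
      (∀ x : Fin 4 → ℂ, (∀ i, (x i).im = 0) → wallForm d m x =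
          -lam * (k * (√2 * (x 0).re) + j * -(√2 * (x 3).re)) +
            (1 + 2 * lam ^ 2 * K) * (x 2).re + t * (x 1).re) ∧
      (j = 0 → k = 0 → K = 0 → m = baseWall d) := by
  obtain ⟨γ, rfl⟩ := exists_eq_smul_baseWall m
  obtain ⟨B, hB⟩ := exists_rep γ⁻¹
  obtain ⟨j, k, K, t, h1, h2, h3⟩ := smul_two_re_coords hO B
  refine ⟨j, k, K, t, h1, fun x hx => ?_, fun a b c => ?_⟩
  · rw [← h2 x hx, ← hB]
    nth_rewrite 1 [← smul_inv_smul γ x]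
    rw [wallForm_smul, wallForm_baseWall]
  · have := h3 a b c
    rw [← hB, inv_mem_iff] at this
    exact smul_baseWall_eq.mpr this

/-! ### Points of a horosphere and local finiteness of the walls. -/

/-- The point `(u, w)` of the horosphere of height one. -/
def horoPoint (u w : ℝ) : Fin 4 → ℂ :=
  ![((1 + u ^ 2 + w ^ 2) / √2 : ℝ), (u : ℂ), (w : ℂ), (-(1 / √2) : ℝ)]

theorem horoPoint_mem (u w : ℝ) : horoPoint u w ∈ futureCone := by
  have him : ∀ j, (horoPoint u w j).im = 0 := by
    intro j; fin_cases j <;> exact Complex.ofReal_im _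
  have hs : √2 * √2 = (2 : ℝ) := Real.mul_self_sqrt (by norm_num)
  refine ⟨him, ?_, ?_⟩
  · rw [hnorm_of_real him]
    simp only [horoPoint, Matrix.cons_val, Complex.ofReal_re]
    have e : 2 * ((1 + u ^ 2 + w ^ 2) / √2) * -(1 / √2) = -(2 * (1 + u ^ 2 + w ^ 2) / (√2 * √2)) := by
      field_simp
    rw [e, hs]; linarith
  · simp only [horoPoint, Matrix.cons_val, Complex.ofReal_re]
    positivity

theorem exists_mem_wall {d : ℕ} (m : Wall d) : ∃ p ∈ futureCone, wallForm d m p = 0 := by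
  obtain ⟨γ, rfl⟩ := exists_eq_smul_baseWall m
  refine ⟨γ • horoPoint 0 0, bi_smul_mem_futureCone γ _ (horoPoint_mem 0 0), ?_⟩
  rw [wallForm_smul, wallForm_baseWall]
  simp [horoPoint]

/-- Cauchy–Schwarz and the norm relation bound the right side of `hle` in terms of `j * k`, and `4 *
j * k * P * R ≤ (k * P + j * R) ^ 2` absorbs that term because `u ^ 2 + w ^ 2 < P * R`. -/
theorem wall_bound {lam P R u w j k K t : ℝ} (hlam : 1 < lam) (hP : 0 < P) (hR : 0 < R)
    (hPR : u ^ 2 + w ^ 2 < P * R) (hjk : 0 ≤ j * k)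
    (h : (1 + 2 * lam ^ 2 * K) ^ 2 + t ^ 2 = 1 + 4 * lam ^ 2 * (j * k))
    (hle : |lam * (k * P + j * R)| ≤ |(1 + 2 * lam ^ 2 * K) * w + t * u|) :
    k ^ 2 * P ^ 2 + j ^ 2 * R ^ 2 ≤ P * R * (u ^ 2 + w ^ 2) / (P * R - (u ^ 2 + w ^ 2)) := by
  have hpos : 0 < P * R - (u ^ 2 + w ^ 2) := by linarith
  have h1 := sq_le_sq.mpr hle
  have h2 : ((1 + 2 * lam ^ 2 * K) * w + t * u) ^ 2 ≤
      ((1 + 2 * lam ^ 2 * K) ^ 2 + t ^ 2) * (u ^ 2 + w ^ 2) := by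
    nlinarith [sq_nonneg ((1 + 2 * lam ^ 2 * K) * u - t * w)]
  rw [h] at h2
  set s := k * P + j * R with hs
  set D := u ^ 2 + w ^ 2 with hD
  have hD0 : 0 ≤ D := by positivity
  have h3 : 4 * (j * k) * (P * R) ≤ s ^ 2 := by
    nlinarith [sq_nonneg (k * P - j * R)]
  have h4 : (lam * s) ^ 2 * (P * R - D) ≤ P * R * D := by
    have h5 : (lam * s) ^ 2 ≤ (1 + 4 * lam ^ 2 * (j * k)) * D := h1.trans h2
    have hPR0 : 0 < P * R := mul_pos hP hR
    have h6 := mul_le_mul_of_nonneg_right h5 hPR0.le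
    have h7 := mul_le_mul_of_nonneg_left h3 (mul_nonneg (sq_nonneg lam) hD0)
    nlinarith
  have h8 : k ^ 2 * P ^ 2 + j ^ 2 * R ^ 2 ≤ (lam * s) ^ 2 := by
    have h9 : k ^ 2 * P ^ 2 + j ^ 2 * R ^ 2 ≤ s ^ 2 := by
      nlinarith [mul_nonneg hjk (mul_pos hP hR).le]
    have : 1 ≤ lam ^ 2 := by nlinarith
    nlinarith [sq_nonneg s]
  rw [le_div_iff₀ hpos]
  exact (mul_le_mul_of_nonneg_right h8 hpos.le).trans h4

theorem same_sign_of_abs_lt {lam a b e f : ℝ} (h : 0 ≤ a * b) (ha : |e| < |lam * a|)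
    (hb : |f| < |lam * b|) : 0 < (-lam * a + e) * (-lam * b + f) := by
  have h1 : 0 ≤ (lam * a) * (lam * b) := by
    have : (lam * a) * (lam * b) = lam ^ 2 * (a * b) := by ring
    rw [this]; positivity
  have e1 : -lam * a = -(lam * a) := by ring
  have e2 : -lam * b = -(lam * b) := by ring
  rw [e1, e2]
  generalize lam * a = A at *
  generalize lam * b = B at *
  have hA : A ≠ 0 := by intro h; rw [h, abs_zero] at ha; linarith [abs_nonneg e]
  have hB : B ≠ 0 := by intro h; rw [h, abs_zero] at hb; linarith [abs_nonneg f]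
  rcases lt_or_gt_of_ne hA with hA | hA
  · have hB' : B < 0 := by
      by_contra! hc
      have := lt_of_le_of_ne hc hB.symm
      nlinarith
    rw [abs_of_neg hA, abs_lt] at ha
    rw [abs_of_neg hB', abs_lt] at hb
    exact mul_pos (by linarith) (by linarith)
  · have hB' : 0 < B := by
      by_contra! hc
      have := lt_of_le_of_ne hc hB
      nlinarith
    rw [abs_of_pos hA, abs_lt] at ha
    rw [abs_of_pos hB', abs_lt] at hb
    exact mul_pos_of_neg_of_neg (by linarith) (by linarith)

theorem walls_finite {d : ℕ} {lam : ℝ} (hO : IsImaginaryOrder (intEmb d).range lam)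
    {x y : Fin 4 → ℂ} (hx : x ∈ futureCone) (hy : y ∈ futureCone) :
    {m : Wall d | wallForm d m x * wallForm d m y ≤ 0}.Finite := by
  classical
  choose j k K t h1 h2 h3 using wallForm_coords (d := d) hO
  have hlam := hO.one_lt
  have key : ∀ z ∈ futureCone, ∃ b : ℝ, ∀ m,
      |lam * (k m * (√2 * (z 0).re) + j m * -(√2 * (z 3).re))| ≤
        |(1 + 2 * lam ^ 2 * K m) * (z 2).re + t m * (z 1).re| →
      (j m : ℝ) ^ 2 + (k m : ℝ) ^ 2 ≤ b := by
    intro z hz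
    obtain ⟨hP, hR, hPR⟩ := futureCone_coords hz
    generalize √2 * (z 0).re = P at *
    generalize -(√2 * (z 3).re) = R at *
    generalize (z 1).re = u at *
    generalize (z 2).re = w at *
    refine ⟨P * R * (u ^ 2 + w ^ 2) / (P * R - (u ^ 2 + w ^ 2)) / P ^ 2 +
      P * R * (u ^ 2 + w ^ 2) / (P * R - (u ^ 2 + w ^ 2)) / R ^ 2, fun m hm => ?_⟩
    have hjk : (0 : ℝ) ≤ j m * k m := by exact_mod_cast (wall_ineq hlam (h1 m)).1
    have hb := wall_bound hlam hP hR hPR hjk (h1 m) hm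
    rw [add_comm]
    apply add_le_add
    · rw [le_div_iff₀ (by positivity)]
      nlinarith [mul_nonneg (sq_nonneg (j m : ℝ)) (sq_nonneg R)]
    · rw [le_div_iff₀ (by positivity)]
      nlinarith [mul_nonneg (sq_nonneg (k m : ℝ)) (sq_nonneg P)]
  obtain ⟨b, hb⟩ := key x hx
  obtain ⟨b', hb'⟩ := key y hy
  obtain ⟨N, hN⟩ := exists_nat_gt (4 + 4 * lam ^ 2 * (|b| + |b'| + 1) + (|b| + |b'| + 1))
  have habs : ∀ (i : ℤ), (i : ℝ) ^ 2 ≤ |b| + |b'| → i ∈ Set.Icc (-(N : ℤ)) N := by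
    intro i hi
    have h4 : |(i : ℝ)| ≤ N := by
      have : |(i : ℝ)| ≤ 1 + |(i : ℝ)| ^ 2 := by nlinarith [sq_nonneg (|(i : ℝ)| - 1 / 2)]
      rw [sq_abs] at this
      have h5 : 0 ≤ 4 * lam ^ 2 * (|b| + |b'| + 1) := by positivity
      linarith
    rw [abs_le] at h4
    exact ⟨by exact_mod_cast h4.1, by exact_mod_cast h4.2⟩
  have hbound : ∀ m ∈ {m : Wall d | wallForm d m x * wallForm d m y ≤ 0},
      j m ∈ Set.Icc (-(N : ℤ)) N ∧ k m ∈ Set.Icc (-(N : ℤ)) N ∧ K m ∈ Set.Icc (-(N : ℤ)) N := by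
    intro m hm
    have hm' : wallForm d m x * wallForm d m y ≤ 0 := hm
    have hjk : 0 ≤ (j m : ℝ) * k m := by exact_mod_cast (wall_ineq hlam (h1 m)).1
    -- For large `j`, `k` the term in `lam` dominates at both points. It has the same sign at both
    -- since `j * k ≥ 0`, so the wall cannot separate them.
    have hsum : (j m : ℝ) ^ 2 + (k m : ℝ) ^ 2 ≤ |b| + |b'| := by
      by_contra! hc
      have hx1 := mt (hb m) (by linarith [le_abs_self b, abs_nonneg b'])
      have hy1 := mt (hb' m) (by linarith [le_abs_self b', abs_nonneg b])
      push Not at hx1 hy1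
      obtain ⟨hP, hR, -⟩ := futureCone_coords hx
      obtain ⟨hP', hR', -⟩ := futureCone_coords hy
      have hprod := same_sign_of_abs_lt (lam := lam) (by
        generalize √2 * (x 0).re = P at *
        generalize -(√2 * (x 3).re) = R at *
        generalize √2 * (y 0).re = P' at *
        generalize -(√2 * (y 3).re) = R' at *
        have e : (k m * P + j m * R) * (k m * P' + j m * R') =
          (k m : ℝ) ^ 2 * (P * P') + (j m : ℝ) ^ 2 * (R * R') +
            (j m * k m) * (P * R' + R * P') := by ring
        rw [e]; positivity) hx1 hy1
      rw [h2 m x hx.1, h2 m y hy.1] at hm'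
      linarith
    have hj2 : (j m : ℝ) ^ 2 ≤ |b| + |b'| := by nlinarith [sq_nonneg (k m : ℝ)]
    have hk2 : (k m : ℝ) ^ 2 ≤ |b| + |b'| := by nlinarith [sq_nonneg (j m : ℝ)]
    refine ⟨habs _ hj2, habs _ hk2, ?_⟩
    have h4 : |(K m : ℝ)| ≤ N := by
      have h5 : (j m : ℝ) * k m ≤ |b| + |b'| := by nlinarith [sq_nonneg ((j m : ℝ) - k m)]
      have h6 : (1 + 2 * lam ^ 2 * (K m : ℝ)) ^ 2 ≤ 1 + 4 * lam ^ 2 * (|b| + |b'|) := by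
        have := h1 m
        nlinarith [sq_nonneg (t m), mul_le_mul_of_nonneg_left h5 (by positivity : 0 ≤ 4 * lam ^ 2)]
      have hl2 : 1 ≤ lam ^ 2 := by nlinarith
      have h7 : |(K m : ℝ)| ≤ |2 * lam ^ 2 * (K m : ℝ)| := by
        rw [abs_mul, abs_of_pos (by positivity : 0 < 2 * lam ^ 2)]
        nlinarith [abs_nonneg (K m : ℝ)]
      have h8 : |2 * lam ^ 2 * (K m : ℝ)| ≤ |1 + 2 * lam ^ 2 * (K m : ℝ)| + 1 := by
        have := abs_sub (1 + 2 * lam ^ 2 * (K m : ℝ)) 1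
        simpa using this
      have h9 : |1 + 2 * lam ^ 2 * (K m : ℝ)| ≤ 1 + |1 + 2 * lam ^ 2 * (K m : ℝ)| ^ 2 := by
        nlinarith [sq_nonneg (|1 + 2 * lam ^ 2 * (K m : ℝ)| - 1 / 2)]
      rw [sq_abs] at h9
      have h10 : 0 ≤ |b| + |b'| := by positivity
      nlinarith
    rw [abs_le] at h4
    exact ⟨by exact_mod_cast h4.1, by exact_mod_cast h4.2⟩
  -- The integers determine `t` up to sign through the norm relation, and the form determines its
  -- wall because every wall has a point in the cone.
  set Φ : Wall d → ℤ × ℤ × ℤ × Bool := fun m => (j m, k m, K m, decide (0 ≤ t m)) with hΦ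
  have hinj : Function.Injective Φ := by
    intro m m' he
    simp only [hΦ, Prod.mk.injEq, decide_eq_decide] at he
    obtain ⟨e1, e2, e3, e4⟩ := he
    have ht : t m = t m' := by
      have ha := h1 m
      have hb := h1 m'
      rw [e1, e2, e3] at ha
      have hsq : t m ^ 2 = t m' ^ 2 := by linarith
      rcases sq_eq_sq_iff_eq_or_eq_neg.mp hsq with h | h
      · exact h
      · rcases le_or_gt 0 (t m) with h5 | h5
        · have := e4.mp h5; linarith
        · have : ¬ 0 ≤ t m' := fun h6 => absurd (e4.mpr h6) (not_le.mpr h5)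
          linarith
    obtain ⟨p, hp, hp0⟩ := exists_mem_wall m
    refine wall_unique hO hp hp0 ?_
    rw [h2 m' p hp.1, ← e1, ← e2, ← e3, ← ht, ← h2 m p hp.1, hp0]
  refine Set.Finite.of_finite_image (f := Φ) ?_ hinj.injOn
  refine Set.Finite.subset ((Set.finite_Icc (-(N : ℤ)) N).prod ((Set.finite_Icc (-(N : ℤ)) N).prod
    ((Set.finite_Icc (-(N : ℤ)) N).prod (Set.finite_univ (α := Bool))))) ?_
  rintro _ ⟨m, hm, rfl⟩
  obtain ⟨a1, a2, a3⟩ := hbound m hm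
  exact ⟨a1, a2, a3, Set.mem_univ _⟩

theorem isWallSystem {d : ℕ} {lam : ℝ} (hO : IsImaginaryOrder (intEmb d).range lam) :
    IsWallSystem (wallForm d) futureCone where
  convex := futureCone_convex
  disjoint := wall_unique hO
  finite := walls_finite hO

/-! ### Vertical walls and the two regions bordering the base plane. -/

/-- Along the horosphere of height one, every wall but the vertical ones keeps one sign. -/
theorem wallForm_horoPoint {d : ℕ} {lam : ℝ} (hO : IsImaginaryOrder (intEmb d).range lam)
    (m : Wall d) : (∃ k : ℝ, ∀ u w, k * wallForm d m (horoPoint u w) < 0) ∨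
      ∃ j : ℤ, (∀ u w, wallForm d m (horoPoint u w) = w - lam * j) ∧
        (j = 0 → m = baseWall d) := by
  obtain ⟨j, k, K, t, h1, h2, h3⟩ := wallForm_coords hO m
  have hlam := hO.one_lt
  have hl2 : 1 < lam ^ 2 := by nlinarith
  have hs0 : √2 ≠ 0 := by positivity
  have h4 : ∀ u w : ℝ, wallForm d m (horoPoint u w) =
      -lam * (k * (1 + u ^ 2 + w ^ 2) + j) + (1 + 2 * lam ^ 2 * K) * w + t * u := by
    intro u w
    rw [h2 _ (horoPoint_mem u w).1]
    simp only [horoPoint, Matrix.cons_val, Complex.ofReal_re]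
    field_simp
  by_cases hk : k = 0
  · right
    rw [hk] at h1
    have hK : K = 0 := by
      by_contra hK
      have e : 4 * lam ^ 2 * (K * (1 + lam ^ 2 * K)) + t ^ 2 = 0 := by
        push_cast at h1; linear_combination h1
      nlinarith [mul_one_add_pos hl2 hK, sq_nonneg t,
        mul_pos (pow_pos (by linarith : 0 < lam) 2) (mul_one_add_pos hl2 hK)]
    rw [hK] at h1
    have ht : t = 0 := by
      have : t ^ 2 = 0 := by push_cast at h1; linarith
      simpa using this
    refine ⟨j, fun u w => ?_, fun hj => h3 hj hk hK⟩
    rw [h4, hk, hK, ht]; push_cast; ring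
  · left
    refine ⟨k, fun u w => ?_⟩
    rw [h4]
    have hk1 : (1 : ℝ) ≤ (k : ℝ) ^ 2 := by
      have : 1 ≤ k ^ 2 := by
        have := sq_nonneg k
        have h5 : k ^ 2 ≠ 0 := pow_ne_zero 2 hk
        omega
      exact_mod_cast this
    -- In the upper half space the wall is a hemisphere of radius `1 / (2 * lam * |k|)`, less than
    -- one, so it stays below height one. This identity is the completed square.
    have e : 4 * lam * (k * (-lam * (k * (1 + u ^ 2 + w ^ 2) + j) +
        (1 + 2 * lam ^ 2 * K) * w + t * u)) = 1 - 4 * lam ^ 2 * k ^ 2 -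
        ((2 * lam * k * u - t) ^ 2 + (2 * lam * k * w - (1 + 2 * lam ^ 2 * K)) ^ 2) := by
      linear_combination h1
    have h5 : 4 * lam * (k * (-lam * (k * (1 + u ^ 2 + w ^ 2) + j) +
        (1 + 2 * lam ^ 2 * K) * w + t * u)) < 0 := by
      rw [e]
      nlinarith [sq_nonneg (2 * lam * k * u - t),
        sq_nonneg (2 * lam * k * w - (1 + 2 * lam ^ 2 * K)), mul_pos (by linarith : 0 < lam ^ 2)
        (by linarith : (0 : ℝ) < k ^ 2)]
    have hl : 0 < 4 * lam := by linarith
    by_contra! hc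
    linarith [mul_nonneg hl.le hc]

theorem horoPoint_mem_offWalls {d : ℕ} {lam : ℝ} (hO : IsImaginaryOrder (intEmb d).range lam)
    {u w : ℝ} (hw : ∀ j : ℤ, w ≠ lam * j) : horoPoint u w ∈ offWalls (wallForm d) futureCone := by
  refine ⟨horoPoint_mem u w, fun m h => ?_⟩
  rcases wallForm_horoPoint hO m with ⟨k, hk⟩ | ⟨j, hj, -⟩
  · have := hk u w
    rw [h] at this; simp at this
  · rw [hj] at h
    exact hw j (by linarith)

theorem half_ne_mul_int {lam : ℝ} (hlam : 1 < lam) (j : ℤ) :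
    lam / 2 ≠ lam * j ∧ -(lam / 2) ≠ lam * j := by
  constructor <;> intro h
  · have h1 : (1 : ℝ) = 2 * j := by
      have : lam * 1 = lam * (2 * j) := by linarith
      exact mul_left_cancel₀ (by linarith) this
    have : (1 : ℤ) = 2 * j := by exact_mod_cast h1
    omega
  · have h1 : (-1 : ℝ) = 2 * j := by
      have : lam * (-1) = lam * (2 * j) := by linarith
      exact mul_left_cancel₀ (by linarith) this
    have : (-1 : ℤ) = 2 * j := by exact_mod_cast h1
    omega

/-- A point on the negative side of the base wall, next to it. -/
def negPoint (lam : ℝ) : Fin 4 → ℂ := horoPoint 0 (-(lam / 2))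

/-- A point on the positive side of the base wall, next to it. -/
def posPoint (lam : ℝ) : Fin 4 → ℂ := horoPoint 0 (lam / 2)

theorem negPoint_mem {d : ℕ} {lam : ℝ} (hO : IsImaginaryOrder (intEmb d).range lam) :
    negPoint lam ∈ offWalls (wallForm d) futureCone :=
  horoPoint_mem_offWalls hO fun j => (half_ne_mul_int hO.one_lt j).2

theorem posPoint_mem {d : ℕ} {lam : ℝ} (hO : IsImaginaryOrder (intEmb d).range lam) :
    posPoint lam ∈ offWalls (wallForm d) futureCone :=
  horoPoint_mem_offWalls hO fun j => (half_ne_mul_int hO.one_lt j).1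

theorem pos_of_mul_neg_neg {k a b : ℝ} (ha : k * a < 0) (hb : k * b < 0) : 0 < a * b := by
  have := mul_pos_of_neg_of_neg ha hb
  have e : k * a * (k * b) = k ^ 2 * (a * b) := by ring
  rw [e] at this
  exact pos_of_mul_pos_right this (sq_nonneg k)

theorem adjacent_negPoint_posPoint {d : ℕ} {lam : ℝ}
    (hO : IsImaginaryOrder (intEmb d).range lam) :
    AdjacentAlong (wallForm d) (baseWall d) (negPoint lam) (posPoint lam) := by
  have hlam := hO.one_lt
  refine ⟨?_, ?_, fun m hm => ?_⟩
  · rw [wallForm_baseWall]; simp [negPoint, horoPoint]; linarith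
  · rw [wallForm_baseWall]; simp [posPoint, horoPoint]; linarith
  · rcases wallForm_horoPoint hO m with ⟨k, hk⟩ | ⟨j, hj, hj0⟩
    · exact pos_of_mul_neg_neg (hk _ _) (hk _ _)
    · rw [negPoint, posPoint, hj, hj]
      have hj1 : (1 : ℝ) ≤ (j : ℝ) ^ 2 := by
        have : 1 ≤ j ^ 2 := by
          have h5 : j ^ 2 ≠ 0 := pow_ne_zero 2 fun h => hm (hj0 h)
          have := sq_nonneg j
          omega
        exact_mod_cast this
      have e : (-(lam / 2) - lam * j) * (lam / 2 - lam * j) = lam ^ 2 * (j ^ 2 - 1 / 4) := by ring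
      rw [e]
      exact mul_pos (by positivity) (by linarith)

theorem wallForm_horoPoint_translate {d : ℕ} {lam : ℝ}
    (hO : IsImaginaryOrder (intEmb d).range lam) {u u' w : ℝ} (hw : ∀ j : ℤ, w ≠ lam * j) :
    SameSide (wallForm d) (horoPoint u w) (horoPoint u' w) := by
  intro m
  rcases wallForm_horoPoint hO m with ⟨k, hk⟩ | ⟨j, hj, -⟩
  · exact pos_of_mul_neg_neg (hk _ _) (hk _ _)
  · rw [hj, hj]
    exact mul_self_pos.mpr fun h => hw j (by linarith)

/-! ### Translations and the stable letter. -/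

/-- The unipotent matrix with upper right entry `β`. -/
def translation {R : Type*} [CommRing R] (β : R) : SL(2, R) :=
  ⟨!![1, β; 0, 1], by simp [Matrix.det_fin_two]⟩

theorem spinLin_translation_horoPoint (β : ℂ) (u w : ℝ) :
    spinLin !![1, β; 0, 1] (horoPoint u w) = horoPoint (u - β.re) (w + β.im) := by
  have hs0 : ((√2 : ℝ) : ℂ) ≠ 0 := by simp
  have hs : ((√2 : ℝ) : ℂ) * ((√2 : ℝ) : ℂ) = 2 := by
    rw [← Complex.ofReal_mul, Real.mul_self_sqrt (by norm_num)]; simp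
  apply toHerm.injective
  rw [toHerm_spinLin, toHerm_entries, toHerm_entries]
  ext r s
  fin_cases r <;> fin_cases s <;> apply Complex.ext <;>
    simp [horoPoint, Matrix.mul_apply, hs0, pow_two] <;> field_simp <;> ring_nf

theorem map_translation {d : ℕ} (β : 𝓞 (Qd d)) :
    (Matrix.SpecialLinearGroup.map (intEmb d) (translation β)).1 = !![1, intEmb d β; 0, 1] := by
  ext r s
  fin_cases r <;> fin_cases s
  · exact map_one (intEmb d)
  · rfl
  · exact map_zero (intEmb d)
  · exact map_one (intEmb d)

theorem translation_smul_horoPoint {d : ℕ} (β : 𝓞 (Qd d)) (u w : ℝ) :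
    (QuotientGroup.mk (translation β) : Bi d) • horoPoint u w =
      horoPoint (u - (intEmb d β).re) (w + (intEmb d β).im) := by
  rw [bi_smul_def, incl_mk, spin_smul, map_translation, spinLin_translation_horoPoint]

theorem posPoint_sameSide {d : ℕ} {lam : ℝ} (hO : IsImaginaryOrder (intEmb d).range lam)
    {β : 𝓞 (Qd d)} (hβ : (intEmb d β).im = lam) :
    SameSide (wallForm d) (posPoint lam)
      ((QuotientGroup.mk (translation β) : Bi d) • negPoint lam) := by
  rw [negPoint, translation_smul_horoPoint, hβ, posPoint]
  have : -(lam / 2) + lam = lam / 2 := by ring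
  rw [this]
  exact wallForm_horoPoint_translate hO fun j => (half_ne_mul_int hO.one_lt j).1

/-! ### Regions -/

/-- The segment from `x` to `x'` meets `o` without meeting any other wall, and points of `o` are not
separated by other walls. -/
theorem AdjacentAlong.wall_pos {V W : Type*} [AddCommGroup V] [Module ℝ V]
    {ℓ : W → V →ₗ[ℝ] ℝ} {H : Set V} (hW : IsWallSystem ℓ H) {o : W} {x x' p : V} (hx : x ∈ H)
    (hx' : x' ∈ H) (h : AdjacentAlong ℓ o x x') (hp : p ∈ H) (hp0 : ℓ o p = 0) {m : W}
    (hm : m ≠ o) : 0 < ℓ m p * ℓ m x := by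
  obtain ⟨t, ht, h0⟩ := exists_zero_on_segment (ℓ o) (x := x) (y := x')
    (mul_neg_of_neg_of_pos h.1 h.2.1).le
  have h1 := hW.sameSide_on_wall hm hp (hW.segment_mem hx hx' ht) hp0 h0
  have h2 := h.2.2 m hm
  refine mul_pos_trans h1 ?_
  have hne : ℓ m x ≠ 0 := by intro h3; rw [h3] at h2; simp at h2
  rw [linear_apply_segment]
  rcases eq_or_lt_of_le ht.2 with h4 | h4
  · rw [h4, mul_comm]; simpa using h2
  · nlinarith [mul_nonneg ht.1 h2.le, mul_pos (sub_pos.mpr h4) (mul_self_pos.mpr hne)]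

theorem continuous_hnorm : Continuous hnorm := by
  unfold hnorm; fun_prop

theorem continuous_wallForm {d : ℕ} (m : Wall d) : Continuous (wallForm d m) :=
  LinearMap.continuous_of_finiteDimensional _

/-- The radial projection of the future cone to real hyperbolic space. -/
def normalize (x : Fin 4 → ℂ) : Fin 4 → ℂ := ((√(-hnorm x))⁻¹ : ℝ) • x

theorem normalize_eq {x : Fin 4 → ℂ} (hx : x ∈ HR) : normalize x = x := by
  have : hnorm x = -1 := hx.2.1
  simp [normalize, this]

theorem HR_subset : HR ⊆ futureCone := fun x hx => ⟨hx.1, by rw [hx.2.1]; norm_num, hx.2.2⟩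

theorem sqrt_hnorm_pos {x : Fin 4 → ℂ} (hx : x ∈ futureCone) : 0 < (√(-hnorm x))⁻¹ := by
  have : 0 < -hnorm x := neg_pos.mpr hx.2.1
  positivity

theorem normalize_mem {x : Fin 4 → ℂ} (hx : x ∈ futureCone) : normalize x ∈ HR := by
  have h0 := sqrt_hnorm_pos hx
  have h1 := smul_mem_futureCone hx h0
  have e : normalize x = ((√(-hnorm x))⁻¹ : ℝ) • x := rfl
  have e' : normalize x = (((√(-hnorm x))⁻¹ : ℝ) : ℂ) • x := by rw [e]; ext j; simp
  refine ⟨by rw [e']; exact h1.1, ?_, by rw [e']; exact h1.2.2⟩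
  rw [e', hnorm_const_smul, Complex.norm_real, Real.norm_eq_abs, sq_abs, inv_pow,
    Real.sq_sqrt (neg_pos.mpr hx.2.1).le]
  have : hnorm x ≠ 0 := hx.2.1.ne
  field_simp

theorem continuousOn_normalize : ContinuousOn normalize futureCone := by
  have h : ContinuousOn (fun x => (√(-hnorm x))⁻¹) futureCone := by
    refine ContinuousOn.inv₀ ?_ fun x hx => (Real.sqrt_pos.mpr (neg_pos.mpr hx.2.1)).ne'
    exact (Real.continuous_sqrt.comp continuous_hnorm.neg).continuousOn
  exact h.smul continuousOn_id

theorem wallForm_normalize {d : ℕ} (m : Wall d) (x : Fin 4 → ℂ) :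
    wallForm d m (normalize x) = (√(-hnorm x))⁻¹ * wallForm d m x := by
  rw [normalize, map_smul, smul_eq_mul]

theorem sameSide_normalize {d : ℕ} {x y : Fin 4 → ℂ} (hy : y ∈ futureCone) :
    SameSide (wallForm d) x (normalize y) ↔ SameSide (wallForm d) x y := by
  refine forall_congr' fun m => ?_
  rw [wallForm_normalize, mul_left_comm]
  exact mul_pos_iff_of_pos_left (sqrt_hnorm_pos hy)

theorem bi_smul_mem_HR {d : ℕ} (γ : Bi d) {x : Fin 4 → ℂ} (hx : x ∈ HR) : γ • x ∈ HR := by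
  have h := bi_smul_mem_futureCone γ x (HR_subset hx)
  exact ⟨h.1, (hnorm_smul _ x).trans hx.2.1, h.2.2⟩

theorem mem_plane {x : Fin 4 → ℂ} : x ∈ plane ↔ x ∈ HR ∧ (x 2).re = 0 := by
  constructor
  · rintro ⟨h1, h2⟩
    exact ⟨h1, by rw [h2]; simp⟩
  · rintro ⟨h1, h2⟩
    exact ⟨h1, Complex.ext h2 (h1.1 2)⟩

theorem move_eq {d : ℕ} (γ : Bi d) (s : Set (Fin 4 → ℂ)) :
    move (incl d) γ s = {x | γ⁻¹ • x ∈ s} := by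
  ext x
  constructor
  · rintro ⟨y, hy, rfl⟩
    change γ⁻¹ • γ • y ∈ s
    rwa [inv_smul_smul]
  · intro h
    exact ⟨γ⁻¹ • x, h, smul_inv_smul γ x⟩

theorem mem_move_plane {d : ℕ} {γ : Bi d} {x : Fin 4 → ℂ} :
    x ∈ move (incl d) γ plane ↔ x ∈ HR ∧ wallForm d (γ • baseWall d) x = 0 := by
  rw [move_eq]
  change γ⁻¹ • x ∈ plane ↔ _
  rw [mem_plane]
  have e : wallForm d (γ • baseWall d) x = ((γ⁻¹ • x) 2).re := by
    nth_rewrite 1 [← smul_inv_smul γ x]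
    rw [wallForm_smul, wallForm_baseWall]
  rw [e]
  refine and_congr_left fun _ => ⟨fun h => ?_, fun h => bi_smul_mem_HR _ h⟩
  rw [← smul_inv_smul γ x]
  exact bi_smul_mem_HR _ h

theorem mem_complement {d : ℕ} {x : Fin 4 → ℂ} :
    x ∈ complement (incl d) ↔ x ∈ HR ∧ ∀ m, wallForm d m x ≠ 0 := by
  unfold complement
  rw [Set.mem_sdiff, Set.mem_iUnion]
  refine and_congr_right fun hx => ?_
  push Not
  constructor
  · intro h m
    obtain ⟨γ, rfl⟩ := exists_eq_smul_baseWall m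
    exact fun h0 => h γ (mem_move_plane.mpr ⟨hx, h0⟩)
  · intro h γ hγ
    exact h _ (mem_move_plane.mp hγ).2

/-- The points of real hyperbolic space on the same side of all walls as `x`. -/
def region (d : ℕ) (x : Fin 4 → ℂ) : Set (Fin 4 → ℂ) := {y | y ∈ HR ∧ SameSide (wallForm d) x y}

theorem convex_sameSide {d : ℕ} (x : Fin 4 → ℂ) :
    Convex ℝ {y | y ∈ futureCone ∧ SameSide (wallForm d) x y} := by
  rintro y ⟨hy, hy'⟩ z ⟨hz, hz'⟩ s t hs ht hst
  refine ⟨futureCone_convex hy hz hs ht hst, fun m => ?_⟩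
  rw [map_add, map_smul, map_smul, smul_eq_mul, smul_eq_mul]
  rcases eq_or_lt_of_le hs with h | h
  · rw [← h] at hst ⊢
    have : t = 1 := by linarith
    rw [this]; simpa using hz' m
  · nlinarith [mul_pos h (hy' m), mul_nonneg ht (hz' m).le]

theorem isPreconnected_region {d : ℕ} (x : Fin 4 → ℂ) : IsPreconnected (region d x) := by
  have : region d x = normalize '' {y | y ∈ futureCone ∧ SameSide (wallForm d) x y} := by
    ext y
    constructor
    · rintro ⟨h1, h2⟩
      exact ⟨y, ⟨HR_subset h1, h2⟩, normalize_eq h1⟩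
    · rintro ⟨z, ⟨h1, h2⟩, rfl⟩
      exact ⟨normalize_mem h1, (sameSide_normalize h1).mpr h2⟩
  rw [this]
  exact (convex_sameSide x).isPreconnected.image _
    (continuousOn_normalize.mono fun y hy => hy.1)

/-- A connected set avoiding all walls keeps every sign, by the intermediate value theorem.
Conversely, a sign class is the radial projection of a convex set. -/
theorem connectedComponentIn_complement {d : ℕ} {x : Fin 4 → ℂ} (hx : x ∈ complement (incl d)) :
    connectedComponentIn (complement (incl d)) x = region d x := by
  have hx' := mem_complement.mp hx
  apply subset_antisymm
  · intro y hy
    have hyc := connectedComponentIn_subset _ _ hy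
    have hy' := mem_complement.mp hyc
    refine ⟨hy'.1, fun m => ?_⟩
    by_contra! hc
    have hpre : IsPreconnected (connectedComponentIn (complement (incl d)) x) :=
      isPreconnected_connectedComponentIn
    have hxm := mem_connectedComponentIn hx
    have hiv := hpre.intermediate_value hy hxm
      (f := fun z => wallForm d m x * wallForm d m z)
      (continuous_const.mul (continuous_wallForm m)).continuousOn
    obtain ⟨z, hz, hz0⟩ := hiv (Set.mem_Icc.mpr ⟨hc, mul_self_nonneg _⟩)
    have hz' := (mem_complement.mp (connectedComponentIn_subset _ _ hz)).2 m
    exact (mul_ne_zero (hx'.2 m) hz') hz0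
  · refine (isPreconnected_region x).subset_connectedComponentIn ⟨hx'.1, ?_⟩ ?_
    · exact fun m => mul_self_pos.mpr (hx'.2 m)
    · rintro y ⟨h1, h2⟩
      rw [mem_complement]
      refine ⟨h1, fun m h => ?_⟩
      have := h2 m
      rw [h] at this; simp at this

theorem region_congr {d : ℕ} {x y : Fin 4 → ℂ} (h : SameSide (wallForm d) x y) :
    region d x = region d y := by
  ext z
  exact ⟨fun hz => ⟨hz.1, h.symm.trans hz.2⟩, fun hz => ⟨hz.1, h.trans hz.2⟩⟩

theorem normalize_mem_region {d : ℕ} {x : Fin 4 → ℂ}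
    (hx : x ∈ offWalls (wallForm d) futureCone) : normalize x ∈ region d x :=
  ⟨normalize_mem hx.1, (sameSide_normalize hx.1).mpr (SameSide.refl hx)⟩

theorem region_eq_iff {d : ℕ} {x y : Fin 4 → ℂ} (hy : y ∈ offWalls (wallForm d) futureCone) :
    region d x = region d y ↔ SameSide (wallForm d) x y := by
  refine ⟨fun h => ?_, region_congr⟩
  have := normalize_mem_region hy
  rw [← h] at this
  exact (sameSide_normalize hy.1).mp this.2

theorem isRegion_iff {d : ℕ} {C : Set (Fin 4 → ℂ)} :
    IsRegion (incl d) C ↔ ∃ x ∈ offWalls (wallForm d) futureCone, C = region d x := by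
  constructor
  · rintro ⟨x, hx, rfl⟩
    have := mem_complement.mp hx
    exact ⟨x, ⟨HR_subset this.1, this.2⟩, connectedComponentIn_complement hx⟩
  · rintro ⟨x, hx, rfl⟩
    have h1 := normalize_mem_region hx
    have h2 : normalize x ∈ complement (incl d) := by
      rw [mem_complement]
      refine ⟨h1.1, fun m h => ?_⟩
      have := h1.2 m
      rw [h] at this; simp at this
    exact ⟨normalize x, h2, by rw [connectedComponentIn_complement h2, region_congr h1.2]⟩

theorem move_region {d : ℕ} (γ : Bi d) (x : Fin 4 → ℂ) :
    move (incl d) γ (region d x) = region d (γ • x) := by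
  rw [move_eq]
  ext y
  constructor
  · rintro ⟨h1, h2⟩
    have h1' := bi_smul_mem_HR γ h1
    have h2' := h2.smul wallForm_smul γ
    rw [smul_inv_smul] at h1' h2'
    exact ⟨h1', h2'⟩
  · rintro ⟨h1, h2⟩
    have h2' := h2.smul wallForm_smul γ⁻¹
    rw [inv_smul_smul] at h2'
    exact ⟨bi_smul_mem_HR γ⁻¹ h1, h2'⟩

theorem move_region_eq_iff {d : ℕ} {γ : Bi d} {x y : Fin 4 → ℂ}
    (hx : x ∈ offWalls (wallForm d) futureCone) :
    move (incl d) γ (region d x) = region d y ↔ SameSide (wallForm d) y (γ • x) := by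
  rw [move_region, eq_comm,
    region_eq_iff (smul_mem_offWalls wallForm_smul bi_smul_mem_futureCone hx γ)]

theorem plane_subset_closure_region {d : ℕ} {lam : ℝ}
    (hO : IsImaginaryOrder (intEmb d).range lam) {y : Fin 4 → ℂ} {r : ℝ} (hr : r ^ 2 < 1)
    (hy0 : 0 < r * wallForm d (baseWall d) y)
    (hy : ∀ p ∈ futureCone, wallForm d (baseWall d) p = 0 → ∀ m, m ≠ baseWall d →
      0 < wallForm d m p * wallForm d m y) :
    plane ⊆ closure (region d y) := by
  intro p hp
  obtain ⟨hpH, hp0⟩ := mem_plane.mp hp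
  have hpF := HR_subset hpH
  -- Moving `p` off the plane by `r` gives norm `-1 + r ^ 2`, hence the condition `r ^ 2 < 1`. The
  -- points approaching `p` are projections of points on the segment towards `q`.
  set q : Fin 4 → ℂ := fun j => p j + if j = 2 then (r : ℂ) else 0 with hq
  have hqim : ∀ j, (q j).im = 0 := by
    intro j
    by_cases h : j = 2
    · simp [hq, h, hpF.1]
    · simp [hq, h, hpF.1]
  have hqF : q ∈ futureCone := by
    refine ⟨hqim, ?_, ?_⟩
    · have h1 := hpH.2.1
      rw [hnorm_of_real hpF.1, hp0] at h1
      rw [hnorm_of_real hqim]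
      simp [hq, hp0]
      linarith
    · simpa [hq] using hpF.2.2
  have hW := isWallSystem hO
  have hbase : wallForm d (baseWall d) p = 0 := by rw [wallForm_baseWall]; exact hp0
  have hev := hW.eventually_sameSide hpF hqF
  have h2 : ∀ᶠ ε in nhdsWithin (0 : ℝ) (Set.Ioi 0), ε < 1 :=
    (gt_mem_nhds one_pos).filter_mono nhdsWithin_le_nhds
  have htend : Filter.Tendsto (fun ε : ℝ => normalize (p + ε • (q - p)))
      (nhdsWithin (0 : ℝ) (Set.Ioi 0)) (nhds p) := by
    have h3 : ContinuousWithinAt normalize futureCone p := continuousOn_normalize p hpF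
    have h4 : Filter.Tendsto (fun ε : ℝ => p + ε • (q - p)) (nhdsWithin (0 : ℝ) (Set.Ioi 0))
        (nhdsWithin p futureCone) := by
      refine tendsto_nhdsWithin_iff.mpr ⟨?_, ?_⟩
      · have : Continuous fun ε : ℝ => p + ε • (q - p) := by fun_prop
        have := this.tendsto 0
        simp only [zero_smul, add_zero] at this
        exact this.mono_left nhdsWithin_le_nhds
      · filter_upwards [h2, self_mem_nhdsWithin] with ε h2 h3
        exact hW.segment_mem hpF hqF ⟨le_of_lt h3, h2.le⟩
    have := h3.tendsto.comp h4
    rw [normalize_eq hpH] at this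
    exact this
  refine mem_closure_of_tendsto htend ?_
  filter_upwards [hev, h2, self_mem_nhdsWithin] with ε h1 h2 h3
  have h3' : (0 : ℝ) < ε := h3
  have hmem := hW.segment_mem hpF hqF ⟨h3'.le, h2.le⟩
  refine ⟨normalize_mem hmem, (sameSide_normalize hmem).mpr fun m => ?_⟩
  by_cases hm : m = baseWall d
  · subst hm
    rw [linear_apply_segment, hbase]
    have : wallForm d (baseWall d) q = r := by
      rw [wallForm_baseWall]; simp [hq, hp0]
    rw [this]
    nlinarith [mul_pos h3' hy0]
  · have h5 := hy p hpF hbase m hm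
    have h6 := h1 m fun h => by rw [h] at h5; simp at h5
    rw [mul_comm] at h5
    exact mul_pos_trans h5 h6

/-- A single point of the plane suffices: being a limit of points of the region, it shares the sign
of `x` for every wall other than the base wall. -/
theorem sameSide_of_plane_subset_closure {d : ℕ} {x y : Fin 4 → ℂ}
    (hx : x ∈ offWalls (wallForm d) futureCone) (hcl : plane ⊆ closure (region d x))
    (hbase : 0 < wallForm d (baseWall d) y * wallForm d (baseWall d) x)
    (hy : ∀ p ∈ futureCone, wallForm d (baseWall d) p = 0 → ∀ m, m ≠ baseWall d →
      0 < wallForm d m p * wallForm d m y) :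
    SameSide (wallForm d) y x := by
  have hp : normalize (horoPoint 0 0) ∈ HR := normalize_mem (horoPoint_mem 0 0)
  have hp0 : wallForm d (baseWall d) (normalize (horoPoint 0 0)) = 0 := by
    rw [wallForm_normalize, wallForm_baseWall]; simp [horoPoint]
  set p := normalize (horoPoint 0 0)
  have hpP : p ∈ plane := mem_plane.mpr ⟨hp, by rw [← wallForm_baseWall (d := d)]; exact hp0⟩
  intro m
  by_cases hm : m = baseWall d
  · subst hm; exact hbase
  · have h1 := hy p (HR_subset hp) hp0 m hm
    have hclosed : IsClosed {z | 0 ≤ wallForm d m x * wallForm d m z} :=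
      isClosed_le continuous_const (continuous_const.mul (continuous_wallForm m))
    have h2 : 0 ≤ wallForm d m x * wallForm d m p :=
      closure_minimal (fun z hz => (hz.2 m).le) hclosed (hcl hpP)
    have h3 : 0 < wallForm d m x * wallForm d m p := by
      refine lt_of_le_of_ne h2 (Ne.symm (mul_ne_zero (hx.2 m) fun h => ?_))
      rw [h] at h1; simp at h1
    have := mul_pos_trans h3 h1
    rwa [mul_comm] at this

/-! ### The stabilizer of the plane and its centralizer -/

theorem normalize_horoPoint_mem_plane : normalize (horoPoint 0 0) ∈ plane := by
  refine mem_plane.mpr ⟨normalize_mem (horoPoint_mem 0 0), ?_⟩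
  simp [normalize, horoPoint]

theorem move_plane_eq_iff {d : ℕ} {lam : ℝ} (hO : IsImaginaryOrder (intEmb d).range lam)
    (γ : Bi d) : move (incl d) γ plane = plane ↔ γ ∈ modularGroup d := by
  rw [← smul_baseWall_eq]
  constructor
  · intro h
    have hp := normalize_horoPoint_mem_plane
    have h1 := (mem_plane.mp hp).2
    rw [← h, mem_move_plane] at hp
    exact wall_unique hO (HR_subset hp.1) hp.2 (by rw [wallForm_baseWall]; exact h1)
  · intro h
    ext x
    rw [mem_move_plane, h, mem_plane, wallForm_baseWall]

theorem move_plane_disjoint {d : ℕ} {lam : ℝ} (hO : IsImaginaryOrder (intEmb d).range lam)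
    {γ : Bi d} (hγ : γ ∉ modularGroup d) : Disjoint (move (incl d) γ plane) plane := by
  rw [Set.disjoint_left]
  intro x hx hx'
  obtain ⟨h1, h2⟩ := mem_move_plane.mp hx
  refine hγ (smul_baseWall_eq.mp (wall_unique hO (HR_subset h1) h2 ?_))
  rw [wallForm_baseWall]; exact (mem_plane.mp hx').2

/-! ### The centralizer of the modular group. -/

theorem spin_int_smul {d : ℕ} (A : SL(2, ℤ)) (x : Fin 4 → ℂ) :
    ((incl d (QuotientGroup.mk (Matrix.SpecialLinearGroup.map (Int.castRingHom (𝓞 (Qd d))) A)) :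
      SU31) : SL(4, ℂ)) • x = spinLin (A.1.map (Int.cast : ℤ → ℂ)) x := by
  rw [incl_mk, spin_smul]
  congr 1

theorem su31_ext {g h : SU31} (H : ∀ x : Fin 4 → ℂ, (g : SL(4, ℂ)) • x = (h : SL(4, ℂ)) • x) :
    g = h := by
  apply Subtype.ext
  apply Subtype.ext
  apply Matrix.ext_of_mulVec_single
  intro j
  exact H _

theorem bendElt_smul (v : Circle) (x : Fin 4 → ℂ) :
    (bendElt v : SL(4, ℂ)) • x = ![v * x 0, v * x 1, ((v : ℂ) ^ 3)⁻¹ * x 2, v * x 3] := by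
  change (Matrix.diagonal _) *ᵥ x = _
  ext j
  rw [Matrix.mulVec_diagonal]
  fin_cases j <;> simp

theorem bendElt_smul_eq (v : Circle) (x : Fin 4 → ℂ) : (bendElt v : SL(4, ℂ)) • x =
    (v : ℂ) • x + ((((v : ℂ) ^ 3)⁻¹ - v) * x 2) • (Pi.single 2 1 : Fin 4 → ℂ) := by
  rw [bendElt_smul]
  ext j
  fin_cases j <;> simp
  ring

theorem modular_smul_single {d : ℕ} {δ : Bi d} (hδ : δ ∈ modularGroup d) :
    δ • (Pi.single 2 1 : Fin 4 → ℂ) = Pi.single 2 1 := by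
  obtain ⟨A, rfl⟩ := hδ
  have hdet := A.2
  rw [Matrix.det_fin_two] at hdet
  have hdet' : (A.1 0 0 : ℂ) * A.1 1 1 - A.1 0 1 * A.1 1 0 = 1 := by exact_mod_cast hdet
  change (incl d (QuotientGroup.mk _) : SL(4, ℂ)) • (Pi.single 2 1 : Fin 4 → ℂ) = _
  rw [spin_int_smul]
  apply toHerm.injective
  rw [toHerm_spinLin, toHerm_entries]
  ext r s
  fin_cases r <;> fin_cases s <;> simp [Matrix.mul_apply]
  · ring
  · linear_combination Complex.I * hdet'
  · linear_combination -Complex.I * hdet'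
  · ring

theorem incl_mul_bendElt {d : ℕ} {γ : Bi d} (hγ : γ ∈ modularGroup d) (v : Circle) :
    incl d γ * bendElt v = bendElt v * incl d γ := by
  refine su31_ext fun x => ?_
  rw [Subgroup.coe_mul, Subgroup.coe_mul, mul_smul, mul_smul]
  change γ • ((bendElt v : SL(4, ℂ)) • x : Fin 4 → ℂ) =
    (bendElt v : SL(4, ℂ)) • (γ • x : Fin 4 → ℂ)
  rw [bendElt_smul_eq, bendElt_smul_eq, bi_smul_add, bi_smul_const, bi_smul_const,
    modular_smul_single hγ, modular_smul_two hγ]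

theorem spinLin_T (x : Fin 4 → ℂ) : spinLin !![1, 1; 0, 1] x =
    ![x 0 - (√2 : ℝ) * x 1 - x 3, x 1 + (√2 : ℝ) * x 3, x 2, x 3] := by
  have hs0 : ((√2 : ℝ) : ℂ) ≠ 0 := by simp
  have hs : ((√2 : ℝ) : ℂ) * ((√2 : ℝ) : ℂ) = 2 := by
    rw [← Complex.ofReal_mul, Real.mul_self_sqrt (by norm_num)]; simp
  apply toHerm.injective
  rw [toHerm_spinLin, toHerm_entries, toHerm_entries]
  ext r s
  fin_cases r <;> fin_cases s <;> simp [Matrix.mul_apply]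
  · linear_combination x 1 * hs
  · ring
  · ring

theorem spinLin_S (x : Fin 4 → ℂ) : spinLin !![0, -1; 1, 0] x = ![- x 3, - x 1, x 2, - x 0] := by
  apply toHerm.injective
  rw [toHerm_spinLin, toHerm_entries, toHerm_entries]
  ext r s
  fin_cases r <;> fin_cases s <;> simp [Matrix.mul_apply]
  · ring
  · ring

/-- Commuting with the two standard generators of the modular group already forces a diagonal
matrix, scalar outside the third coordinate. Unitarity and determinant one then leave only a
parameter in the circle. -/
theorem exists_bendElt_of_commute {d : ℕ} {g : SU31}
    (h : ∀ γ ∈ modularGroup d, incl d γ * g = g * incl d γ) : ∃ v : Circle, g = bendElt v := by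
  have key : ∀ (A : SL(2, ℤ)) (x : Fin 4 → ℂ), spinLin (A.1.map (Int.cast : ℤ → ℂ))
      ((g : SL(4, ℂ)) • x) = (g : SL(4, ℂ)) • spinLin (A.1.map (Int.cast : ℤ → ℂ)) x := by
    intro A x
    rw [← spin_int_smul (d := d), ← spin_int_smul (d := d)]
    have := h _ ⟨A, rfl⟩
    have h2 := congrArg (fun k : SU31 => (k : SL(4, ℂ)) • x) this
    simp only [Subgroup.coe_mul, mul_smul] at h2
    exact h2
  have hT : ∀ x : Fin 4 → ℂ, spinLin !![1, 1; 0, 1] ((g : SL(4, ℂ)) • x) =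
      (g : SL(4, ℂ)) • spinLin !![1, 1; 0, 1] x := by
    intro x
    have := key (translation 1) x
    have e : (translation (1 : ℤ)).1.map (Int.cast : ℤ → ℂ) = !![1, 1; 0, 1] := by
      ext r s; fin_cases r <;> fin_cases s <;> simp [translation]
    rwa [e] at this
  have hS : ∀ x : Fin 4 → ℂ, spinLin !![0, -1; 1, 0] ((g : SL(4, ℂ)) • x) =
      (g : SL(4, ℂ)) • spinLin !![0, -1; 1, 0] x := by
    intro x
    have := key ModularGroup.S x
    have e : (ModularGroup.S).1.map (Int.cast : ℤ → ℂ) = !![0, -1; 1, 0] := by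
      ext r s; fin_cases r <;> fin_cases s <;> simp [ModularGroup.S]
    rwa [e] at this
  set M : Matrix (Fin 4) (Fin 4) ℂ := (g : SL(4, ℂ)).1 with hM
  have hg : ∀ x : Fin 4 → ℂ, (g : SL(4, ℂ)) • x = M *ᵥ x := fun _ => rfl
  simp only [hg, spinLin_T, spinLin_S] at hT hS
  have hs0 : ((√2 : ℝ) : ℂ) ≠ 0 := by simp
  have T0 := hT (Pi.single 0 1)
  have T1 := hT (Pi.single 1 1)
  have T2 := hT (Pi.single 2 1)
  have S0 := hS (Pi.single 0 1)
  have S1 := hS (Pi.single 1 1)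
  have S2 := hS (Pi.single 2 1)
  rw [funext_iff] at T0 T1 T2 S0 S1 S2
  simp [Fin.forall_fin_succ, Matrix.mulVec, dotProduct, Fin.sum_univ_four] at T0 T1 T2 S0 S1 S2
  obtain ⟨a1, a2⟩ := T0
  obtain ⟨b1, b2, b3, -⟩ := T1
  obtain ⟨c1, c2⟩ := T2
  obtain ⟨e1, e2, e3, e4⟩ := S0
  obtain ⟨f1, f2, -⟩ := S1
  obtain ⟨k1, -, -⟩ := S2
  have m10 : M 1 0 = 0 := by
    have : ((√2 : ℝ) : ℂ) * M 1 0 = 0 := by linear_combination -a1 - a2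
    simpa [hs0] using this
  have m31 : M 3 1 = 0 := by
    have : ((√2 : ℝ) : ℂ) * M 3 1 = 0 := by linear_combination b2 - ((√2 : ℝ) : ℂ) * m10
    simpa [hs0] using this
  have m11 : M 1 1 = M 0 0 := by
    have : ((√2 : ℝ) : ℂ) * (M 1 1 - M 0 0) = 0 := by linear_combination -b1 - m31
    rcases mul_eq_zero.mp this with h | h
    · exact absurd h hs0
    · linear_combination h
  have m21 : M 2 1 = 0 := by
    have : (2 : ℂ) * M 2 1 = 0 := by linear_combination f2
    simpa using this
  have m12 : M 1 2 = 0 := by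
    have : ((√2 : ℝ) : ℂ) * M 1 2 = 0 := by linear_combination -c1 - c2
    simpa [hs0] using this
  have hdiag : M = Matrix.diagonal ![M 0 0, M 0 0, M 2 2, M 0 0] := by
    ext r s
    fin_cases r <;> fin_cases s <;>
      simp [m10, m31, m11, m21, m12, ← e1, ← e2, ← f1, a2, b3, c2, ← k1, ← e4]
    rw [b3] at e3
    exact neg_eq_zero.mp e3.symm
  have hJ : Mᴴ * J * M = J := g.2
  have hdet : M.det = 1 := (g : SL(4, ℂ)).2
  have hα : (starRingEnd ℂ) (M 0 0) * M 0 0 = 1 := by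
    have := congrFun (congrFun hJ 0) 3
    rw [hdiag] at this
    simpa [J, Matrix.diagonal_conjTranspose, Matrix.diagonal_mul, Matrix.mul_diagonal] using this
  have hα1 : ‖M 0 0‖ = 1 := by
    have h1 : Complex.normSq (M 0 0) = 1 := by
      have := Complex.normSq_eq_conj_mul_self (z := M 0 0)
      rw [hα] at this
      exact_mod_cast this
    rw [Complex.normSq_eq_norm_sq] at h1
    nlinarith [norm_nonneg (M 0 0)]
  have hdet3 : (M 0 0) ^ 3 * M 2 2 = 1 := by
    rw [hdiag, Matrix.det_diagonal] at hdet
    simp [Fin.prod_univ_four] at hdet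
    linear_combination hdet
  have h0 : M 0 0 ≠ 0 := by intro h; rw [h] at hα1; simp at hα1
  refine ⟨⟨M 0 0, by simpa [Submonoid.unitSphere] using hα1⟩, ?_⟩
  apply Subtype.ext
  apply Subtype.ext
  change M = Matrix.diagonal _
  have h22 : M 2 2 = ((M 0 0) ^ 3)⁻¹ := by field_simp; linear_combination hdet3
  conv_lhs => rw [hdiag, h22]

/-! ### Bendings in terms of the base points -/

/-- The closure and sign conditions force `C` and `C'` to be the regions of `negPoint` and
`posPoint`, so a bending is described by sign conditions alone. -/
theorem isBending_iff {d : ℕ} {lam : ℝ} (hO : IsImaginaryOrder (intEmb d).range lam) (v : Circle)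
    (ρ : Bi d →* SU31) : IsBending (incl d) (bendElt v) ρ ↔
      (∀ γ, SameSide (wallForm d) (negPoint lam) (γ • negPoint lam) → ρ γ = incl d γ) ∧
      ∀ z, SameSide (wallForm d) (posPoint lam) (z • negPoint lam) →
        ρ z = bendElt v * incl d z := by
  have hW := isWallSystem hO
  have hneg := negPoint_mem hO
  have hpos := posPoint_mem hO
  have hadj := adjacent_negPoint_posPoint hO
  have hwn : ∀ p ∈ futureCone, wallForm d (baseWall d) p = 0 → ∀ m, m ≠ baseWall d →
      0 < wallForm d m p * wallForm d m (negPoint lam) := fun p hp hp0 m hm =>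
    hadj.wall_pos hW hneg.1 hpos.1 hp hp0 hm
  have hwp : ∀ p ∈ futureCone, wallForm d (baseWall d) p = 0 → ∀ m, m ≠ baseWall d →
      0 < wallForm d m p * wallForm d m (posPoint lam) := fun p hp hp0 m hm =>
    mul_pos_trans (hwn p hp hp0 m hm) (hadj.2.2 m hm)
  constructor
  · rintro ⟨-, -, C, C', hC, hC', hcl, hcl', hlt, hgt, h1, -, h3⟩
    obtain ⟨x, hx, rfl⟩ := isRegion_iff.mp hC
    obtain ⟨x', hx', rfl⟩ := isRegion_iff.mp hC'
    have hx0 : wallForm d (baseWall d) x < 0 := by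
      have := hlt _ (normalize_mem_region hx)
      rw [← wallForm_baseWall (d := d), wallForm_normalize] at this
      exact neg_of_mul_neg_right this (sqrt_hnorm_pos hx.1).le
    have hx0' : 0 < wallForm d (baseWall d) x' := by
      have := hgt _ (normalize_mem_region hx')
      rw [← wallForm_baseWall (d := d), wallForm_normalize] at this
      exact pos_of_mul_pos_right this (sqrt_hnorm_pos hx'.1).le
    have hs := sameSide_of_plane_subset_closure hx hcl (mul_pos_of_neg_of_neg hadj.1 hx0) hwn
    have hs' := sameSide_of_plane_subset_closure hx' hcl' (mul_pos hadj.2.1 hx0') hwp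
    refine ⟨fun γ hγ => h1 γ ?_, fun z hz => h3 z ?_⟩
    · rw [← region_congr hs, move_region_eq_iff hneg]; exact hγ
    · rw [← region_congr hs, ← region_congr hs', move_region_eq_iff hneg]; exact hz
  · rintro ⟨h1, h2⟩
    refine ⟨fun γ => ?_, fun γ hγ => ?_, region d (negPoint lam), region d (posPoint lam),
      isRegion_iff.mpr ⟨_, hneg, rfl⟩, isRegion_iff.mpr ⟨_, hpos, rfl⟩, ?_, ?_, ?_, ?_, ?_, ?_, ?_⟩
    · by_cases hγ : γ ∈ modularGroup d
      · exact Or.inl ((move_plane_eq_iff hO γ).mpr hγ)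
      · exact Or.inr (move_plane_disjoint hO hγ)
    · exact incl_mul_bendElt ((move_plane_eq_iff hO γ).mp hγ) v
    · exact plane_subset_closure_region hO (r := -1 / 2) (by norm_num)
        (by nlinarith [hadj.1]) hwn
    · exact plane_subset_closure_region hO (r := 1 / 2) (by norm_num)
        (by nlinarith [hadj.2.1]) hwp
    · intro x hx
      have h3 := hx.2 (baseWall d)
      rw [wallForm_baseWall (d := d) x] at h3
      exact neg_of_mul_pos_right h3 hadj.1.le
    · intro x hx
      have h3 := hx.2 (baseWall d)
      rw [wallForm_baseWall (d := d) x] at h3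
      exact pos_of_mul_pos_right h3 hadj.2.1.le
    · intro γ hγ
      exact h1 γ ((move_region_eq_iff hneg).mp hγ)
    · obtain ⟨w, ⟨β, rfl⟩, hw⟩ := hO.exists_im
      exact ⟨_, (move_region_eq_iff hneg).mpr (posPoint_sameSide hO hw)⟩
    · intro z hz
      exact h2 z ((move_region_eq_iff hneg).mp hz)

theorem exists_isBending {d : ℕ} {lam : ℝ} (hO : IsImaginaryOrder (intEmb d).range lam)
    (v : Circle) : ∃ ρ : Bi d →* SU31, IsBending (incl d) (bendElt v) ρ := by
  -- The jump at a translate of the plane is the conjugate of `bendElt v`. It depends only on the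
  -- coset because `bendElt v` commutes with the modular group.
  set G : Wall d → SU31 := fun m => Quotient.liftOn' m
    (fun γ : Bi d => incl d γ * bendElt v * (incl d γ)⁻¹) (by
      intro γ γ' h
      rw [QuotientGroup.leftRel_apply] at h
      have h1 := incl_mul_bendElt h v
      have e : incl d γ' = incl d γ * incl d (γ⁻¹ * γ') := by rw [← map_mul]; simp
      rw [e, mul_assoc (incl d γ) (incl d (γ⁻¹ * γ')), h1]; group) with hG
  have hGmk : ∀ γ : Bi d, G (γ : Bi d ⧸ modularGroup d) =
    incl d γ * bendElt v * (incl d γ)⁻¹ := fun _ => rfl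
  have hGeq : ∀ γ m, G (γ • m) = incl d γ * G m * (incl d γ)⁻¹ := by
    intro γ m
    induction m using QuotientGroup.induction_on with
    | H δ =>
      change G ((γ * δ : Bi d) : Bi d ⧸ modularGroup d) = _
      rw [hGmk, hGmk, map_mul]; group
  obtain ⟨ρ, h1, h2⟩ := (isWallSystem hO).exists_bending wallForm_smul bi_smul_mem_futureCone
    (incl d) G hGeq (negPoint_mem hO)
  refine ⟨ρ, (isBending_iff hO v ρ).mpr ⟨h1, fun z hz => ?_⟩⟩
  rw [h2 z (baseWall d) ((adjacent_negPoint_posPoint hO).congr_right hz), baseWall, hGmk]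
  simp

theorem exists_translate {d : ℕ} {lam : ℝ} (hO : IsImaginaryOrder (intEmb d).range lam)
    {β : 𝓞 (Qd d)} (hβ : (intEmb d β).im = lam) {y : Fin 4 → ℂ}
    (hy : y ∈ offWalls (wallForm d) futureCone) :
    ∃ h ∈ Subgroup.closure
      ({γ : Bi d | SameSide (wallForm d) (negPoint lam) (γ • negPoint lam)} ∪
        {(QuotientGroup.mk (translation β) : Bi d)}),
      SameSide (wallForm d) y (h • negPoint lam) :=
  (isWallSystem hO).exists_region_translate wallForm_smul bi_smul_mem_futureCone (negPoint_mem hO)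
    (posPoint_mem hO) (adjacent_negPoint_posPoint hO) exists_eq_smul_baseWall
    (posPoint_sameSide hO hβ) hy

/-- If `k` in the subgroup generated by the region stabilizer and the stable letter reaches the
region of `γ • negPoint lam`, then `γ⁻¹ * k` stabilizes the base region. Both bendings are
prescribed on all these elements. -/
theorem isBending_unique {d : ℕ} {lam : ℝ} (hO : IsImaginaryOrder (intEmb d).range lam)
    {v : Circle} {ρ ρ' : Bi d →* SU31} (h : IsBending (incl d) (bendElt v) ρ)
    (h' : IsBending (incl d) (bendElt v) ρ') : ρ = ρ' := by
  obtain ⟨w, ⟨β, rfl⟩, hβ⟩ := hO.exists_im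
  rw [isBending_iff hO] at h h'
  refine MonoidHom.ext fun γ => ?_
  have hneg := negPoint_mem (d := d) hO
  obtain ⟨k, hk, hs⟩ := exists_translate hO hβ
    (smul_mem_offWalls wallForm_smul bi_smul_mem_futureCone hneg γ)
  have hs' := hs.smul wallForm_smul γ⁻¹
  rw [inv_smul_smul, smul_smul] at hs'
  have h1 : ρ (γ⁻¹ * k) = ρ' (γ⁻¹ * k) := by rw [h.1 _ hs', h'.1 _ hs']
  have h2 : ρ k = ρ' k := by
    have : Set.EqOn ρ ρ' (({γ : Bi d | SameSide (wallForm d) (negPoint lam) (γ • negPoint lam)} ∪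
        {(QuotientGroup.mk (translation β) : Bi d)})) := by
      rintro δ (hδ | hδ)
      · rw [h.1 _ hδ, h'.1 _ hδ]
      · rw [Set.mem_singleton_iff] at hδ
        rw [hδ, h.2 _ (posPoint_sameSide hO hβ), h'.2 _ (posPoint_sameSide hO hβ)]
    exact MonoidHom.eqOn_closure this hk
  rw [map_mul, map_mul, map_inv, map_inv, h2] at h1
  exact inv_injective (mul_right_cancel h1)

/-! ### Fixed points at the level of vectors -/

theorem smul_mk_eq_iff (g : SL(4, ℂ)) {z : Fin 4 → ℂ} (hz : z ≠ 0) :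
    g • Projectivization.mk ℂ z hz = Projectivization.mk ℂ z hz ↔ ∃ c : ℂ, g • z = c • z := by
  rw [Projectivization.smul_mk, Projectivization.mk_eq_mk_iff']
  exact exists_congr fun c => eq_comm

theorem hnorm_rep_mk {z : Fin 4 → ℂ} (hz : z ≠ 0) :
    ∃ r : ℝ, 0 < r ∧ hnorm (Projectivization.mk ℂ z hz).rep = r * hnorm z := by
  obtain ⟨a, ha⟩ := Projectivization.exists_smul_eq_mk_rep ℂ z hz
  refine ⟨‖(a : ℂ)‖ ^ 2, by have := a.ne_zero; positivity, ?_⟩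
  rw [← ha, Units.smul_def, hnorm_const_smul]

theorem mk_mem_HC {z : Fin 4 → ℂ} (hz : z ≠ 0) :
    Projectivization.mk ℂ z hz ∈ HC ↔ hnorm z < 0 := by
  obtain ⟨r, hr, h⟩ := hnorm_rep_mk hz
  change hnorm _ < 0 ↔ _
  rw [h]
  exact ⟨fun h => by nlinarith, fun h => by nlinarith⟩

theorem mk_mem_bdryHC {z : Fin 4 → ℂ} (hz : z ≠ 0) :
    Projectivization.mk ℂ z hz ∈ bdryHC ↔ hnorm z = 0 := by
  obtain ⟨r, hr, h⟩ := hnorm_rep_mk hz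
  change hnorm _ = 0 ↔ _
  rw [h]
  simp [hr.ne']

theorem smul_mem_HC_iff (g : SU31) (p : ℙ ℂ (Fin 4 → ℂ)) :
    (g : SL(4, ℂ)) • p ∈ HC ↔ p ∈ HC := by
  induction p using Projectivization.ind with
  | h z hz => rw [Projectivization.smul_mk, mk_mem_HC, mk_mem_HC, hnorm_smul]

theorem smul_mem_bdryHC_iff (g : SU31) (p : ℙ ℂ (Fin 4 → ℂ)) :
    (g : SL(4, ℂ)) • p ∈ bdryHC ↔ p ∈ bdryHC := by
  induction p using Projectivization.ind with
  | h z hz => rw [Projectivization.smul_mk, mk_mem_bdryHC, mk_mem_bdryHC, hnorm_smul]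

theorem conj_smul_eq_iff (g h : SU31) (p : ℙ ℂ (Fin 4 → ℂ)) :
    ((h * g * h⁻¹ : SU31) : SL(4, ℂ)) • (h : SL(4, ℂ)) • p = (h : SL(4, ℂ)) • p ↔
      (g : SL(4, ℂ)) • p = p := by
  have e : ((h * g * h⁻¹ : SU31) : SL(4, ℂ)) • (h : SL(4, ℂ)) • p =
      (h : SL(4, ℂ)) • (g : SL(4, ℂ)) • p := by
    rw [smul_smul, smul_smul]
    congr 1
    push_cast
    group
  rw [e]
  exact (MulAction.injective (h : SL(4, ℂ))).eq_iff

theorem IsParabolic.conj {g : SU31} (hg : IsParabolic g) (h : SU31) :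
    IsParabolic (h * g * h⁻¹) := by
  obtain ⟨h1, p, ⟨h2, h3⟩, h4⟩ := hg
  have surj : ∀ q : ℙ ℂ (Fin 4 → ℂ), ∃ q', q = (h : SL(4, ℂ)) • q' :=
    fun q => ⟨(h : SL(4, ℂ))⁻¹ • q, (smul_inv_smul _ _).symm⟩
  refine ⟨fun q hq => ?_, (h : SL(4, ℂ)) • p,
    ⟨(smul_mem_bdryHC_iff h p).mpr h2, (conj_smul_eq_iff g h p).mpr h3⟩, fun q hq => ?_⟩
  · obtain ⟨q', rfl⟩ := surj q
    rw [smul_mem_HC_iff] at hq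
    exact fun hc => h1 q' hq ((conj_smul_eq_iff g h q').mp hc)
  · obtain ⟨q', rfl⟩ := surj q
    rw [smul_mem_bdryHC_iff, conj_smul_eq_iff] at hq
    rw [h4 q' hq]

theorem IsBoundaryElliptic.conj {g : SU31} (hg : IsBoundaryElliptic g) (h : SU31) :
    IsBoundaryElliptic (h * g * h⁻¹) := by
  obtain ⟨⟨p, h1, h2⟩, ⟨q, h3, h4⟩, r, h5, h6⟩ := hg
  exact ⟨⟨_, (smul_mem_HC_iff h p).mpr h1, fun hc => h2 ((conj_smul_eq_iff g h p).mp hc)⟩,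
    ⟨_, (smul_mem_HC_iff h q).mpr h3, (conj_smul_eq_iff g h q).mpr h4⟩,
    _, (smul_mem_bdryHC_iff h r).mpr h5, (conj_smul_eq_iff g h r).mpr h6⟩

theorem IsParabolic.of_smul_eq {g g' : SU31} (hg : IsParabolic g) {c : ℂ}
    (h : ∀ x : Fin 4 → ℂ, (g' : SL(4, ℂ)) • x = c • (g : SL(4, ℂ)) • x) : IsParabolic g' := by
  have e : ∀ p : ℙ ℂ (Fin 4 → ℂ), (g' : SL(4, ℂ)) • p = (g : SL(4, ℂ)) • p := by
    intro p
    induction p using Projectivization.ind with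
    | h z hz =>
      rw [Projectivization.smul_mk, Projectivization.smul_mk, Projectivization.mk_eq_mk_iff']
      exact ⟨c, (h z).symm⟩
  unfold IsParabolic
  simp only [e]
  exact hg

/-! ### Elliptic elements -/

/-- The real part of a vector. -/
def rePart (z : Fin 4 → ℂ) : Fin 4 → ℂ := fun j => ((z j).re : ℂ)

theorem spinLin_rePart (A : Matrix (Fin 2) (Fin 2) ℂ) (z : Fin 4 → ℂ) :
    spinLin A (rePart z) = rePart (spinLin A z) := by
  have h : ∀ z, rePart z = (1 / 2 : ℂ) • (z + star z) := by
    intro z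
    ext j
    simp only [rePart, Pi.smul_apply, Pi.add_apply, Pi.star_apply, smul_eq_mul]
    apply Complex.ext
    · simp; ring
    · simp
  rw [h, h, map_smul, map_add, spinLin_star]

theorem exists_futureCone_of_timelike {d : ℕ} {γ : Bi d} {x : Fin 4 → ℂ}
    (hx : ∀ j, (x j).im = 0) (hneg : hnorm x < 0) {c : ℂ} (hc : c ^ 2 = 1) (h : γ • x = c • x) :
    ∃ y ∈ futureCone, γ • y = y := by
  have hfut : ∃ y ∈ futureCone, γ • y = c • y := by
    have h0 : (x 0).re ≠ 0 := by
      intro h0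
      rw [hnorm_of_real hx, h0] at hneg
      nlinarith [sq_nonneg (x 1).re, sq_nonneg (x 2).re]
    rcases lt_or_gt_of_ne h0 with h1 | h1
    · refine ⟨(-1 : ℂ) • x, ⟨fun j => by simp [hx j], ?_, by simpa using h1⟩, ?_⟩
      · rw [hnorm_const_smul]; simpa using hneg
      · rw [bi_smul_const, h, smul_comm]
    · exact ⟨x, ⟨hx, hneg, h1⟩, h⟩
  obtain ⟨y, hy, hcy⟩ := hfut
  refine ⟨y, hy, ?_⟩
  rcases eq_or_eq_neg_of_sq_eq_sq _ _ (hc.trans (one_pow 2).symm) with rfl | rfl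
  · rw [hcy, one_smul]
  · have h1 := (bi_smul_mem_futureCone γ y hy).2.2
    rw [hcy] at h1
    have h2 := hy.2.2
    simp at h1
    linarith

/-- Besides the Hermitian form, the action preserves its complex bilinear extension, so a negative
eigenvector `z` has eigenvalue `±1` or is isotropic for the latter. The second case would make its
real and imaginary parts orthogonal and both timelike, which is impossible. In the first case one of
the two parts is a real timelike eigenvector. -/
theorem exists_fixed_of_isBoundaryElliptic {d : ℕ} {γ : Bi d}
    (h : IsBoundaryElliptic (incl d γ)) : ∃ x ∈ futureCone, γ • x = x := by
  obtain ⟨-, ⟨p, hp, hfix⟩, -⟩ := h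
  induction p using Projectivization.ind with
  | h z hz =>
  rw [mk_mem_HC] at hp
  obtain ⟨c, hc⟩ := (smul_mk_eq_iff _ hz).mp hfix
  obtain ⟨A, rfl⟩ := exists_rep γ
  have hc' : spinLin (Matrix.SpecialLinearGroup.map (intEmb d) A).1 z = c • z := by
    rw [← spin_smul, ← incl_mk]; exact hc
  have hform := spinLin_form _ (Matrix.SpecialLinearGroup.map (intEmb d) A).2 z z
  have hact : ∀ x, (QuotientGroup.mk A : Bi d) • x =
      spinLin (Matrix.SpecialLinearGroup.map (intEmb d) A).1 x := by
    intro x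
    rw [bi_smul_def, incl_mk, spin_smul]
  rw [hc'] at hform
  simp only [Matrix.mulVec_smul, smul_dotProduct, dotProduct_smul, smul_eq_mul] at hform
  have hsum : hnorm (rePart z) + hnorm (rePart (-Complex.I • z)) = hnorm z := by
    simp only [hnorm_eq, rePart]
    simp
    ring
  have him : ∀ z : Fin 4 → ℂ, ∀ j, (rePart z j).im = 0 := fun z j => Complex.ofReal_im _
  by_cases hs : z ⬝ᵥ J *ᵥ z = 0
  · exfalso
    have h1 : hnorm (rePart z) = hnorm (rePart (-Complex.I • z)) := by
      have := congrArg Complex.re hs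
      simp [J, dotProduct, Matrix.mulVec, Fin.sum_univ_four] at this
      simp only [hnorm_eq, rePart]
      simp
      linarith
    have h2 : (z 0).re * (z 3).im + (z 3).re * (z 0).im + (z 1).re * (z 1).im +
        (z 2).re * (z 2).im = 0 := by
      have := congrArg Complex.im hs
      simp [J, dotProduct, Matrix.mulVec, Fin.sum_univ_four] at this
      linarith
    have h3 : hnorm (rePart z) < 0 := by linarith
    have h4 : hnorm (rePart (-Complex.I • z)) < 0 := by linarith
    simp only [hnorm_eq, rePart] at h3 h4
    simp at h3 h4
    have key : ∀ {a b c e a' b' c' e' : ℝ}, 2 * (a * e) + b ^ 2 + c ^ 2 < 0 →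
        2 * (a' * e') + b' ^ 2 + c' ^ 2 < 0 → a * e' + e * a' + b * b' + c * c' ≠ 0 := by
      intro a b c e a' b' c' e' h h'
      have hne : a ≠ 0 := by rintro rfl; nlinarith [sq_nonneg b, sq_nonneg c]
      have hne' : a' ≠ 0 := by rintro rfl; nlinarith [sq_nonneg b', sq_nonneg c']
      rcases lt_or_gt_of_ne hne with h1 | h1 <;> rcases lt_or_gt_of_ne hne' with h2 | h2
      · have := mixed_pos (a := -a) (b := b) (c := c) (e := e) (a' := -a') (b' := b') (c' := c')
          (e' := e') (by linarith) (by linarith) (by linarith) (by linarith)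
        intro h; linarith
      · have := mixed_pos (a := -a) (b := -b) (c := -c) (e := e) (a' := a') (b' := b') (c' := c')
          (e' := -e') (by linarith) (by linarith) (by linarith) (by linarith)
        intro h; linarith
      · have := mixed_pos (a := a) (b := b) (c := c) (e := -e) (a' := -a') (b' := -b') (c' := -c')
          (e' := e') (by linarith) (by linarith) (by linarith) (by linarith)
        intro h; linarith
      · have := mixed_pos (a := a) (b := b) (c := c) (e := -e) (a' := a') (b' := b') (c' := c')
          (e' := -e') (by linarith) (by linarith) (by linarith) (by linarith)
        intro h; linarith
    exact key h3 h4 h2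
  · have hc2 : c ^ 2 = 1 := by
      have : (c ^ 2 - 1) * (z ⬝ᵥ J *ᵥ z) = 0 := by linear_combination hform
      rcases mul_eq_zero.mp this with h | h
      · linear_combination h
      · exact absurd h hs
    have hreal : ∀ w, spinLin (Matrix.SpecialLinearGroup.map (intEmb d) A).1 w = c • w →
        (QuotientGroup.mk A : Bi d) • rePart w = c • rePart w := by
      intro w hw
      rw [hact, spinLin_rePart, hw]
      rcases eq_or_eq_neg_of_sq_eq_sq _ _ (hc2.trans (one_pow 2).symm) with rfl | rfl
      · simp
      · ext j; simp [rePart]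
    rcases lt_or_ge (hnorm (rePart z)) 0 with h1 | h1
    · exact exists_futureCone_of_timelike (him z) h1 hc2 (hreal z hc')
    · refine exists_futureCone_of_timelike (him (-Complex.I • z)) (by linarith) hc2
        (hreal _ ?_)
      rw [map_smul, hc', smul_comm]

theorem modular_sameSide {d : ℕ} {lam : ℝ} (hO : IsImaginaryOrder (intEmb d).range lam)
    {δ : Bi d} (hδ : δ ∈ modularGroup d) :
    SameSide (wallForm d) (negPoint lam) (δ • negPoint lam) := by
  have hadj := adjacent_negPoint_posPoint (d := d) hO
  have hW := isWallSystem hO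
  have hfix : δ⁻¹ • baseWall d = baseWall d := smul_baseWall_eq.mpr (inv_mem hδ)
  intro m
  rw [linear_smul_eq wallForm_smul]
  by_cases hm : m = baseWall d
  · subst hm
    rw [hfix]
    exact mul_pos_of_neg_of_neg hadj.1 hadj.1
  · have hm' : δ⁻¹ • m ≠ baseWall d := by
      intro h
      rw [← hfix] at h
      exact hm (MulAction.injective _ h)
    have hp := horoPoint_mem 0 0
    have hp0 : wallForm d (baseWall d) (horoPoint 0 0) = 0 := by
      rw [wallForm_baseWall]; simp [horoPoint]
    have h1 := hadj.wall_pos hW (negPoint_mem hO).1 (posPoint_mem hO).1 hp hp0 hm'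
    have h2 := hadj.wall_pos hW (negPoint_mem hO).1 (posPoint_mem hO).1
      (bi_smul_mem_futureCone δ _ hp) (by
        rw [wallForm_baseWall, modular_smul_two hδ]; simp [horoPoint]) hm
    rw [linear_smul_eq wallForm_smul, mul_comm] at h2
    exact mul_pos_trans h2 h1

theorem conj_sameSide {d : ℕ} {γ h : Bi d} {x y : Fin 4 → ℂ}
    (hxy : SameSide (wallForm d) x (h • y)) (hγ : SameSide (wallForm d) x (γ • x)) :
    SameSide (wallForm d) y ((h⁻¹ * γ * h) • y) := by
  have h1 := hxy.symm.trans (hγ.trans (hxy.smul wallForm_smul γ))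
  have h2 := h1.smul wallForm_smul h⁻¹
  rwa [inv_smul_smul, smul_smul, smul_smul] at h2

/-- A fixed point off the walls gives a stabilized region; a fixed point on a wall gives a conjugate
in the modular group, which preserves both sides of the plane. -/
theorem exists_conj_sameSide_of_fixed {d : ℕ} {lam : ℝ}
    (hO : IsImaginaryOrder (intEmb d).range lam) {γ : Bi d} {x : Fin 4 → ℂ}
    (hx : x ∈ futureCone) (hfix : γ • x = x) :
    ∃ h : Bi d, SameSide (wallForm d) (negPoint lam) ((h⁻¹ * γ * h) • negPoint lam) := by
  by_cases hoff : ∀ m, wallForm d m x ≠ 0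
  · obtain ⟨w, ⟨β, rfl⟩, hβ⟩ := hO.exists_im
    obtain ⟨h, -, hs⟩ := exists_translate hO hβ ⟨hx, hoff⟩
    exact ⟨h, conj_sameSide hs (by rw [hfix]; exact SameSide.refl ⟨hx, hoff⟩)⟩
  · push Not at hoff
    obtain ⟨m, hm⟩ := hoff
    obtain ⟨h, rfl⟩ := exists_eq_smul_baseWall m
    rw [← smul_inv_smul h x, wallForm_smul, wallForm_baseWall] at hm
    refine ⟨h, modular_sameSide hO
      (mem_modularGroup_of_two_eq_zero hO (bi_smul_mem_futureCone h⁻¹ x hx) hm ?_)⟩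
    rw [smul_smul, mul_inv_cancel_right, mul_smul, hfix]
    exact hm

theorem map_eq_conj {Γ 𝒢 : Type*} [Group Γ] [Group 𝒢] {i ρ : Γ →* 𝒢} {γ h : Γ}
    (H : ρ (h⁻¹ * γ * h) = i (h⁻¹ * γ * h)) :
    ρ γ = (ρ h * (i h)⁻¹) * i γ * (ρ h * (i h)⁻¹)⁻¹ := by
  simp only [map_mul, map_inv] at H
  have : ρ γ = ρ h * ((ρ h)⁻¹ * ρ γ * ρ h) * (ρ h)⁻¹ := by group
  rw [this, H]; group

/-! ### Isotropic vectors and parabolic elements -/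

/-- The isotropic vector of the Hermitian matrix `u uᴴ`. -/
def nullVec (u : Fin 2 → ℂ) : Fin 4 → ℂ := toHerm.symm (Matrix.vecMulVec u (star u))

theorem toHerm_nullVec (u : Fin 2 → ℂ) : toHerm (nullVec u) = Matrix.vecMulVec u (star u) :=
  toHerm.apply_symm_apply _

theorem spinLin_nullVec (A : Matrix (Fin 2) (Fin 2) ℂ) (u : Fin 2 → ℂ) :
    spinLin A (nullVec u) = nullVec (A *ᵥ u) := by
  apply toHerm.injective
  rw [toHerm_spinLin, toHerm_nullVec, toHerm_nullVec, Matrix.mul_vecMulVec, Matrix.vecMulVec_mul,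
    Matrix.star_mulVec]

theorem nullVec_smul (c : ℂ) (u : Fin 2 → ℂ) :
    nullVec (c • u) = (c * (starRingEnd ℂ) c) • nullVec u := by
  apply toHerm.injective
  rw [map_smul, toHerm_nullVec, toHerm_nullVec]
  ext r s
  simp [Matrix.vecMulVec_apply]
  ring

theorem nullVec_eq (u : Fin 2 → ℂ) : nullVec u = ![((Complex.normSq (u 0) / √2 : ℝ) : ℂ),
    ((-(u 0 * (starRingEnd ℂ) (u 1)).re : ℝ) : ℂ), (((u 0 * (starRingEnd ℂ) (u 1)).im : ℝ) : ℂ),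
    ((-(Complex.normSq (u 1) / √2) : ℝ) : ℂ)] := by
  rw [nullVec, toHerm_symm_entries]
  ext j
  fin_cases j <;> apply Complex.ext <;>
    simp [Matrix.vecMulVec_apply, Complex.normSq_apply, Complex.div_re, Complex.div_im] <;> ring

theorem nullVec_im (u : Fin 2 → ℂ) (j : Fin 4) : (nullVec u j).im = 0 := by
  rw [nullVec_eq]
  fin_cases j <;> exact Complex.ofReal_im _

theorem hnorm_nullVec (u : Fin 2 → ℂ) : hnorm (nullVec u) = 0 := by
  have hs : √2 * √2 = (2 : ℝ) := Real.mul_self_sqrt (by norm_num)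
  have hs0 : √2 ≠ 0 := by positivity
  rw [hnorm_of_real (nullVec_im u), nullVec_eq]
  simp only [Matrix.cons_val, Complex.ofReal_re, Complex.normSq_apply, Complex.mul_re,
    Complex.mul_im, Complex.conj_re, Complex.conj_im]
  field_simp
  rw [Real.sq_sqrt (by norm_num)]
  ring

theorem nullVec_ne_zero {u : Fin 2 → ℂ} (hu : u ≠ 0) : nullVec u ≠ 0 := by
  intro h
  apply hu
  have h1 := toHerm_nullVec u
  rw [h, map_zero] at h1
  ext j
  have := congrFun (congrFun h1 j) j
  simpa [Matrix.vecMulVec_apply] using this.symm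

theorem proportional_of_nullVec {u u' : Fin 2 → ℂ} (hu : u ≠ 0) {a : ℂ}
    (h : nullVec u = a • nullVec u') : u 0 * u' 1 = u 1 * u' 0 := by
  have h1 := congrArg toHerm h
  rw [map_smul, toHerm_nullVec, toHerm_nullVec] at h1
  have h2 : ∀ i j, u i * (starRingEnd ℂ) (u j) = a * (u' i * (starRingEnd ℂ) (u' j)) := fun i j => by
    simpa [Matrix.vecMulVec_apply] using congrFun (congrFun h1 i) j
  have h3 : ∀ j, (u 0 * u' 1 - u 1 * u' 0) * (starRingEnd ℂ) (u j) = 0 := fun j => by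
    linear_combination u' 1 * h2 0 j - u' 0 * h2 1 j
  by_contra hne
  apply hu
  ext j
  have := (mul_eq_zero.mp (h3 j)).resolve_left (sub_ne_zero.mpr hne)
  simpa using this

theorem eq_smul_of_proportional {K : Type*} [Field K] {u u' : Fin 2 → K} (hu : u ≠ 0)
    (h : u 0 * u' 1 = u 1 * u' 0) : ∃ c : K, u' = c • u := by
  by_cases h0 : u 0 = 0
  · have h1 : u 1 ≠ 0 := fun h1 => hu (by ext j; fin_cases j <;> assumption)
    refine ⟨u' 1 / u 1, ?_⟩
    rw [h0, zero_mul] at h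
    have h2 := (mul_eq_zero.mp h.symm).resolve_left h1
    ext j
    fin_cases j
    · simp [h0, h2]
    · simp [h1]
  · refine ⟨u' 0 / u 0, ?_⟩
    ext j
    fin_cases j
    · simp [h0]
    · simp; field_simp; linear_combination h

theorem spin_smul_mk_nullVec {A : SL(2, ℂ)} {u : Fin 2 → ℂ} (hu : u ≠ 0) {c : ℂ}
    (h : A.1 *ᵥ u = c • u) : ((spin A : SU31) : SL(4, ℂ)) •
      Projectivization.mk ℂ (nullVec u) (nullVec_ne_zero hu) =
      Projectivization.mk ℂ (nullVec u) (nullVec_ne_zero hu) := by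
  rw [smul_mk_eq_iff]
  exact ⟨_, by rw [spin_smul, spinLin_nullVec, h, nullVec_smul]⟩

theorem exists_mulVec_of_smul_mk_nullVec {A : SL(2, ℂ)} {u : Fin 2 → ℂ} (hu : u ≠ 0)
    (h : ((spin A : SU31) : SL(4, ℂ)) • Projectivization.mk ℂ (nullVec u) (nullVec_ne_zero hu) =
      Projectivization.mk ℂ (nullVec u) (nullVec_ne_zero hu)) : ∃ c : ℂ, A.1 *ᵥ u = c • u := by
  rw [smul_mk_eq_iff] at h
  obtain ⟨c, hc⟩ := h
  rw [spin_smul, spinLin_nullVec] at hc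
  refine eq_smul_of_proportional hu ?_
  by_cases h0 : A.1 *ᵥ u = 0
  · simp [h0]
  · have := proportional_of_nullVec h0 hc
    linear_combination -this

/-- Otherwise the matrix has two independent eigenvectors, whose null vectors give two fixed
boundary points. -/
theorem trace_sq_of_isParabolic {A : SL(2, ℂ)} (h : IsParabolic (spin A)) :
    A.1.trace ^ 2 = 4 := by
  by_contra hne
  obtain ⟨s, hs⟩ := IsAlgClosed.exists_pow_nat_eq (A.1.trace ^ 2 - 4) (n := 2) (by norm_num)
  have hs0 : s ≠ 0 := by
    rintro rfl
    exact hne (by linear_combination -hs)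
  have hdet := A.2
  rw [Matrix.det_fin_two] at hdet
  rw [Matrix.trace_fin_two] at hs
  have key : ∀ e : ℂ, e ^ 2 = s ^ 2 → ∃ u : Fin 2 → ℂ, u ≠ 0 ∧
      A.1 *ᵥ u = ((A.1 0 0 + A.1 1 1 + e) / 2) • u := by
    intro e he
    set μ := (A.1 0 0 + A.1 1 1 + e) / 2 with hμ
    obtain ⟨u, hu, hAu⟩ := (Matrix.exists_mulVec_eq_zero_iff (M := A.1 - Matrix.scalar _ μ)).mpr (by
      rw [Matrix.det_fin_two]
      simp [hμ]
      linear_combination hdet + (he + hs) / 4)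
    refine ⟨u, hu, ?_⟩
    rw [Matrix.sub_mulVec, sub_eq_zero] at hAu
    rw [hAu]
    ext j
    simp [Matrix.mulVec_diagonal]
  obtain ⟨u, hu, h1⟩ := key s rfl
  obtain ⟨u', hu', h2⟩ := key (-s) (by ring)
  obtain ⟨-, p, -, hp⟩ := h
  have e1 := hp _ ⟨(mk_mem_bdryHC (nullVec_ne_zero hu)).mpr (hnorm_nullVec u),
    spin_smul_mk_nullVec hu h1⟩
  have e2 := hp _ ⟨(mk_mem_bdryHC (nullVec_ne_zero hu')).mpr (hnorm_nullVec u'),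
    spin_smul_mk_nullVec hu' h2⟩
  rw [← e2, Projectivization.mk_eq_mk_iff'] at e1
  obtain ⟨a, ha⟩ := e1
  obtain ⟨c, rfl⟩ := eq_smul_of_proportional hu (proportional_of_nullVec hu ha.symm)
  rw [Matrix.mulVec_smul, h1] at h2
  apply hu'
  have h3 : s • c • u = 0 := by
    ext j
    have := congrFun h2 j
    simp only [Pi.smul_apply, smul_eq_mul, Pi.zero_apply] at this ⊢
    linear_combination this
  exact (smul_eq_zero.mp h3).resolve_left hs0

theorem intEmb_injective (d : ℕ) : Function.Injective (intEmb d) :=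
  fun _ _ h => Subtype.ext (Subtype.ext h)

theorem neg_rep {d : ℕ} (A : SL(2, 𝓞 (Qd d))) :
    (QuotientGroup.mk (-A) : Bi d) = QuotientGroup.mk A := by
  rw [QuotientGroup.eq, Matrix.SpecialLinearGroup.mem_center_iff]
  refine ⟨-1, by simp, ?_⟩
  have : (-A)⁻¹ * A = -1 := by
    rw [inv_mul_eq_iff_eq_mul]; simp
  rw [this, map_neg, map_one]
  rfl

theorem not_isParabolic_one : ¬ IsParabolic 1 := by
  intro h
  have hp := horoPoint_mem 0 0
  have h0 : horoPoint 0 0 ≠ 0 := by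
    intro h
    have := hp.2.2
    rw [h] at this
    simp at this
  refine h.1 (Projectivization.mk ℂ _ h0) ((mk_mem_HC h0).mpr hp.2.1) ?_
  rw [OneMemClass.coe_one, one_smul]

theorem exists_fixed_vector_of_isParabolic {d : ℕ} {γ : Bi d} (h : IsParabolic (incl d γ)) :
    ∃ (A : SL(2, 𝓞 (Qd d))) (u : Fin 2 → 𝓞 (Qd d)), γ = QuotientGroup.mk A ∧ A ≠ 1 ∧
      u ≠ 0 ∧ A.1 *ᵥ u = u := by
  have htr : ∃ A : SL(2, 𝓞 (Qd d)), γ = QuotientGroup.mk A ∧ A.1 0 0 + A.1 1 1 = 2 := by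
    obtain ⟨A, rfl⟩ := exists_rep γ
    rw [incl_mk] at h
    have h1 := trace_sq_of_isParabolic h
    rw [Matrix.trace_fin_two] at h1
    have h2 : (A.1 0 0 + A.1 1 1) ^ 2 = 2 ^ 2 := by
      apply intEmb_injective d
      rw [map_pow, map_add, map_pow, map_ofNat]
      norm_num
      exact h1
    rcases eq_or_eq_neg_of_sq_eq_sq _ _ h2 with h3 | h3
    · exact ⟨A, rfl, h3⟩
    · refine ⟨-A, (neg_rep A).symm, ?_⟩
      rw [Matrix.SpecialLinearGroup.coe_neg]
      simp only [Matrix.neg_apply]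
      linear_combination -h3
  obtain ⟨A, rfl, htr⟩ := htr
  have hdet := A.2
  rw [Matrix.det_fin_two] at hdet
  have hne : A ≠ 1 := by
    rintro rfl
    rw [QuotientGroup.mk_one, map_one] at h
    exact not_isParabolic_one h
  -- With trace two, Cayley–Hamilton gives `(A - 1) ^ 2 = 0`, so the first column of `A - 1` is
  -- fixed by `A`. If it vanishes, the first basis vector is fixed.
  by_cases hc : ![A.1 0 0 - 1, A.1 1 0] = 0
  · refine ⟨A, ![1, 0], rfl, hne, fun h => by simpa using congrFun h 0, ?_⟩
    have h0 := congrFun hc 0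
    have h1 := congrFun hc 1
    simp at h0 h1
    refine funext fun j => ?_
    fin_cases j
    · simp [Matrix.mulVec, dotProduct]; linear_combination h0
    · simpa [Matrix.mulVec, dotProduct] using h1
  · refine ⟨A, _, rfl, hne, hc, ?_⟩
    refine funext fun j => ?_
    fin_cases j
    · simp [Matrix.mulVec, dotProduct]
      linear_combination -hdet + A.1 0 0 * htr
    · simp [Matrix.mulVec, dotProduct]
      linear_combination A.1 1 0 * htr

/-! ### Cusps -/

/-- This is the reversed Cauchy–Schwarz inequality in the plane of `x`, applied to `x` and the
projection of `k`, whose norm is minus the square of the third coordinate of `k`. -/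
theorem hnorm_add_sq_ge_of_two_eq_zero {x k : Fin 4 → ℂ} (hx : ∀ j, (x j).im = 0)
    (hk : ∀ j, (k j).im = 0) (hneg : hnorm x < 0) (hnull : hnorm k = 0) (h2 : (x 2).re = 0) :
    4 * -hnorm x * (k 2).re ^ 2 ≤ (hnorm (x + k) - hnorm x) ^ 2 := by
  have hxk : ∀ j, ((x + k) j).im = 0 := fun j => by simp [hx j, hk j]
  rw [hnorm_of_real hxk]
  rw [hnorm_of_real hk] at hnull
  rw [hnorm_of_real hx, h2] at hneg ⊢
  simp only [Pi.add_apply, Complex.add_re, h2]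
  generalize (x 0).re = x0 at *
  generalize (x 1).re = x1 at *
  generalize (x 3).re = x3 at *
  generalize (k 0).re = k0 at *
  generalize (k 1).re = k1 at *
  generalize (k 2).re = k2 at *
  generalize (k 3).re = k3 at *
  have h0 : x0 ≠ 0 := by rintro rfl; nlinarith [sq_nonneg x1]
  set b := x0 * k3 + x3 * k0 + x1 * k1 with hb
  have hk2 : k2 ^ 2 = -(2 * k0 * k3 + k1 ^ 2) := by linarith
  have hE : 0 ≤ x0 ^ 2 * (b ^ 2 - -(2 * x0 * x3 + x1 ^ 2) * k2 ^ 2) := by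
    have e : x0 ^ 2 * (b ^ 2 - -(2 * x0 * x3 + x1 ^ 2) * k2 ^ 2) =
        (x0 * b - k0 * (2 * x0 * x3 + x1 ^ 2)) ^ 2 +
          -(2 * x0 * x3 + x1 ^ 2) * (x0 * k1 - k0 * x1) ^ 2 := by
      rw [hk2, hb]; ring
    rw [e]
    have h4 : 0 < -(2 * x0 * x3 + x1 ^ 2) := by linarith
    positivity
  have h5 := nonneg_of_mul_nonneg_right hE (by positivity)
  have e : 2 * (x0 + k0) * (x3 + k3) + (x1 + k1) ^ 2 + (0 + k2) ^ 2 -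
      (2 * x0 * x3 + x1 ^ 2 + 0 ^ 2) = 2 * b := by
    rw [hb]; linear_combination hk2
  rw [e]
  nlinarith

theorem bi_smul_im {d : ℕ} (γ : Bi d) {x : Fin 4 → ℂ} (hx : ∀ j, (x j).im = 0) (j : Fin 4) :
    ((γ • x) j).im = 0 := by
  obtain ⟨A, rfl⟩ := exists_rep γ
  rw [bi_smul_def, incl_mk, spin_smul]
  exact im_spinLin hx j

theorem bi_hnorm_smul {d : ℕ} (γ : Bi d) (x : Fin 4 → ℂ) : hnorm (γ • x) = hnorm x :=
  hnorm_smul _ _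

theorem hnorm_add_sq_ge_of_wallForm_eq_zero {d : ℕ} {m : Wall d} {x k : Fin 4 → ℂ}
    (hx : ∀ j, (x j).im = 0) (hk : ∀ j, (k j).im = 0) (hneg : hnorm x < 0) (hnull : hnorm k = 0)
    (h : wallForm d m x = 0) :
    4 * -hnorm x * wallForm d m k ^ 2 ≤ (hnorm (x + k) - hnorm x) ^ 2 := by
  obtain ⟨γ, rfl⟩ := exists_eq_smul_baseWall m
  have e : ∀ y, wallForm d (γ • baseWall d) y = ((γ⁻¹ • y) 2).re := fun y => by
    rw [← wallForm_baseWall, linear_smul_eq wallForm_smul, inv_inv]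
  rw [e] at h
  have := hnorm_add_sq_ge_of_two_eq_zero (bi_smul_im γ⁻¹ hx) (bi_smul_im γ⁻¹ hk)
    (by rwa [bi_hnorm_smul]) (by rwa [bi_hnorm_smul]) h
  rwa [← bi_smul_add, bi_hnorm_smul, bi_hnorm_smul, ← e] at this

theorem bi_smul_nullVec {d : ℕ} (A : SL(2, 𝓞 (Qd d))) (u : Fin 2 → 𝓞 (Qd d)) :
    (QuotientGroup.mk A : Bi d) • nullVec (intEmb d ∘ u) = nullVec (intEmb d ∘ (A.1 *ᵥ u)) := by
  rw [bi_smul_def, incl_mk, spin_smul, spinLin_nullVec]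
  exact congrArg nullVec (funext fun j => (RingHom.map_mulVec (intEmb d) A.1 u j).symm)

theorem wallForm_nullVec {d : ℕ} (m : Wall d) :
    ∃ B : SL(2, 𝓞 (Qd d)), ∀ u : Fin 2 → 𝓞 (Qd d), wallForm d m (nullVec (intEmb d ∘ u)) =
      (intEmb d ((B.1 *ᵥ u) 0) * (starRingEnd ℂ) (intEmb d ((B.1 *ᵥ u) 1))).im := by
  obtain ⟨γ, rfl⟩ := exists_eq_smul_baseWall m
  obtain ⟨B, hB⟩ := exists_rep γ⁻¹
  refine ⟨B, fun u => ?_⟩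
  rw [← inv_inv γ, ← linear_smul_eq wallForm_smul, wallForm_baseWall, hB, bi_smul_nullVec,
    nullVec_eq]
  simp

/-- The ratio of the two coordinates is real, hence rational. Its reduced form and a Bézout relation
give an integer matrix sending the cusp to infinity. -/
theorem exists_mulVec_one_eq_zero {d : ℕ} {lam : ℝ} (hO : IsImaginaryOrder (intEmb d).range lam)
    {w : Fin 2 → 𝓞 (Qd d)}
    (h : (intEmb d (w 0) * (starRingEnd ℂ) (intEmb d (w 1))).im = 0) :
    ∃ C : SL(2, 𝓞 (Qd d)), (C.1 *ᵥ w) 1 = 0 := by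
  have hmem : ∀ a : 𝓞 (Qd d), intEmb d a ∈ (intEmb d).range := fun a => ⟨a, rfl⟩
  obtain ⟨r, hr⟩ := hO.real_mem (mul_mem (hmem (w 0)) (hO.conj_mem (hmem (w 1)))) h
  obtain ⟨n, hn⟩ := hO.real_mem (mul_mem (hmem (w 1)) (hO.conj_mem (hmem (w 1)))) (by
    rw [Complex.mul_conj]; exact Complex.ofReal_im _)
  by_cases hw : w 1 = 0
  · exact ⟨1, by simpa using hw⟩
  have hw' : intEmb d (w 1) ≠ 0 := fun h => hw (intEmb_injective d (by rw [h, map_zero]))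
  have hn0 : n ≠ 0 := by
    rintro rfl
    rw [Complex.mul_conj] at hn
    norm_cast at hn
    exact hw' (Complex.normSq_eq_zero.mp hn)
  have hnr : (n : 𝓞 (Qd d)) * w 0 = r * w 1 := by
    apply intEmb_injective d
    rw [map_mul, map_mul, map_intCast, map_intCast, ← hr, ← hn]
    ring
  obtain ⟨g, n', r', hg, hcop, rfl, rfl⟩ := Int.exists_gcd_one' (m := n) (n := r)
    (Int.gcd_pos_of_ne_zero_left _ hn0)
  have hg0 : (g : 𝓞 (Qd d)) ≠ 0 := by
    intro h
    have := congrArg (intEmb d) h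
    rw [map_natCast, map_zero] at this
    norm_cast at this
    omega
  have hnr' : (n' : 𝓞 (Qd d)) * w 0 = r' * w 1 := by
    apply mul_left_cancel₀ hg0
    push_cast at hnr
    linear_combination hnr
  obtain ⟨a, b, hab⟩ := Int.isCoprime_iff_gcd_eq_one.mpr hcop
  refine ⟨⟨!![(-b : 𝓞 (Qd d)), -a; n', -r'], ?_⟩, ?_⟩
  · have hab' : (a : 𝓞 (Qd d)) * n' + b * r' = 1 := by exact_mod_cast hab
    rw [Matrix.det_fin_two]
    simp
    linear_combination hab'
  · simp [Matrix.mulVec, dotProduct]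
    linear_combination hnr'

/-- Integrality keeps the values of the wall forms at the null vector away from zero, so a horoball
there meets no wall. Any of its points has the signs of the null vector itself. -/
theorem exists_horoball_point {d : ℕ} {lam : ℝ} (hO : IsImaginaryOrder (intEmb d).range lam)
    {u : Fin 2 → 𝓞 (Qd d)} (h : ∀ m, wallForm d m (nullVec (intEmb d ∘ u)) ≠ 0) :
    ∃ x ∈ futureCone, ∀ m, 0 < wallForm d m x * wallForm d m (nullVec (intEmb d ∘ u)) := by
  have hsq : ∀ m, 1 ≤ wallForm d m (nullVec (intEmb d ∘ u)) ^ 2 := by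
    intro m
    obtain ⟨B, hB⟩ := wallForm_nullVec m
    obtain ⟨k, hk⟩ := hO.im_mem (mul_mem ⟨(B.1 *ᵥ u) 0, rfl⟩ (hO.conj_mem ⟨(B.1 *ᵥ u) 1, rfl⟩))
    have h1 := h m
    rw [hB, hk] at h1 ⊢
    have hk0 : k ≠ 0 := by rintro rfl; simp at h1
    have hk1 : (1 : ℝ) ≤ (k : ℝ) ^ 2 := by
      have : 1 ≤ k ^ 2 := Int.one_le_abs (pow_ne_zero 2 hk0) |>.trans (abs_of_nonneg (sq_nonneg k)).le
      exact_mod_cast this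
    have hl := hO.one_lt
    rw [mul_pow]
    nlinarith
  set k := nullVec (intEmb d ∘ u) with hk
  have him : ∀ j, (k j).im = 0 := nullVec_im _
  have hnull : hnorm k = 0 := hnorm_nullVec _
  set b : ℝ := (Complex.normSq (intEmb d (u 0)) + Complex.normSq (intEmb d (u 1))) / 2 with hb
  have hb0 : 0 ≤ b := by
    have := Complex.normSq_nonneg (intEmb d (u 0))
    have := Complex.normSq_nonneg (intEmb d (u 1))
    positivity
  have hk0 : 0 ≤ (k 0).re := by
    rw [hk, nullVec_eq]
    simp
    have := Complex.normSq_nonneg (intEmb d (u 0))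
    positivity
  set p := horoPoint 0 0 with hp
  have hpm : p ∈ futureCone := horoPoint_mem 0 0
  have him' : ∀ (R : ℝ) j, ((p + R • k) j).im = 0 := fun R j => by simp [hpm.1 j, him j]
  have hnorm' : ∀ R : ℝ, hnorm (p + R • k) = -1 - 2 * R * b := by
    intro R
    rw [hnorm_of_real (him' R)]
    rw [hnorm_of_real him] at hnull
    have e1 : (k 0).re = Complex.normSq (intEmb d (u 0)) / √2 := by rw [hk, nullVec_eq]; simp
    have e3 : (k 3).re = -(Complex.normSq (intEmb d (u 1)) / √2) := by
      rw [hk, nullVec_eq]; simp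
    have hi : (1 / √2) * (1 / √2) = 1 / 2 := by field_simp; rw [Real.sq_sqrt (by norm_num)]
    simp only [Pi.add_apply, Pi.smul_apply, Complex.add_re, Complex.real_smul, Complex.re_ofReal_mul]
    simp only [hp, horoPoint, Matrix.cons_val, Complex.ofReal_re]
    have e : 2 * ((1 + 0 ^ 2 + 0 ^ 2) / √2 + R * (k 0).re) * (-(1 / √2) + R * (k 3).re) +
        (0 + R * (k 1).re) ^ 2 + (0 + R * (k 2).re) ^ 2 = -2 * ((1 / √2) * (1 / √2)) +
        2 * R * ((k 3).re * (1 / √2) - (k 0).re * (1 / √2)) +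
        R ^ 2 * (2 * (k 0).re * (k 3).re + (k 1).re ^ 2 + (k 2).re ^ 2) := by ring
    rw [e, hnull, e1, e3, hb]
    linear_combination (-2 - 2 * R * (Complex.normSq (intEmb d (u 0)) +
      Complex.normSq (intEmb d (u 1)))) * hi
  -- A zero would give `4 * (1 + 2 * R * b) ≤ (2 * b) ^ 2`, which is false for `R ≥ b`.
  have hne : ∀ (R : ℝ), b ≤ R → ∀ m, wallForm d m (p + R • k) ≠ 0 := by
    intro R hR m h0
    have h1 := hnorm_add_sq_ge_of_wallForm_eq_zero (him' R) him (by rw [hnorm']; nlinarith)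
      hnull h0
    have e : p + R • k + k = p + (R + 1) • k := by rw [add_smul, one_smul, add_assoc]
    rw [e, hnorm', hnorm'] at h1
    have h2 := hsq m
    nlinarith [mul_le_mul_of_nonneg_left hR hb0,
      mul_nonneg (show 0 ≤ -(-1 - 2 * R * b) by nlinarith) (sub_nonneg.mpr h2)]
  refine ⟨p + b • k, ⟨him' b, by rw [hnorm']; nlinarith, ?_⟩, fun m => ?_⟩
  · have := hpm.2.2
    simp only [Pi.add_apply, Pi.smul_apply, Complex.add_re, Complex.real_smul,
      Complex.re_ofReal_mul]
    nlinarith [mul_nonneg hb0 hk0]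
  · by_contra hlt
    push Not at hlt
    have hm := h m
    have hlin : ∀ R : ℝ, wallForm d m (p + R • k) = wallForm d m p + R * wallForm d m k :=
      fun R => by rw [map_add, map_smul, smul_eq_mul]
    -- With the wrong sign at parameter `b`, the affine function with slope `wallForm d m k`
    -- vanishes at this later parameter.
    refine hne (b - wallForm d m (p + b • k) / wallForm d m k) ?_ m ?_
    · have : wallForm d m (p + b • k) / wallForm d m k ≤ 0 := by
        rw [← mul_div_mul_right _ _ hm]
        exact div_nonpos_of_nonpos_of_nonneg hlt (mul_self_nonneg _)
      linarith
    · rw [hlin, hlin]; field_simp; ring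

theorem exists_conj_sameSide_of_cusp {d : ℕ} {lam : ℝ}
    (hO : IsImaginaryOrder (intEmb d).range lam) {u : Fin 2 → 𝓞 (Qd d)}
    (h : ∀ m, wallForm d m (nullVec (intEmb d ∘ u)) ≠ 0) :
    ∃ h : Bi d, ∀ γ : Bi d, γ • nullVec (intEmb d ∘ u) = nullVec (intEmb d ∘ u) →
      SameSide (wallForm d) (negPoint lam) ((h⁻¹ * γ * h) • negPoint lam) := by
  obtain ⟨x, hx, hs⟩ := exists_horoball_point hO h
  obtain ⟨w, ⟨β, rfl⟩, hβ⟩ := hO.exists_im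
  obtain ⟨g, -, hg⟩ := exists_translate hO hβ
    ⟨hx, fun m h0 => by have := hs m; rw [h0, zero_mul] at this; exact lt_irrefl _ this⟩
  refine ⟨g, fun γ hγ => conj_sameSide hg fun m => ?_⟩
  have h1 := hs (γ⁻¹ • m)
  rw [← linear_smul_eq wallForm_smul, ← linear_smul_eq wallForm_smul, hγ] at h1
  rw [mul_comm] at h1
  exact mul_pos_trans (hs m) h1

theorem exists_mulVec_one_eq_zero_of_cusp {d : ℕ} {lam : ℝ}
    (hO : IsImaginaryOrder (intEmb d).range lam) {u : Fin 2 → 𝓞 (Qd d)} {m : Wall d}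
    (h : wallForm d m (nullVec (intEmb d ∘ u)) = 0) :
    ∃ C : SL(2, 𝓞 (Qd d)), (C.1 *ᵥ u) 1 = 0 := by
  obtain ⟨B, hB⟩ := wallForm_nullVec m
  rw [hB] at h
  obtain ⟨C, hC⟩ := exists_mulVec_one_eq_zero hO h
  exact ⟨C * B, by rw [Matrix.SpecialLinearGroup.coe_mul, ← Matrix.mulVec_mulVec]; exact hC⟩

theorem eq_translation_of_mulVec {R : Type*} [CommRing R] [IsDomain R] {A C : SL(2, R)}
    {u : Fin 2 → R} (hu : u ≠ 0) (hA : A.1 *ᵥ u = u) (hC : (C.1 *ᵥ u) 1 = 0) :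
    ∃ β : R, A = C⁻¹ * translation β * C := by
  set D : SL(2, R) := C * A * C⁻¹ with hD
  set w := C.1 *ᵥ u with hw
  have hDw : D.1 *ᵥ w = w := by
    have e : D.1 * C.1 = C.1 * A.1 := by
      rw [← Matrix.SpecialLinearGroup.coe_mul, ← Matrix.SpecialLinearGroup.coe_mul, hD,
        inv_mul_cancel_right]
    rw [hw, Matrix.mulVec_mulVec, e, ← Matrix.mulVec_mulVec, hA]
  have hw0 : w 0 ≠ 0 := by
    intro h0
    apply hu
    have : w = 0 := by ext j; fin_cases j <;> assumption
    have e : (C⁻¹ : SL(2, R)).1 * C.1 = 1 := by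
      rw [← Matrix.SpecialLinearGroup.coe_mul, inv_mul_cancel, Matrix.SpecialLinearGroup.coe_one]
    rw [← Matrix.one_mulVec u, ← e, ← Matrix.mulVec_mulVec, ← hw, this, Matrix.mulVec_zero]
  have h0 := congrFun hDw 0
  have h1 := congrFun hDw 1
  simp [Matrix.mulVec, dotProduct, hC] at h0 h1
  have h00 : D.1 0 0 = 1 := by simpa [hw0] using h0
  have h10 : D.1 1 0 = 0 := by simpa [hw0] using h1
  have hdet := D.2
  rw [Matrix.det_fin_two, h00, h10] at hdet
  refine ⟨D.1 0 1, ?_⟩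
  have : D = translation (D.1 0 1) := by
    refine Subtype.ext (Matrix.ext fun r s => ?_)
    fin_cases r <;> fin_cases s
    · exact h00
    · rfl
    · exact h10
    · change D.1 1 1 = 1
      simpa using hdet
  rw [← this, hD]
  group

/-! ### Bent translations -/

/-- In the coordinates `x₀ + α (x₂ + κ x₃), x₁, x₂ + κ x₃, x₃`, the matrix `g` is the product of
the scalar `ν`, of a unipotent matrix with parameters `p`, `s`, and of the complex reflection of
multiplier `w` in the third coordinate. -/
def IsShear (α κ : ℂ) (g : SU31) (p s w ν : ℂ) : Prop :=
  ∀ x : Fin 4 → ℂ, ((g : SL(4, ℂ)) • x) 3 = ν * x 3 ∧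
    ((g : SL(4, ℂ)) • x) 1 = ν * (x 1 + p * x 3) ∧
    ((g : SL(4, ℂ)) • x) 2 + κ * ((g : SL(4, ℂ)) • x) 3 = ν * w * (x 2 + κ * x 3) ∧
    ((g : SL(4, ℂ)) • x) 0 + α * (((g : SL(4, ℂ)) • x) 2 + κ * ((g : SL(4, ℂ)) • x) 3) =
      ν * (x 0 + α * (x 2 + κ * x 3) - p * x 1 + (s - p ^ 2 / 2) * x 3)

theorem IsShear.mul {α κ : ℂ} {g g' : SU31} {p s w ν p' s' w' ν' : ℂ}
    (h : IsShear α κ g p s w ν) (h' : IsShear α κ g' p' s' w' ν') :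
    IsShear α κ (g * g') (p + p') (s + s') (w * w') (ν * ν') := by
  intro x
  rw [Subgroup.coe_mul, mul_smul]
  obtain ⟨h3, h1, h2, h0⟩ := h ((g' : SL(4, ℂ)) • x)
  obtain ⟨h3', h1', h2', h0'⟩ := h' x
  refine ⟨?_, ?_, ?_, ?_⟩
  · rw [h3, h3']; ring
  · rw [h1, h3', h1']; ring
  · rw [h2, h2']; ring
  · rw [h0, h0', h3', h1']; ring

theorem IsShear.inv {α κ : ℂ} {g : SU31} {p s w ν : ℂ} (hν : ν ≠ 0) (hw : w ≠ 0)
    (h : IsShear α κ g p s w ν) : IsShear α κ g⁻¹ (-p) (-s) w⁻¹ ν⁻¹ := by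
  intro x
  obtain ⟨h3, h1, h2, h0⟩ := h (((g⁻¹ : SU31) : SL(4, ℂ)) • x)
  rw [InvMemClass.coe_inv, smul_inv_smul] at h3 h1 h2 h0
  rw [InvMemClass.coe_inv]
  refine ⟨?_, ?_, ?_, ?_⟩
  · rw [h3]; field_simp
  · rw [h1, h3]; field_simp; ring
  · rw [h2]; field_simp
  · rw [h0, h1, h3]; field_simp; ring

theorem IsShear.one (α κ : ℂ) : IsShear α κ 1 0 0 1 1 := by
  intro x
  rw [OneMemClass.coe_one, one_smul]
  refine ⟨?_, ?_, ?_, ?_⟩ <;> ring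

theorem IsShear.zpow {α κ : ℂ} {g : SU31} {p s w ν : ℂ} (hν : ν ≠ 0) (hw : w ≠ 0)
    (h : IsShear α κ g p s w ν) (k : ℤ) : IsShear α κ (g ^ k) (k * p) (k * s) (w ^ k) (ν ^ k) := by
  induction k using Int.induction_on with
  | zero => simpa using IsShear.one α κ
  | succ n ih =>
    have := ih.mul h
    rw [← zpow_add_one, ← zpow_add_one₀ hw, ← zpow_add_one₀ hν] at this
    convert this using 1 <;> push_cast <;> ring
  | pred n ih =>
    have := ih.mul (h.inv hν hw)
    rw [← zpow_sub_one, ← zpow_sub_one₀ hw, ← zpow_sub_one₀ hν] at this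
    convert this using 1 <;> push_cast <;> ring

/-- A nonzero last coordinate of an eigenvector would force the eigenvalue `ν` and then `p = s = 0`.
With last coordinate zero, nonpositive norm leaves only the line of the first basis vector. -/
theorem IsShear.isParabolic {α κ : ℂ} {g : SU31} {p s w ν : ℂ} (h : IsShear α κ g p s w ν)
    (hν : ν ≠ 0) (hps : p ≠ 0 ∨ s ≠ 0) : IsParabolic g := by
  have key : ∀ z : Fin 4 → ℂ, ∀ c : ℂ, (g : SL(4, ℂ)) • z = c • z → hnorm z ≤ 0 →
      z = z 0 • (Pi.single 0 1 : Fin 4 → ℂ) := by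
    intro z c hz hn
    obtain ⟨h3, h1, -, h0⟩ := h z
    obtain ⟨-, -, h2, -⟩ := h z
    rw [hz] at h3 h1 h2 h0
    simp only [Pi.smul_apply, smul_eq_mul] at h3 h1 h2 h0
    have hz3 : z 3 = 0 := by
      by_contra hz3
      have hc : c = ν := mul_right_cancel₀ hz3 h3
      subst hc
      have hp : p = 0 := by
        have : c * p * z 3 = 0 := by linear_combination -h1
        simpa [hν, hz3] using this
      have hs : s = 0 := by
        have : c * s * z 3 = 0 := by
          rw [hp] at h0
          linear_combination -h0
        simpa [hν, hz3] using this
      exact hps.elim (fun h => h hp) (fun h => h hs)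
    have h12 : z 1 = 0 ∧ z 2 = 0 := by
      simp only [hnorm, hz3, star_zero, mul_zero, Complex.zero_re, zero_add] at hn
      have h1 : ‖z 1‖ ^ 2 = 0 := by nlinarith [sq_nonneg ‖z 1‖, sq_nonneg ‖z 2‖]
      have h2 : ‖z 2‖ ^ 2 = 0 := by nlinarith [sq_nonneg ‖z 1‖, sq_nonneg ‖z 2‖]
      simpa using And.intro h1 h2
    ext j
    fin_cases j <;> simp [hz3, h12.1, h12.2]
  have he : (Pi.single 0 1 : Fin 4 → ℂ) ≠ 0 := by simp
  have hne : hnorm (Pi.single 0 1 : Fin 4 → ℂ) = 0 := by simp [hnorm]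
  refine ⟨fun q hq hfix => ?_, Projectivization.mk ℂ _ he,
    ⟨(mk_mem_bdryHC he).mpr hne, ?_⟩, fun q hq => ?_⟩
  · induction q using Projectivization.ind with
    | h z hz =>
    rw [mk_mem_HC] at hq
    obtain ⟨c, hc⟩ := (smul_mk_eq_iff _ hz).mp hfix
    rw [key z c hc hq.le, hnorm_const_smul, hne, mul_zero] at hq
    exact lt_irrefl _ hq
  · rw [smul_mk_eq_iff]
    obtain ⟨h3, h1, h2, h0⟩ := h (Pi.single 0 1)
    simp only [Pi.single_eq_same, Pi.single_apply, Fin.reduceEq, if_false, mul_zero, add_zero,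
      sub_zero, mul_one] at h3 h1 h2 h0
    rw [h3, mul_zero, add_zero] at h2
    rw [h3, h2] at h0
    refine ⟨ν, funext fun j => ?_⟩
    fin_cases j
    · simpa using h0
    · simpa using h1
    · simpa using h2
    · simpa using h3
  · obtain ⟨hq, hfix⟩ := hq
    induction q using Projectivization.ind with
    | h z hz =>
    rw [mk_mem_bdryHC] at hq
    obtain ⟨c, hc⟩ := (smul_mk_eq_iff _ hz).mp hfix
    rw [Projectivization.mk_eq_mk_iff']
    exact ⟨z 0, (key z c hc hq.le).symm⟩

theorem spinLin_translation (β : ℂ) (x : Fin 4 → ℂ) : spinLin !![1, β; 0, 1] x =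
    ![x 0 - (√2 * β.re : ℝ) * x 1 + (√2 * β.im : ℝ) * x 2 - (Complex.normSq β : ℝ) * x 3,
      x 1 + (√2 * β.re : ℝ) * x 3, x 2 - (√2 * β.im : ℝ) * x 3, x 3] := by
  have hs0 : ((√2 : ℝ) : ℂ) ≠ 0 := by simp
  have hs : ((√2 : ℝ) : ℂ) * ((√2 : ℝ) : ℂ) = 2 := by
    rw [← Complex.ofReal_mul, Real.mul_self_sqrt (by norm_num)]; simp
  have hc : (starRingEnd ℂ) β = β.re - β.im * Complex.I := by
    apply Complex.ext <;> simp
  have hn : ((Complex.normSq β : ℝ) : ℂ) = β.re * β.re + β.im * β.im := by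
    rw [Complex.normSq_apply]; push_cast; ring
  have hI := Complex.I_sq
  apply toHerm.injective
  rw [toHerm_spinLin, toHerm_entries, toHerm_entries]
  have hb : β = β.re + β.im * Complex.I := (Complex.re_add_im β).symm
  generalize β.re = a at *
  generalize β.im = b at *
  rw [hn]
  ext r s
  fin_cases r <;> fin_cases s <;> simp [Matrix.mul_apply, hc] <;> try rw [hb]
  · linear_combination (a * x 1 - b * x 2) * hs +
      (√2 * x 3 * b ^ 2 - 2 * x 2 * b) * hI
  · ring
  · ring

/-- With `u = v⁻⁴`, the constant `κ` solves `κ - u * b = u * κ`: it centres the rotation at its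
fixed point, which needs `u ≠ 1`. The constant `α` removes the remaining third-coordinate term, and
the factor `u + 1` survives in the vertical parameter. -/
theorem bendElt_mul_translation_isShear {v : Circle} (h : (v : ℂ) ^ 4 ≠ 1) {A : SL(2, ℂ)} {β : ℂ}
    (hA : A.1 = !![1, β; 0, 1]) {b : ℂ} (hb : b = √2 * β.im) :
    IsShear (-b / ((v ^ 4 : ℂ)⁻¹ - 1)) (-(v ^ 4 : ℂ)⁻¹ * b / ((v ^ 4 : ℂ)⁻¹ - 1))
      (bendElt v * spin A) (√2 * β.re)
      (b ^ 2 * ((v ^ 4 : ℂ)⁻¹ + 1) / (2 * ((v ^ 4 : ℂ)⁻¹ - 1))) (v ^ 4 : ℂ)⁻¹ v := by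
  intro x
  have hv : (v : ℂ) ≠ 0 := Circle.coe_ne_zero v
  have h1 : 1 - (v : ℂ) ^ 4 ≠ 0 := sub_ne_zero.mpr (Ne.symm h)
  have hs : ((√2 : ℝ) : ℂ) * ((√2 : ℝ) : ℂ) = 2 := by
    rw [← Complex.ofReal_mul, Real.mul_self_sqrt (by norm_num)]; simp
  have hn : ((Complex.normSq β : ℝ) : ℂ) = ((√2 * β.re) ^ 2 + b ^ 2) / 2 := by
    rw [Complex.normSq_apply, hb]; push_cast
    linear_combination -((β.re : ℂ) ^ 2 + (β.im : ℂ) ^ 2) / 2 * hs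
  have hu : ((v : ℂ) ^ 4)⁻¹ - 1 ≠ 0 := by
    rw [sub_ne_zero]
    exact fun h' => h (by rw [← inv_inv ((v : ℂ) ^ 4), h', inv_one])
  have hv3 : ((v : ℂ) ^ 3)⁻¹ = v * ((v : ℂ) ^ 4)⁻¹ := by field_simp
  rw [Subgroup.coe_mul, mul_smul, spin_smul, hA, spinLin_translation, bendElt_smul, hn, hv3]
  push_cast
  rw [← hb]
  obtain ⟨u, hu'⟩ : ∃ u, u = ((v : ℂ) ^ 4)⁻¹ := ⟨_, rfl⟩
  rw [← hu'] at hu ⊢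
  refine ⟨rfl, rfl, ?_, ?_⟩
  · field_simp; ring
  · field_simp; ring

theorem translation_add {R : Type*} [CommRing R] (a b : R) :
    translation (a + b) = translation a * translation b := by
  refine Subtype.ext (Matrix.ext fun r s => ?_)
  rw [Matrix.SpecialLinearGroup.coe_mul]
  fin_cases r <;> fin_cases s <;> simp [translation, Matrix.mul_apply, add_comm]

theorem translation_intCast_mul {R : Type*} [CommRing R] (k : ℤ) (a : R) :
    translation (k * a) = translation a ^ k := by
  let f : Multiplicative R →* SL(2, R) :=
    MonoidHom.mk' (fun a => translation a.toAdd) fun a b => translation_add a.toAdd b.toAdd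
  rw [← zsmul_eq_mul]
  exact map_zpow f (Multiplicative.ofAdd a) k

theorem translation_zero {R : Type*} [CommRing R] : translation (0 : R) = 1 := by
  refine Subtype.ext (Matrix.ext fun r s => ?_)
  fin_cases r <;> fin_cases s <;> simp [translation]

theorem translation_intCast_mem_modularGroup {d : ℕ} (l : ℤ) :
    (QuotientGroup.mk (translation (l : 𝓞 (Qd d))) : Bi d) ∈ modularGroup d := by
  refine ⟨translation l, ?_⟩
  change QuotientGroup.mk _ = _
  congr 1
  refine Subtype.ext (Matrix.ext fun r s => ?_)
  rw [Matrix.SpecialLinearGroup.map_apply_coe]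
  fin_cases r <;> fin_cases s <;> simp [translation]

theorem IsImaginaryOrder.exists_int_coords {d : ℕ} {lam : ℝ}
    (hO : IsImaginaryOrder (intEmb d).range lam) {ω : 𝓞 (Qd d)} (hω : (intEmb d ω).im = lam)
    (β : 𝓞 (Qd d)) : ∃ k l : ℤ, β = k * ω + l := by
  obtain ⟨k, hk⟩ := hO.im_mem ⟨β, rfl⟩
  obtain ⟨l, hl⟩ := hO.real_mem (x := intEmb d (β - k * ω)) ⟨_, rfl⟩ (by
    rw [map_sub, map_mul, map_intCast]
    simp [hk, hω])
  refine ⟨k, l, intEmb_injective d ?_⟩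
  rw [map_add, map_mul, map_intCast, map_intCast, ← hl, map_sub, map_mul, map_intCast]
  ring

/-! ### Parabolic elements under bending -/

variable {d : ℕ} {lam : ℝ}

/-- The elements on which `ρ` differs from the inclusion by a scalar. -/
def scalarSubgroup (ρ : Bi d →* SU31) : Subgroup (Bi d) where
  carrier := {γ | ∃ c : ℂ, ‖c‖ = 1 ∧ ∀ x : Fin 4 → ℂ, (ρ γ : SL(4, ℂ)) • x = c • γ • x}
  one_mem' := ⟨1, norm_one, fun x => by
    rw [map_one, OneMemClass.coe_one, one_smul, one_smul, one_smul]⟩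
  mul_mem' := by
    rintro γ γ' ⟨c, hc, h⟩ ⟨c', hc', h'⟩
    refine ⟨c * c', by rw [norm_mul, hc, hc', mul_one], fun x => ?_⟩
    rw [map_mul, Subgroup.coe_mul, mul_smul, h', h, bi_smul_const, smul_smul, smul_smul]
  inv_mem' := by
    rintro γ ⟨c, hc, h⟩
    have hc0 : c ≠ 0 := norm_ne_zero_iff.mp (by rw [hc]; exact one_ne_zero)
    refine ⟨c⁻¹, by rw [norm_inv, hc, inv_one], fun x => ?_⟩
    rw [map_inv, InvMemClass.coe_inv, inv_smul_eq_iff, h, bi_smul_const, smul_inv_smul,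
      smul_inv_smul₀ hc0]

theorem bending_translation_int (hO : IsImaginaryOrder (intEmb d).range lam) {v : Circle}
    {ρ : Bi d →* SU31} (hρ : IsBending (incl d) (bendElt v) ρ) (l : ℤ) :
    ρ (QuotientGroup.mk (translation (l : 𝓞 (Qd d)))) =
      incl d (QuotientGroup.mk (translation (l : 𝓞 (Qd d)))) :=
  ((isBending_iff hO v ρ).mp hρ).1 _ (modular_sameSide hO (translation_intCast_mem_modularGroup l))

theorem bending_translation_stable (hO : IsImaginaryOrder (intEmb d).range lam) {v : Circle}
    {ρ : Bi d →* SU31} (hρ : IsBending (incl d) (bendElt v) ρ) {ω : 𝓞 (Qd d)}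
    (hω : (intEmb d ω).im = lam) :
    ρ (QuotientGroup.mk (translation ω)) =
      bendElt v * incl d (QuotientGroup.mk (translation ω)) :=
  ((isBending_iff hO v ρ).mp hρ).2 _ (posPoint_sameSide hO hω)

theorem mk_translation_coords (k l : ℤ) (ω : 𝓞 (Qd d)) :
    (QuotientGroup.mk (translation (k * ω + l)) : Bi d) =
      QuotientGroup.mk (translation ω) ^ k * QuotientGroup.mk (translation (l : 𝓞 (Qd d))) := by
  rw [translation_add, translation_intCast_mul, QuotientGroup.mk_mul, QuotientGroup.mk_zpow]

theorem translation_mem_scalarSubgroup (hO : IsImaginaryOrder (intEmb d).range lam) {v : Circle}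
    (hv : (v : ℂ) ^ 4 = 1) {ρ : Bi d →* SU31} (hρ : IsBending (incl d) (bendElt v) ρ)
    (β : 𝓞 (Qd d)) : (QuotientGroup.mk (translation β) : Bi d) ∈ scalarSubgroup ρ := by
  obtain ⟨w, ⟨ω, rfl⟩, hω⟩ := hO.exists_im
  obtain ⟨k, l, rfl⟩ := hO.exists_int_coords hω β
  have h1 : (QuotientGroup.mk (translation ω) : Bi d) ∈ scalarSubgroup ρ := by
    refine ⟨v, Circle.norm_coe v, fun x => ?_⟩
    rw [bending_translation_stable hO hρ hω, Subgroup.coe_mul, mul_smul, bendElt_smul_eq,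
      ← bi_smul_def]
    have : ((v : ℂ) ^ 3)⁻¹ = v := by
      rw [inv_eq_of_mul_eq_one_right]
      linear_combination hv
    rw [this, sub_self, zero_mul, zero_smul, add_zero]
  have h2 : (QuotientGroup.mk (translation (l : 𝓞 (Qd d))) : Bi d) ∈ scalarSubgroup ρ :=
    ⟨1, norm_one, fun x => by rw [bending_translation_int hO hρ, one_smul, bi_smul_def]⟩
  rw [mk_translation_coords]
  exact mul_mem (zpow_mem h1 k) h2

/-- The shear parameter `s` of a bent stable letter. -/
def shearParam (lam : ℝ) (v : Circle) : ℂ :=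
  (√2 * lam) ^ 2 * ((v ^ 4 : ℂ)⁻¹ + 1) / (2 * ((v ^ 4 : ℂ)⁻¹ - 1))

theorem shearParam_ne_zero {v : Circle} (hlam : lam ≠ 0) (h : (v : ℂ) ^ 4 ≠ 1)
    (h' : (v : ℂ) ^ 4 ≠ -1) : shearParam lam v ≠ 0 := by
  have h1 : ((v : ℂ) ^ 4)⁻¹ - 1 ≠ 0 := by
    rw [sub_ne_zero]
    exact fun h' => h (by rw [← inv_inv ((v : ℂ) ^ 4), h', inv_one])
  have h2 : ((v : ℂ) ^ 4)⁻¹ + 1 ≠ 0 := by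
    intro h2
    exact h' (by rw [← inv_inv ((v : ℂ) ^ 4), eq_neg_of_add_eq_zero_left h2]; norm_num)
  have h3 : ((√2 : ℝ) : ℂ) ≠ 0 := by simp
  have h4 : (lam : ℂ) ≠ 0 := by exact_mod_cast hlam
  exact div_ne_zero (mul_ne_zero (pow_ne_zero 2 (mul_ne_zero h3 h4)) h2)
    (mul_ne_zero two_ne_zero h1)

theorem exists_translation_isShear (hO : IsImaginaryOrder (intEmb d).range lam) {v : Circle}
    (hv : (v : ℂ) ^ 4 ≠ 1) {ρ : Bi d →* SU31} (hρ : IsBending (incl d) (bendElt v) ρ)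
    {ω : 𝓞 (Qd d)} (hω : (intEmb d ω).im = lam) : ∃ α κ : ℂ, ∀ k l : ℤ,
      IsShear α κ (ρ (QuotientGroup.mk (translation (k * ω + l))))
        (√2 * (k * (intEmb d ω).re + l) : ℝ) (k * shearParam lam v)
        ((v ^ 4 : ℂ)⁻¹ ^ k) ((v : ℂ) ^ k) := by
  have hv0 : (v : ℂ) ≠ 0 := Circle.coe_ne_zero v
  obtain ⟨α, κ, h1⟩ : ∃ α κ : ℂ, IsShear α κ
      (bendElt v * incl d (QuotientGroup.mk (translation ω))) _ _ _ _ :=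
    ⟨_, _, bendElt_mul_translation_isShear hv (map_translation ω) rfl⟩
  rw [← bending_translation_stable hO hρ hω] at h1
  refine ⟨α, κ, fun k l => ?_⟩
  have h2 := h1.zpow hv0 (by simp [hv0]) k
  have h3 := h2.mul (g' := ρ (QuotientGroup.mk (translation (l : 𝓞 (Qd d)))))
    (p' := √2 * l) (s' := 0) (w' := 1) (ν' := 1) (by
      intro x
      rw [bending_translation_int hO hρ, incl_mk, spin_smul, map_translation, spinLin_translation]
      have hs : ((√2 : ℝ) : ℂ) ^ 2 = 2 := by
        rw [← Complex.ofReal_pow, Real.sq_sqrt (by norm_num)]; simp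
      refine ⟨?_, ?_, ?_, ?_⟩ <;> simp [Complex.normSq_apply]
      linear_combination (l : ℂ) ^ 2 * x 3 / 2 * hs)
  rw [← map_zpow, ← map_mul, ← mk_translation_coords] at h3
  convert h3 using 1
  · push_cast; ring
  · rw [shearParam, hω]; ring
  · ring
  · ring

/-- For `v ^ 4 = 1` the bending element is scalar and nothing changes projectively. Otherwise a
nonzero multiple `k` of `ω` is detected by the vertical parameter, where `v ^ 4 ≠ -1` enters, and a
rational integer by the horizontal one. -/
theorem isParabolic_translation (hO : IsImaginaryOrder (intEmb d).range lam) {β : 𝓞 (Qd d)}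
    (hβ : β ≠ 0) {v : Circle} (hv : (v : ℂ) ^ 4 ≠ -1) {ρ : Bi d →* SU31}
    (hρ : IsBending (incl d) (bendElt v) ρ)
    (hpar : IsParabolic (incl d (QuotientGroup.mk (translation β)))) :
    IsParabolic (ρ (QuotientGroup.mk (translation β))) := by
  by_cases h1 : (v : ℂ) ^ 4 = 1
  · obtain ⟨c, -, hc⟩ := translation_mem_scalarSubgroup hO h1 hρ β
    exact hpar.of_smul_eq hc
  · obtain ⟨w, ⟨ω, rfl⟩, hω⟩ := hO.exists_im
    obtain ⟨k, l, rfl⟩ := hO.exists_int_coords hω β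
    obtain ⟨α, κ, h⟩ := exists_translation_isShear hO h1 hρ hω
    refine (h k l).isParabolic (zpow_ne_zero _ (Circle.coe_ne_zero v)) ?_
    by_cases hk : k = 0
    · left
      subst hk
      have hl : (l : ℝ) ≠ 0 := by
        rintro hl
        have : l = 0 := by exact_mod_cast hl
        exact hβ (by rw [this]; simp)
      have hs : √2 ≠ 0 := by positivity
      rw [Ne, Complex.ofReal_eq_zero]
      simpa [hs] using hl
    · right
      exact mul_ne_zero (by exact_mod_cast hk)
        (shearParam_ne_zero (by linarith [hO.one_lt]) h1 hv)

theorem mk_eq_conj_translation {A C : SL(2, 𝓞 (Qd d))} {β : 𝓞 (Qd d)}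
    (h : A = C⁻¹ * translation β * C) : (QuotientGroup.mk A : Bi d) =
      (QuotientGroup.mk C)⁻¹ * QuotientGroup.mk (translation β) * QuotientGroup.mk C := by
  rw [h]; rfl

theorem IsParabolic.bending (hO : IsImaginaryOrder (intEmb d).range lam) {γ : Bi d}
    (hpar : IsParabolic (incl d γ)) {v : Circle} (hv : (v : ℂ) ^ 4 ≠ -1) {ρ : Bi d →* SU31}
    (hρ : IsBending (incl d) (bendElt v) ρ) : IsParabolic (ρ γ) := by
  obtain ⟨A, u, rfl, hA1, hu, hAu⟩ := exists_fixed_vector_of_isParabolic hpar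
  by_cases h : ∀ m, wallForm d m (nullVec (intEmb d ∘ u)) ≠ 0
  · obtain ⟨g, hg⟩ := exists_conj_sameSide_of_cusp hO h
    have h1 := hg _ (by rw [bi_smul_nullVec, hAu])
    rw [map_eq_conj (((isBending_iff hO v ρ).mp hρ).1 _ h1)]
    exact hpar.conj _
  · push Not at h
    obtain ⟨m, hm⟩ := h
    obtain ⟨C, hC⟩ := exists_mulVec_one_eq_zero_of_cusp hO hm
    obtain ⟨β, hβ⟩ := eq_translation_of_mulVec hu hAu hC
    have hβ0 : β ≠ 0 := by
      rintro rfl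
      rw [translation_zero, mul_one, inv_mul_cancel] at hβ
      exact hA1 hβ
    have e := mk_eq_conj_translation hβ
    have e' : (QuotientGroup.mk (translation β) : Bi d) =
        QuotientGroup.mk C * QuotientGroup.mk A * (QuotientGroup.mk C)⁻¹ := by
      rw [e]; group
    have h1 : IsParabolic (incl d (QuotientGroup.mk (translation β))) := by
      rw [e', map_mul, map_mul, map_inv]
      exact hpar.conj _
    have h2 := (isParabolic_translation hO hβ0 hv hρ h1).conj (ρ (QuotientGroup.mk C))⁻¹
    rw [e, map_mul, map_mul, map_inv]
    rwa [inv_inv] at h2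

theorem IsBoundaryElliptic.bending (hO : IsImaginaryOrder (intEmb d).range lam) {γ : Bi d}
    (hell : IsBoundaryElliptic (incl d γ)) {v : Circle} {ρ : Bi d →* SU31}
    (hρ : IsBending (incl d) (bendElt v) ρ) : IsBoundaryElliptic (ρ γ) := by
  obtain ⟨x, hx, hfix⟩ := exists_fixed_of_isBoundaryElliptic hell
  obtain ⟨g, hg⟩ := exists_conj_sameSide_of_fixed hO hx hfix
  rw [map_eq_conj (((isBending_iff hO v ρ).mp hρ).1 _ hg)]
  exact hell.conj _

theorem parabolicPreserving_of_isBending (hO : IsImaginaryOrder (intEmb d).range lam) {v : Circle}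
    (hv : (v : ℂ) ^ 4 ≠ -1) {ρ : Bi d →* SU31} (hρ : IsBending (incl d) (bendElt v) ρ) :
    ParabolicPreserving (incl d) ρ :=
  fun _ => ⟨fun h => h.bending hO hv hρ, fun h => h.bending hO hρ⟩

/-! ### Discreteness of the images of parabolic subgroups -/

theorem discreteTopology_of_conj_mem {G : Type*} [Group G] [TopologicalSpace G]
    [IsTopologicalGroup G] {K : Subgroup G} {U : Set G} (hU : IsOpen U) (h1 : (1 : G) ∈ U) (c : G)
    (h : ∀ g ∈ K, c⁻¹ * g * c ∈ U → g = 1) : DiscreteTopology K := by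
  apply discreteTopology_of_isOpen_singleton_one
  have hc : Continuous fun g : K => c⁻¹ * (g : G) * c := by fun_prop
  convert hU.preimage hc using 1
  ext g
  constructor
  · intro hg
    rw [Set.mem_singleton_iff] at hg
    subst hg
    have : c⁻¹ * ((1 : K) : G) * c ∈ U := by simpa using h1
    exact this
  · intro hg
    exact Subtype.ext (h g g.2 hg)

theorem continuous_entry (i j : Fin 4) : Continuous fun g : SU31 => (g : SL(4, ℂ)).1 i j :=
  have h : Continuous fun g : SL(4, ℂ) => (g : Matrix (Fin 4) (Fin 4) ℂ) := continuous_subtype_val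
  (h.matrix_elem i j).comp (continuous_subtype_val (p := (· ∈ SU31)))

theorem entry_eq_smul (g : SL(4, ℂ)) (i j : Fin 4) :
    g.1 i j = (g • (Pi.single j 1 : Fin 4 → ℂ)) i := by
  change _ = (g.1 *ᵥ _) i
  simp

namespace IsImaginaryOrder

theorem one_le_normSq {O : Subring ℂ} (hO : IsImaginaryOrder O lam) {x : ℂ} (hx : x ∈ O)
    (hx0 : x ≠ 0) : 1 ≤ Complex.normSq x := by
  obtain ⟨n, hn⟩ := hO.real_mem (mul_mem hx (hO.conj_mem hx)) (by
    rw [Complex.mul_conj]; exact Complex.ofReal_im _)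
  rw [Complex.mul_conj] at hn
  have hn' : Complex.normSq x = n := by exact_mod_cast hn
  have := Complex.normSq_pos.mpr hx0
  rw [hn'] at this ⊢
  have h0 : 0 < n := by exact_mod_cast this
  exact_mod_cast h0

/-- A unit has modulus one, and `lam > 1` leaves no room for a nonzero imaginary part. -/
theorem eq_one_or_neg_one {O : Subring ℂ} (hO : IsImaginaryOrder O lam) {x y : ℂ} (hx : x ∈ O)
    (hy : y ∈ O) (hxy : x * y = 1) : x = 1 ∨ x = -1 := by
  have hx0 : x ≠ 0 := left_ne_zero_of_mul_eq_one hxy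
  have hy0 : y ≠ 0 := right_ne_zero_of_mul_eq_one hxy
  have h1 := hO.one_le_normSq hx hx0
  have h2 := hO.one_le_normSq hy hy0
  have h3 : Complex.normSq x * Complex.normSq y = 1 := by rw [← map_mul, hxy, map_one]
  have h4 : Complex.normSq x = 1 := by nlinarith
  rw [Complex.normSq_apply] at h4
  obtain ⟨k, hk⟩ := hO.im_mem hx
  have him : x.im = 0 := by
    have hk0 : k = 0 := by
      by_contra hk0
      have hk1 : (1 : ℝ) ≤ (k : ℝ) ^ 2 := by
        have : 1 ≤ k ^ 2 :=
          (Int.one_le_abs (pow_ne_zero 2 hk0)).trans (abs_of_nonneg (sq_nonneg k)).le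
        exact_mod_cast this
      have hl := hO.one_lt
      have : x.im * x.im = (k : ℝ) ^ 2 * lam ^ 2 := by rw [hk]; ring
      nlinarith [mul_self_nonneg x.re, mul_le_mul hk1 (one_le_pow₀ hl.le (n := 2)) zero_le_one
        (sq_nonneg _)]
    rw [hk, hk0]; simp
  rw [him, mul_zero, add_zero] at h4
  rcases mul_self_eq_one_iff.mp h4 with h | h
  · left; apply Complex.ext <;> simp [h, him]
  · right; apply Complex.ext <;> simp [h, him]

end IsImaginaryOrder

theorem eigenvalue_mem_range {A : SL(2, 𝓞 (Qd d))} {u : Fin 2 → 𝓞 (Qd d)} (hu : u ≠ 0) {c : ℂ}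
    (h : (Matrix.SpecialLinearGroup.map (intEmb d) A).1 *ᵥ (intEmb d ∘ u) = c • (intEmb d ∘ u)) :
    c ∈ (intEmb d).range := by
  have hj : ∀ j, intEmb d ((A.1 *ᵥ u) j) = c * intEmb d (u j) := fun j =>
    (RingHom.map_mulVec (intEmb d) A.1 u j).trans (congrFun h j)
  have hmem : ∀ a : 𝓞 (Qd d), intEmb d a ∈ Qd d := fun a => (a : Qd d).2
  rw [mem_intEmb_range]
  constructor
  · obtain ⟨j, hne⟩ := Function.ne_iff.mp hu
    have hne' : intEmb d (u j) ≠ 0 := fun h => hne (intEmb_injective d (by simpa using h))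
    rw [← mul_div_cancel_right₀ c hne', ← hj]
    exact div_mem (hmem _) (hmem _)
  · have hq : c ^ 2 - intEmb d (A.1 0 0 + A.1 1 1) * c + 1 = 0 := by
      have hu' : intEmb d ∘ u ≠ 0 := by
        intro h0
        exact hu (funext fun j => intEmb_injective d (by simpa using congrFun h0 j))
      have hdet := (Matrix.exists_mulVec_eq_zero_iff
        (M := (Matrix.SpecialLinearGroup.map (intEmb d) A).1 - Matrix.scalar _ c)).mp
        ⟨_, hu', by
          rw [Matrix.sub_mulVec, h, sub_eq_zero]
          ext j
          simp [Matrix.mulVec_diagonal]⟩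
      have h1 := (Matrix.SpecialLinearGroup.map (intEmb d) A).2
      rw [Matrix.det_fin_two] at hdet h1
      rw [map_add]
      have e : ∀ i j, intEmb d (A.1 i j) = (Matrix.SpecialLinearGroup.map (intEmb d) A).1 i j :=
        fun i j => rfl
      rw [← e, ← e, ← e, ← e] at h1
      simp only [Matrix.sub_apply, Matrix.scalar_apply, Matrix.diagonal_apply, if_true,
        Fin.reduceEq, if_false, sub_zero] at hdet
      simp at hdet
      linear_combination hdet - h1
    have hint : IsIntegral (𝓞 (Qd d)) c := by
      refine ⟨Polynomial.X ^ 2 - Polynomial.C (A.1 0 0 + A.1 1 1) * Polynomial.X + Polynomial.C 1,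
        by monicity!, ?_⟩
      simpa [intEmb] using hq
    exact isIntegral_trans c hint

/-- The eigenvalue and its inverse lie in the field and are integral, so the eigenvalue is a unit,
hence `±1`; the sign is absorbed in the lift. Cusp stabilizers are therefore unipotent. -/
theorem exists_rep_of_fixed (hO : IsImaginaryOrder (intEmb d).range lam)
    {u : Fin 2 → 𝓞 (Qd d)} (hu : u ≠ 0) (hu' : intEmb d ∘ u ≠ 0) {γ : Bi d}
    (h : (incl d γ : SL(4, ℂ)) •
      Projectivization.mk ℂ (nullVec (intEmb d ∘ u)) (nullVec_ne_zero hu') =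
      Projectivization.mk ℂ (nullVec (intEmb d ∘ u)) (nullVec_ne_zero hu')) :
    ∃ A : SL(2, 𝓞 (Qd d)), γ = QuotientGroup.mk A ∧ A.1 *ᵥ u = u := by
  obtain ⟨A, rfl⟩ := exists_rep γ
  rw [incl_mk] at h
  obtain ⟨c, hc⟩ := exists_mulVec_of_smul_mk_nullVec hu' h
  have hc0 : c ≠ 0 := by
    rintro rfl
    rw [zero_smul] at hc
    apply hu'
    have e : ((Matrix.SpecialLinearGroup.map (intEmb d) A)⁻¹).1 *
        (Matrix.SpecialLinearGroup.map (intEmb d) A).1 = 1 := by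
      rw [← Matrix.SpecialLinearGroup.coe_mul, inv_mul_cancel, Matrix.SpecialLinearGroup.coe_one]
    rw [← Matrix.one_mulVec (intEmb d ∘ u), ← e, ← Matrix.mulVec_mulVec, hc, Matrix.mulVec_zero]
  have hinv : (Matrix.SpecialLinearGroup.map (intEmb d) A⁻¹).1 *ᵥ (intEmb d ∘ u) =
      c⁻¹ • (intEmb d ∘ u) := by
    have e : (Matrix.SpecialLinearGroup.map (intEmb d) A⁻¹).1 *
        (Matrix.SpecialLinearGroup.map (intEmb d) A).1 = 1 := by
      rw [← Matrix.SpecialLinearGroup.coe_mul, ← map_mul, inv_mul_cancel, map_one,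
        Matrix.SpecialLinearGroup.coe_one]
    conv_lhs => rw [← inv_smul_smul₀ hc0 (intEmb d ∘ u), ← hc, Matrix.mulVec_smul,
      Matrix.mulVec_mulVec, e, Matrix.one_mulVec]
  have hj : ∀ j, intEmb d ((A.1 *ᵥ u) j) = c * intEmb d (u j) := fun j =>
    (RingHom.map_mulVec (intEmb d) A.1 u j).trans (congrFun hc j)
  rcases hO.eq_one_or_neg_one (eigenvalue_mem_range hu hc) (eigenvalue_mem_range hu hinv)
    (mul_inv_cancel₀ hc0) with rfl | rfl
  · exact ⟨A, rfl, funext fun j => intEmb_injective d (by rw [hj, one_mul])⟩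
  · refine ⟨-A, (neg_rep A).symm, funext fun j => intEmb_injective d ?_⟩
    rw [Matrix.SpecialLinearGroup.coe_neg, Matrix.neg_mulVec, Pi.neg_apply, map_neg, hj]
    ring

/-- Up to sign, the two corner entries are the square moduli of the off-diagonal entries of a lift.
Being integers, they vanish, and a diagonal lift has entries `±1`. This is discreteness of the
unbent group. -/
theorem eq_one_of_entries (hO : IsImaginaryOrder (intEmb d).range lam) {γ : Bi d}
    (h30 : ‖(incl d γ : SL(4, ℂ)).1 3 0‖ < 1) (h03 : ‖(incl d γ : SL(4, ℂ)).1 0 3‖ < 1) :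
    γ = 1 := by
  obtain ⟨A, rfl⟩ := exists_rep γ
  have hs0 : ((√2 : ℝ) : ℂ) ≠ 0 := by simp
  have hzero : ∀ a : 𝓞 (Qd d), ‖((Complex.normSq (intEmb d a) : ℝ) : ℂ)‖ < 1 → a = 0 := by
    intro a ha
    by_contra hne
    have := hO.one_le_normSq ⟨a, rfl⟩ (fun h => hne (intEmb_injective d (by rw [h, map_zero])))
    rw [Complex.norm_real, Real.norm_of_nonneg (Complex.normSq_nonneg _)] at ha
    linarith
  have e : ∀ i j, (Matrix.SpecialLinearGroup.map (intEmb d) A).1 i j = intEmb d (A.1 i j) :=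
    fun i j => rfl
  have h10 : A.1 1 0 = 0 := by
    apply hzero
    rw [entry_eq_smul, incl_mk, spin_smul, spinLin_eq, toHerm_symm_entries, toHerm_entries] at h30
    convert h30 using 1
    rw [← norm_neg]
    congr 1
    simp [Matrix.mul_apply, ← Complex.mul_conj]
    field_simp
  have h01 : A.1 0 1 = 0 := by
    apply hzero
    rw [entry_eq_smul, incl_mk, spin_smul, spinLin_eq, toHerm_symm_entries, toHerm_entries] at h03
    convert h03 using 1
    rw [← norm_neg]
    congr 1
    simp [Matrix.mul_apply, ← Complex.mul_conj]
    field_simp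
  have hdet := A.2
  rw [Matrix.det_fin_two, h01, h10, mul_zero, sub_zero] at hdet
  have hprod : intEmb d (A.1 0 0) * intEmb d (A.1 1 1) = 1 := by rw [← map_mul, hdet, map_one]
  rcases hO.eq_one_or_neg_one ⟨_, rfl⟩ ⟨_, rfl⟩ hprod with h | h
  · have h00 : A.1 0 0 = 1 := intEmb_injective d (by rw [h, map_one])
    rw [h00, one_mul] at hdet
    have : A = 1 := by
      refine Subtype.ext (Matrix.ext fun r s => ?_)
      fin_cases r <;> fin_cases s <;> assumption
    rw [this, QuotientGroup.mk_one]
  · have h00 : A.1 0 0 = -1 := intEmb_injective d (by rw [h, map_neg, map_one])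
    rw [h00, neg_one_mul, neg_eq_iff_eq_neg] at hdet
    have : -A = 1 := by
      refine Subtype.ext (Matrix.ext fun r s => ?_)
      rw [Matrix.SpecialLinearGroup.coe_neg, Matrix.neg_apply]
      fin_cases r <;> fin_cases s <;> simp [h00, h01, h10, hdet]
    rw [← neg_rep, this, QuotientGroup.mk_one]

/-- Translations whose bent images are close to the identity are trivial. -/
theorem exists_isOpen_translation (hO : IsImaginaryOrder (intEmb d).range lam) {v : Circle}
    (hv : (v : ℂ) ^ 4 ≠ -1) {ρ : Bi d →* SU31} (hρ : IsBending (incl d) (bendElt v) ρ) :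
    ∃ U : Set SU31, IsOpen U ∧ 1 ∈ U ∧ ∀ β : 𝓞 (Qd d),
      ρ (QuotientGroup.mk (translation β)) ∈ U → β = 0 := by
  by_cases h1 : (v : ℂ) ^ 4 = 1
  · refine ⟨{g | ‖(g : SL(4, ℂ)).1 0 3‖ < 1},
      isOpen_lt (continuous_entry 0 3).norm continuous_const, ?_, fun β hβ => ?_⟩
    · change ‖(1 : Matrix (Fin 4) (Fin 4) ℂ) 0 3‖ < 1
      simp
    · obtain ⟨c, hc, h⟩ := translation_mem_scalarSubgroup hO h1 hρ β
      have hβ' : ‖(ρ (QuotientGroup.mk (translation β)) : SL(4, ℂ)).1 0 3‖ < 1 := hβ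
      rw [entry_eq_smul, h, bi_smul_def, incl_mk, spin_smul, map_translation,
        spinLin_translation] at hβ'
      simp [hc, abs_of_nonneg (Complex.normSq_nonneg _)] at hβ'
      by_contra hne
      have := hO.one_le_normSq ⟨β, rfl⟩ (fun h => hne (intEmb_injective d (by rw [h, map_zero])))
      linarith
  · obtain ⟨w, ⟨ω, rfl⟩, hω⟩ := hO.exists_im
    obtain ⟨α, κ, h⟩ := exists_translation_isShear hO h1 hρ hω
    have ht := shearParam_ne_zero (lam := lam) (by linarith [hO.one_lt]) h1 hv
    set t := shearParam lam v
    -- If `k ≠ 0`, then `‖t‖ ≤ ‖k * t‖ < ε + ε ^ 2 / 2 ≤ 3 * ε / 2 < ‖t‖`. If `k = 0`, then `√2 *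
    -- |l| < ε ≤ 1` forces `l = 0`.
    set ε : ℝ := min 1 (‖t‖ / 2) with hε
    have hε0 : 0 < ε := lt_min one_pos (by positivity)
    have hε1 : ε ≤ 1 := min_le_left _ _
    have hεt : ε ≤ ‖t‖ / 2 := min_le_right _ _
    -- On a shear this combination of entries isolates `ν * (s - p ^ 2 / 2)`, while entry `(1, 3)`
    -- is `ν * p`.
    let f : SU31 → ℂ := fun g => (g : SL(4, ℂ)).1 0 3 +
      α * ((g : SL(4, ℂ)).1 2 3 + κ * (g : SL(4, ℂ)).1 3 3) - α * κ * (g : SL(4, ℂ)).1 3 3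
    have hf : Continuous f := by
      have h0 := continuous_entry 0 3
      have h2 := continuous_entry 2 3
      have h3 := continuous_entry 3 3
      fun_prop
    refine ⟨{g | ‖(g : SL(4, ℂ)).1 1 3‖ < ε} ∩ {g | ‖f g‖ < ε},
      (isOpen_lt (continuous_entry 1 3).norm continuous_const).inter
        (isOpen_lt hf.norm continuous_const), ⟨?_, ?_⟩, fun β hβ => ?_⟩
    · change ‖(1 : Matrix (Fin 4) (Fin 4) ℂ) 1 3‖ < ε
      simpa using hε0
    · change ‖(1 : Matrix (Fin 4) (Fin 4) ℂ) 0 3 + α * ((1 : Matrix (Fin 4) (Fin 4) ℂ) 2 3 +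
        κ * (1 : Matrix (Fin 4) (Fin 4) ℂ) 3 3) - α * κ * (1 : Matrix (Fin 4) (Fin 4) ℂ) 3 3‖ < ε
      simpa using hε0
    · obtain ⟨k, l, rfl⟩ := hO.exists_int_coords hω β
      obtain ⟨hβ1, hβ2⟩ := hβ
      change ‖(ρ (QuotientGroup.mk (translation _)) : SL(4, ℂ)).1 1 3‖ < ε at hβ1
      change ‖(ρ (QuotientGroup.mk (translation _)) : SL(4, ℂ)).1 0 3 +
        α * ((ρ (QuotientGroup.mk (translation _)) : SL(4, ℂ)).1 2 3 +
          κ * (ρ (QuotientGroup.mk (translation _)) : SL(4, ℂ)).1 3 3) -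
        α * κ * (ρ (QuotientGroup.mk (translation _)) : SL(4, ℂ)).1 3 3‖ < ε at hβ2
      obtain ⟨e3, e1, -, e0⟩ := h k l (Pi.single 3 1)
      simp only [← entry_eq_smul] at e3 e1 e0
      rw [e1] at hβ1
      rw [e0, e3] at hβ2
      have hν : ‖(v : ℂ) ^ k‖ = 1 := by rw [norm_zpow, Circle.norm_coe, one_zpow]
      set p : ℝ := √2 * (k * (intEmb d ω).re + l) with hp
      have hp1 : |p| < ε := by
        simpa [norm_mul, hν] using hβ1
      have e : ∀ ν : ℂ, ν * ((Pi.single 3 1 : Fin 4 → ℂ) 0 + α * ((Pi.single 3 1 : Fin 4 → ℂ) 2 +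
          κ * (Pi.single 3 1 : Fin 4 → ℂ) 3) - p * (Pi.single 3 1 : Fin 4 → ℂ) 1 +
          (k * t - p ^ 2 / 2) * (Pi.single 3 1 : Fin 4 → ℂ) 3) -
          α * κ * (ν * (Pi.single 3 1 : Fin 4 → ℂ) 3) = ν * (k * t - p ^ 2 / 2) := by
        intro ν
        simp
        ring
      rw [e, norm_mul, hν, one_mul] at hβ2
      have hk : k = 0 := by
        by_contra hk
        have h1k : (1 : ℝ) ≤ ‖(k : ℂ)‖ := by
          rw [Complex.norm_intCast]
          exact_mod_cast Int.one_le_abs hk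
        have h2 : ‖(k : ℂ) * t‖ ≤ ‖(k : ℂ) * t - p ^ 2 / 2‖ + ‖((p : ℂ)) ^ 2 / 2‖ := by
          have := norm_add_le ((k : ℂ) * t - p ^ 2 / 2) ((p : ℂ) ^ 2 / 2)
          rwa [sub_add_cancel] at this
        have h3 : ‖((p : ℂ)) ^ 2 / 2‖ = |p| * |p| / 2 := by
          rw [norm_div, norm_pow, Complex.norm_real, Real.norm_eq_abs, sq]; simp
        rw [norm_mul] at h2
        nlinarith [abs_nonneg p, norm_nonneg t]
      subst hk
      have hl : l = 0 := by
        by_contra hl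
        have h1l : (1 : ℝ) ≤ |(l : ℝ)| := by exact_mod_cast Int.one_le_abs hl
        have hs1 : 1 ≤ √2 := Real.one_le_sqrt.mpr (by norm_num)
        rw [hp] at hp1
        simp [abs_mul, abs_of_nonneg (Real.sqrt_nonneg 2)] at hp1
        nlinarith
      rw [hl]; simp

/-- At a cusp on no wall, the stabilizer is conjugate into the region stabilizer, where `ρ` is the
inclusion. At a cusp on a wall, it is conjugate to a group of translations. -/
theorem discreteTopology_map_of_isParabolicSubgroup (hO : IsImaginaryOrder (intEmb d).range lam)
    {v : Circle} (hv : (v : ℂ) ^ 4 ≠ -1) {ρ : Bi d →* SU31}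
    (hρ : IsBending (incl d) (bendElt v) ρ) {Λ : Subgroup (Bi d)}
    (hΛ : IsParabolicSubgroup (incl d) Λ) : DiscreteTopology (Λ.map ρ) := by
  obtain ⟨p, hp, ⟨γ₀, hpar, hfix⟩, hstab⟩ := hΛ
  obtain ⟨A₀, u, rfl, -, hu, hAu⟩ := exists_fixed_vector_of_isParabolic hpar
  have hu' : intEmb d ∘ u ≠ 0 := fun h0 =>
    hu (funext fun j => intEmb_injective d (by simpa using congrFun h0 j))
  have hpk : p = Projectivization.mk ℂ (nullVec (intEmb d ∘ u)) (nullVec_ne_zero hu') := by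
    refine hpar.2.unique ⟨hp, hfix⟩ ⟨(mk_mem_bdryHC _).mpr (hnorm_nullVec _), ?_⟩
    rw [incl_mk]
    refine spin_smul_mk_nullVec hu' (c := 1) ?_
    rw [one_smul]
    refine funext fun j => ?_
    exact (RingHom.map_mulVec (intEmb d) A₀.1 u j).symm.trans (by rw [hAu]; rfl)
  have hrep : ∀ γ ∈ Λ, ∃ A : SL(2, 𝓞 (Qd d)), γ = QuotientGroup.mk A ∧ A.1 *ᵥ u = u := by
    intro γ hγ
    rw [hstab, hpk] at hγ
    exact exists_rep_of_fixed hO hu hu' hγ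
  by_cases h : ∀ m, wallForm d m (nullVec (intEmb d ∘ u)) ≠ 0
  · obtain ⟨g, hg⟩ := exists_conj_sameSide_of_cusp hO h
    refine discreteTopology_of_conj_mem
      (U := {g | ‖(g : SL(4, ℂ)).1 3 0‖ < 1} ∩ {g | ‖(g : SL(4, ℂ)).1 0 3‖ < 1})
      ((isOpen_lt (continuous_entry 3 0).norm continuous_const).inter
        (isOpen_lt (continuous_entry 0 3).norm continuous_const)) ⟨?_, ?_⟩ (ρ g) ?_
    · change ‖(1 : Matrix (Fin 4) (Fin 4) ℂ) 3 0‖ < 1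
      simp
    · change ‖(1 : Matrix (Fin 4) (Fin 4) ℂ) 0 3‖ < 1
      simp
    · rintro _ ⟨γ, hγ, rfl⟩ hU
      obtain ⟨A, rfl, hA⟩ := hrep γ hγ
      have h1 := hg _ (by rw [bi_smul_nullVec, hA])
      rw [← map_inv, ← map_mul, ← map_mul, ((isBending_iff hO v ρ).mp hρ).1 _ h1] at hU
      have h2 := eq_one_of_entries hO hU.1 hU.2
      have h3 := congrArg ρ h2
      rw [map_mul, map_mul, map_inv, map_one, mul_eq_one_iff_eq_inv, inv_mul_eq_iff_eq_mul,
        mul_inv_cancel] at h3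
      exact h3
  · push Not at h
    obtain ⟨m, hm⟩ := h
    obtain ⟨C, hC⟩ := exists_mulVec_one_eq_zero_of_cusp hO hm
    obtain ⟨U, hU, h1, hUβ⟩ := exists_isOpen_translation hO hv hρ
    refine discreteTopology_of_conj_mem hU h1 (ρ (QuotientGroup.mk C))⁻¹ ?_
    rintro _ ⟨γ, hγ, rfl⟩ hmem
    obtain ⟨A, rfl, hA⟩ := hrep γ hγ
    obtain ⟨β, rfl⟩ := eq_translation_of_mulVec hu hA hC
    have e : (ρ (QuotientGroup.mk C))⁻¹⁻¹ * ρ (QuotientGroup.mk (C⁻¹ * translation β * C)) *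
        (ρ (QuotientGroup.mk C))⁻¹ = ρ (QuotientGroup.mk (translation β)) := by
      rw [mk_eq_conj_translation rfl, map_mul, map_mul, map_inv]; group
    rw [e] at hmem
    rw [hUβ β hmem, translation_zero, mul_one, inv_mul_cancel, QuotientGroup.mk_one, map_one]

theorem stronglyParabolicPreserving_of_isBending (hO : IsImaginaryOrder (intEmb d).range lam)
    {v : Circle} (hv : (v : ℂ) ^ 4 ≠ -1) {ρ : Bi d →* SU31}
    (hρ : IsBending (incl d) (bendElt v) ρ) : StronglyParabolicPreserving (incl d) ρ :=
  ⟨parabolicPreserving_of_isBending hO hv hρ,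
    fun _ hΛ => discreteTopology_map_of_isParabolicSubgroup hO hv hρ hΛ⟩

end Bianchi

end

theorem theorem1p5 (d : ℕ) (hd : Squarefree d) (h1 : d ≠ 1) (h3 : d ≠ 3) :
    (∀ γ : Bianchi.Bi d,
      Bianchi.move (Bianchi.incl d) γ Bianchi.plane = Bianchi.plane ↔
        γ ∈ Bianchi.modularGroup d) ∧
    (∀ g : Bianchi.SU31,
      (∀ γ ∈ Bianchi.modularGroup d, Bianchi.incl d γ * g = g * Bianchi.incl d γ) ↔
        ∃ v : Circle, g = Bianchi.bendElt v) ∧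
    ∀ v : Circle,
      (∃! ρ : Bianchi.Bi d →* Bianchi.SU31,
        Bianchi.IsBending (Bianchi.incl d) (Bianchi.bendElt v) ρ) ∧
      ((v : ℂ) ^ 4 ≠ -1 → ∀ ρ : Bianchi.Bi d →* Bianchi.SU31,
        Bianchi.IsBending (Bianchi.incl d) (Bianchi.bendElt v) ρ →
          Bianchi.ParabolicPreserving (Bianchi.incl d) ρ ∧
          (d % 4 = 1 ∨ d % 4 = 2 →
            Bianchi.StronglyParabolicPreserving (Bianchi.incl d) ρ)) := by
  obtain ⟨lam, hO⟩ := Bianchi.isImaginaryOrder_range hd h1 h3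
  refine ⟨fun γ => Bianchi.move_plane_eq_iff hO γ, fun g => ⟨fun h =>
    Bianchi.exists_bendElt_of_commute h, ?_⟩, fun v => ⟨?_, fun hv ρ hρ =>
      ⟨Bianchi.parabolicPreserving_of_isBending hO hv hρ, fun _ =>
        Bianchi.stronglyParabolicPreserving_of_isBending hO hv hρ⟩⟩⟩
  · rintro ⟨v, rfl⟩ γ hγ
    exact Bianchi.incl_mul_bendElt hγ v
  · obtain ⟨ρ, hρ⟩ := Bianchi.exists_isBending hO v
    exact ⟨ρ, hρ, fun ρ' hρ' => Bianchi.isBending_unique hO hρ' hρ⟩
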